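/- There are absolute constants $C_1, C_2$ such that the following holds. Let ${\bf w}=({\bf w}^{(1)},\ldots,{\bf w}^{(m)})$ be a standard $m$-dimensional Wiener process on $[0,\hat T]$ with independent components on a probability space, with respect to a filtration $\{{\rm F}_s\}$ (i.e. ${\bf w}$ is adapted, ${\bf w}_0=0$ a.s., it has a.s. continuous paths and Gaussian increments, and ${\bf w}_s-{\bf w}_r$ is independent of ${\rm F}_r$ for $r\le s$). Let $0\le t<T\le\hat T$ and $i_1\ne i_2$ in $\{1,\ldots,m\}$. Let $$I=\int_t^T\int_t^s d{\bf w}^{(i_1)}_\tau\, d{\bf w}^{(i_2)}_s,\qquad A=\frac12\left(\int_t^T\int_t^s d{\bf w}^{(i_1)}_\tau\, d{\bf w}^{(i_2)}_s-\int_t^T\int_t^s d{\bf w}^{(i_2)}_\tau\, d{\bf w}^{(i_1)}_s\right)$$ be the iterated Itô integral and the Lévy stochastic area. For a sequence $\phi_0,\phi_1,\ldots$ of functions on $[t,T]$ write $\zeta^{(i)}_j=\int_t^T\phi_j(s)\,d{\bf w}^{(i)}_s$. (Legendre system) For $\phi_j(s)=\sqrt{\frac{2j+1}{T-t}}\,P_j\!\left(\left(s-t-\frac{T-t}{2}\right)\frac{2}{T-t}\right)$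 with the Legendre polynomials $P_j$, put $$A^q=\frac{T-t}{2}\sum_{i=1}^q\frac{1}{\sqrt{4i^2-1}}\left(\zeta^{(i_1)}_{i-1}\zeta^{(i_2)}_i-\zeta^{(i_1)}_i\zeta^{(i_2)}_{i-1}\right),\qquad I^q=\frac{T-t}{2}\zeta_0^{(i_1)}\zeta_0^{(i_2)}+A^q,$$ $$E_q=\frac{(T-t)^2}{2}\left(\frac12-\sum_{i=1}^q\frac1{4i^2-1}\right).$$ (Trigonometric system) For $\phi_0=\frac1{\sqrt{T-t}}$, $\phi_{2r-1}(s)=\sqrt{\frac{2}{T-t}}\sin\frac{2\pi r(s-t)}{T-t}$, $\phi_{2r}(s)=\sqrt{\frac{2}{T-t}}\cos\frac{2\pi r(s-t)}{T-t}$ ($r\ge1$), with the corresponding $\zeta_j^{(i)}$, put $$\hat A^q=\frac{T-t}{2\pi}\sum_{r=1}^q\frac1r\left(\zeta^{(i_1)}_{2r}\zeta^{(i_2)}_{2r-1}-\zeta^{(i_1)}_{2r-1}\zeta^{(i_2)}_{2r}+\sqrt2\left(\zeta^{(i_1)}_{2r-1}\zeta^{(i_2)}_0-\zeta^{(i_1)}_0\zeta^{(i_2)}_{2r-1}\right)\right),$$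 $$\hat I^q=\frac{T-t}{2}\zeta_0^{(i_1)}\zeta_0^{(i_2)}+\hat A^q,\qquad \hat E_q=\frac{3(T-t)^2}{2\pi^2}\left(\frac{\pi^2}{6}-\sum_{r=1}^q\frac1{r^2}\right).$$ Then all the stochastic integrals above exist, all the moments below are finite, and: 1. ${\sf M}\{(A-A^q)^2\}=E_q$ and ${\sf M}\{(A-\hat A^q)^2\}=\hat E_q$ for all $q\ge 0$; moreover ${\sf M}\{(A-A^q)^2\}\le C_1\frac{(T-t)^2}{q}$ and ${\sf M}\{(A-\hat A^q)^2\}\le C_2\frac{(T-t)^2}{q}$ for all $q\ge1$. 2. For every integer $n\ge1$ and every $q\ge 0$, with $C_{n,2}=(2!)^{2n}\,(n(2n-1))^{n}\,(2n-1)!!$, $${\sf M}\{(I-I^q)^{2n}\}\le C_{n,2}\,E_q^{\,n},\qquad {\sf M}\{(I-\hat I^q)^{2n}\}\le C_{n,2}\,\hat E_q^{\,n},$$ and both left-hand sides tend to $0$ as $q\to\infty$. 3. For every integer $n\ge1$, ${\sf M}\{(A-A^q)^{2n}\}\to0$ and ${\sf M}\{(A-\hat A^q)^{2n}\}\to0$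 as $q\to\infty$. 4. There is a constant $K$ independent of $q$ with ${\sf M}\{(I-I^q)^4\}={\sf M}\{(A-A^q)^4\}\le K/q^2$ for all $q\ge1$. 5. $A^q\to A$ as $q\to\infty$ with probability $1$. -/

import Mathlib

open MeasureTheory ProbabilityTheory Filter Topology

noncomputable section

namespace LevyArea

/-- `w` is a standard `m`-dimensional Wiener process on the time interval `[0, Θ]` with respect to
the filtration `ℱ`, with independent components `w i`. Only times in `[0, Θ]` matter: a filtration
indexed by `[0, Θ]` is regarded as one indexed by `ℝ` through any monotone extension. -/
structure IsWienerProcess {Ω : Type*} {mΩ : MeasurableSpace Ω} (μ : Measure Ω)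
    (ℱ : Filtration ℝ mΩ) (Θ : ℝ) {m : ℕ} (w : Fin m → ℝ → Ω → ℝ) : Prop where
  /-- `w` is adapted. -/
  adapted : ∀ i, ∀ s ∈ Set.Icc 0 Θ, Measurable[ℱ s] (w i s)
  /-- `w` starts at zero. -/
  zero : ∀ i, ∀ᵐ ω ∂μ, w i 0 ω = 0
  /-- The paths are continuous. -/
  continuous : ∀ i, ∀ᵐ ω ∂μ, ContinuousOn (fun s => w i s ω) (Set.Icc 0 Θ)
  /-- `w i s - w i r` has the normal distribution with mean `0` and variance `s - r`. -/
  increment_law : ∀ i, ∀ r s, 0 ≤ r → r ≤ s → s ≤ Θ →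
    HasLaw (fun ω => w i s ω - w i r ω) (gaussianReal 0 (s - r).toNNReal) μ
  /-- The increments over `[r, s]` are independent of the past `ℱ r`. -/
  increment_indep : ∀ r s, 0 ≤ r → r ≤ s → s ≤ Θ →
    Indep (MeasurableSpace.comap (fun ω (i : Fin m) => w i s ω - w i r ω) inferInstance)
      (ℱ r) μ
  /-- The components are independent processes. -/
  indep_components : iIndepFun (fun i ω (s : Set.Icc (0 : ℝ) Θ) => w i s ω) μ

/-- A step process on `[a, b]`: a partition `a = τ 0 ≤ τ 1 ≤ ... ≤ τ N = b` and square integrable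
`ℱ (τ k)`-measurable random variables `ξ k`, the values on `[τ k, τ (k + 1))`, `k < N`. -/
structure StepProcess {Ω : Type*} {mΩ : MeasurableSpace Ω} (μ : Measure Ω)
    (ℱ : Filtration ℝ mΩ) (a b : ℝ) where
  /-- the number of steps -/
  N : ℕ
  /-- the partition points -/
  τ : ℕ → ℝ
  mono : Monotone τ
  left : τ 0 = a
  right : τ N = b
  /-- the values -/
  ξ : ℕ → Ω → ℝ
  measurable : ∀ k < N, Measurable[ℱ (τ k)] (ξ k)
  memLp : ∀ k < N, MemLp (ξ k) 2 μ

namespace StepProcess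

variable {Ω : Type*} {mΩ : MeasurableSpace Ω} {μ : Measure Ω} {ℱ : Filtration ℝ mΩ} {a b : ℝ}

/-- The value of a step process at time `s`. -/
def value (Φ : StepProcess μ ℱ a b) (s : ℝ) (ω : Ω) : ℝ :=
  ∑ k ∈ Finset.range Φ.N, (Set.Ico (Φ.τ k) (Φ.τ (k + 1))).indicator (fun _ => Φ.ξ k ω) s

/-- The stochastic integral `∑ k, ξ k * (B (τ (k + 1)) - B (τ k))` of a step process. -/
def integral (Φ : StepProcess μ ℱ a b) (B : ℝ → Ω → ℝ) (ω : Ω) : ℝ :=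
  ∑ k ∈ Finset.range Φ.N, Φ.ξ k ω * (B (Φ.τ (k + 1)) ω - B (Φ.τ k) ω)

end StepProcess

section Ito

variable {Ω : Type*} {mΩ : MeasurableSpace Ω} (μ : Measure Ω) (ℱ : Filtration ℝ mΩ)

/-- `X` is (a version of) the Ito integral `∫_a^b f_s dB_s`: it is the mean-square limit of the
integrals of step processes `Φ n` with `∫_a^b E |f_s - (Φ n)_s|² ds → 0`. -/
def IsItoIntegral (B : ℝ → Ω → ℝ) (a b : ℝ) (f : ℝ → Ω → ℝ) (X : Ω → ℝ) : Prop :=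
  MemLp X 2 μ ∧ ∃ Φ : ℕ → StepProcess μ ℱ a b,
    Tendsto (fun n => ∫⁻ s in Set.Icc a b, ∫⁻ ω, ‖f s ω - (Φ n).value s ω‖ₑ ^ 2 ∂μ) atTop (𝓝 0) ∧
    Tendsto (fun n => ∫⁻ ω, ‖X ω - (Φ n).integral B ω‖ₑ ^ 2 ∂μ) atTop (𝓝 0)

/-- The process `f` has an Ito integral over `[a, b]`. -/
def ItoIntegrable (B : ℝ → Ω → ℝ) (a b : ℝ) (f : ℝ → Ω → ℝ) : Prop :=
  ∃ X : Ω → ℝ, IsItoIntegral μ ℱ B a b f X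

open Classical in
/-- (A version of) the Ito integral `∫_a^b f_s dB_s`. -/
def itoIntegral (B : ℝ → Ω → ℝ) (a b : ℝ) (f : ℝ → Ω → ℝ) : Ω → ℝ :=
  if h : ItoIntegrable μ ℱ B a b f then h.choose else 0

/-- The iterated Ito integral `I_{T,t}^{(12)} = ∫_t^T (∫_t^s dB₁) dB₂(s)`. -/
def iteratedIto (B₁ B₂ : ℝ → Ω → ℝ) (t T : ℝ) : Ω → ℝ :=
  itoIntegral μ ℱ B₂ t T (fun s => itoIntegral μ ℱ B₁ t s (fun _ _ => 1))

/-- The Levy stochastic area `A_{T,t}^{(12)} = (I_{T,t}^{(12)} - I_{T,t}^{(21)}) / 2`. -/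
def levyArea (B₁ B₂ : ℝ → Ω → ℝ) (t T : ℝ) (ω : Ω) : ℝ :=
  (1 / 2) * (iteratedIto μ ℱ B₁ B₂ t T ω - iteratedIto μ ℱ B₂ B₁ t T ω)

end Ito

/-- The Legendre polynomial `P_n(x) = (1 / (2^n n!)) (d/dx)^n (x² - 1)^n`. -/
def legendreP (n : ℕ) : Polynomial ℝ :=
  Polynomial.C (1 / (2 ^ n * (n.factorial : ℝ))) *
    (Polynomial.derivative)^[n] ((Polynomial.X ^ 2 - 1) ^ n)

/-- The complete orthonormal system of Legendre polynomials in `L²([t, T])`. -/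
def legendreBasis (t T : ℝ) (j : ℕ) (s : ℝ) : ℝ :=
  √((2 * j + 1) / (T - t)) * (legendreP j).eval ((s - t - (T - t) / 2) * (2 / (T - t)))

/-- The complete orthonormal trigonometric system in `L²([t, T])`: the constant for `j = 0`,
a sine for `j = 2 r - 1` and a cosine for `j = 2 r`, where `r ≥ 1`. -/
def trigBasis (t T : ℝ) (j : ℕ) (s : ℝ) : ℝ :=
  (1 / √(T - t)) *
    if j = 0 then 1
    else if Odd j then √2 * Real.sin (2 * Real.pi * ((j + 1) / 2 : ℕ) * (s - t) / (T - t))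
    else √2 * Real.cos (2 * Real.pi * (j / 2 : ℕ) * (s - t) / (T - t))

section Approximations

variable {Ω : Type*} {mΩ : MeasurableSpace Ω} (μ : Measure Ω) (ℱ : Filtration ℝ mΩ)

/-- `ζ_j = ∫_t^T φ_j(s) dB_s`. -/
def zeta (φ : ℕ → ℝ → ℝ) (B : ℝ → Ω → ℝ) (t T : ℝ) (j : ℕ) : Ω → ℝ :=
  itoIntegral μ ℱ B t T (fun s _ => φ j s)

/-- The truncation `A_{T,t}^{(12)q}` of the Legendre series of the Levy stochastic area. -/
def legendreArea (B₁ B₂ : ℝ → Ω → ℝ) (t T : ℝ) (q : ℕ) (ω : Ω) : ℝ :=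
  let ζ₁ : ℕ → ℝ := fun j => zeta μ ℱ (legendreBasis t T) B₁ t T j ω
  let ζ₂ : ℕ → ℝ := fun j => zeta μ ℱ (legendreBasis t T) B₂ t T j ω
  (T - t) / 2 * ∑ i ∈ Finset.Icc 1 q,
    1 / √(4 * (i : ℝ) ^ 2 - 1) * (ζ₁ (i - 1) * ζ₂ i - ζ₁ i * ζ₂ (i - 1))

/-- The truncation `Â_{T,t}^{(12)q}` of the trigonometric series of the Levy stochastic area. -/
def trigArea (B₁ B₂ : ℝ → Ω → ℝ) (t T : ℝ) (q : ℕ) (ω : Ω) : ℝ :=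
  let ζ₁ : ℕ → ℝ := fun j => zeta μ ℱ (trigBasis t T) B₁ t T j ω
  let ζ₂ : ℕ → ℝ := fun j => zeta μ ℱ (trigBasis t T) B₂ t T j ω
  (T - t) / (2 * Real.pi) * ∑ r ∈ Finset.Icc 1 q,
    1 / (r : ℝ) * (ζ₁ (2 * r) * ζ₂ (2 * r - 1) - ζ₁ (2 * r - 1) * ζ₂ (2 * r)
      + √2 * (ζ₁ (2 * r - 1) * ζ₂ 0 - ζ₁ 0 * ζ₂ (2 * r - 1)))

/-- The approximation `I_{T,t}^{(12)q} = (T - t) / 2 * ζ₀⁽¹⁾ ζ₀⁽²⁾ + A_{T,t}^{(12)q}` of the iterated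
Ito integral for the Legendre polynomials. -/
def legendreIto (B₁ B₂ : ℝ → Ω → ℝ) (t T : ℝ) (q : ℕ) (ω : Ω) : ℝ :=
  (T - t) / 2 * (zeta μ ℱ (legendreBasis t T) B₁ t T 0 ω *
    zeta μ ℱ (legendreBasis t T) B₂ t T 0 ω) + legendreArea μ ℱ B₁ B₂ t T q ω

/-- The approximation `I_{T,t}^{(12)q} = (T - t) / 2 * ζ₀⁽¹⁾ ζ₀⁽²⁾ + Â_{T,t}^{(12)q}` of the iterated
Ito integral for the trigonometric functions. -/
def trigIto (B₁ B₂ : ℝ → Ω → ℝ) (t T : ℝ) (q : ℕ) (ω : Ω) : ℝ :=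
  (T - t) / 2 * (zeta μ ℱ (trigBasis t T) B₁ t T 0 ω *
    zeta μ ℱ (trigBasis t T) B₂ t T 0 ω) + trigArea μ ℱ B₁ B₂ t T q ω

end Approximations

/-- `C_{n,k} = (k!)^{2n} (n (2n - 1))^{n (k - 1)} (2n - 1)!!`, for `n, k ≥ 1`. -/
def momentConst (n k : ℕ) : ℝ :=
  (k.factorial : ℝ) ^ (2 * n) * ((n : ℝ) * (2 * n - 1)) ^ (n * (k - 1)) *
    ((2 * n - 1).doubleFactorial : ℝ)

end LevyArea

end

open LevyArea

open scoped ENNReal NNReal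

namespace LevyArea

/-! ### Moments of bilinear forms in independent Gaussian vectors -/

section Chaos

/-! Every error in the theorem is almost surely a combination `chaosForm`: `α I⁽¹²⁾ + β I⁽²¹⁾` minus
finitely many products `c ζ⁽¹⁾ ζ⁽²⁾`. It is the double Wiener integral, against two independent
Brownian motions, of the kernel `K(u, v) = α 1_{u<v} + β 1_{v<u} - ∑ c p(u) r(v)`. Two facts about
it carry everything: its second moment is `E = ‖K‖²` in `L²([t, T]²)`, and its moment of degree `2n`
is at most `((2n - 1)!!)² E^n`. Both are contained in `chaosForm_moments`.

They are proved by discretization. On a uniform partition the form becomes a bilinear form in two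
independent vectors of Gaussian increments. Given the first vector it is a centred Gaussian in the
second, which gives one double factorial; Minkowski's inequality in `L^n` for the remaining sum of
squares gives the other (`lintegral_bilinear_pow_le`). For `n = 1` there is equality. The discrete
variances are Riemann sums for `‖K‖²` (`tendsto_gridKernel`). The discrete forms converge in `L¹`;
Fatou's lemma passes the bounds to the limit, and the uniform fourth moments upgrade the convergence
to `L²`, so that the second moment passes exactly (`moments_of_tendsto`).

For the Lévy area `α = -β = 1/2`. Subtracting part of an orthonormal expansion of the kernel leaves
`(T - t)²/4 - ∑ c²` (`kernelNormSq_orthonormal`), and the coefficients are the iterated integrals of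
pairs of basis functions. For Legendre polynomials only neighbouring degrees are used and the sum
telescopes; for the trigonometric system the Basel sum appears.

The kernel `1_{u<v} + 1_{v<u} - (T - t) φ₀(u) φ₀(v)` vanishes off the diagonal, so `I⁽¹²⁾ + I⁽²¹⁾ =
(T - t) ζ₀⁽¹⁾ ζ₀⁽²⁾` almost surely (`iteratedIto_add_swap`); hence `I` and `A` have the same error.
Finally `E = O(1/q)`, so fourth moments are `O(1/q²)`, which is summable and gives almost sure
convergence. -/

/-- Evenness reduces the integral to a Gamma integral at `n + 1/2`. For `n = 0` the truncated `2 * n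
- 1` is `0`, and `0!! = 1` is still the right value. -/
lemma integral_pow_gaussianReal_one (n : ℕ) :
    ∫ x, x ^ (2 * n) ∂(gaussianReal 0 1) = ((2 * n - 1).doubleFactorial : ℝ) := by
  rw [integral_gaussianReal_eq_integral_smul one_ne_zero]
  have h1 : ∀ x : ℝ, gaussianPDFReal 0 1 x • x ^ (2 * n) =
      (√(2 * Real.pi))⁻¹ * (|x| ^ ((2 * n : ℕ) : ℝ) * Real.exp (-(1 / 2) * |x| ^ (2 : ℝ))) := by
    intro x
    have e1 : |x| ^ ((2 * n : ℕ) : ℝ) = x ^ (2 * n) := by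
      rw [Real.rpow_natCast, pow_mul, sq_abs, ← pow_mul]
    have e2 : |x| ^ (2 : ℝ) = x ^ 2 := by
      rw [Real.rpow_two, sq_abs]
    rw [e1, e2, gaussianPDFReal]
    simp only [NNReal.coe_one, mul_one, sub_zero, smul_eq_mul]
    rw [show -x ^ 2 / 2 = -(1 / 2) * x ^ 2 by ring]
    ring
  simp_rw [h1]
  rw [integral_const_mul,
    integral_comp_abs (f := fun y => y ^ ((2 * n : ℕ) : ℝ) * Real.exp (-(1 / 2) * y ^ (2 : ℝ))),
    integral_rpow_mul_exp_neg_mul_rpow (by norm_num)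
      (lt_of_lt_of_le (by norm_num) (Nat.cast_nonneg _)) (by norm_num)]
  have h2 : (((2 * n : ℕ) : ℝ) + 1) / 2 = n + 1 / 2 := by push_cast; ring
  rw [h2, Real.Gamma_nat_add_half, neg_div, h2]
  have h3 : ((1 / 2 : ℝ)) ^ (-((n : ℝ) + 1 / 2)) = 2 ^ n * √2 := by
    rw [one_div, Real.inv_rpow (by norm_num), ← Real.rpow_neg (by norm_num), neg_neg,
      Real.rpow_add (by norm_num), Real.rpow_natCast, ← one_div, Real.sqrt_eq_rpow]
  rw [h3, Real.sqrt_mul (by norm_num)]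
  have : √Real.pi ≠ 0 := by positivity
  field_simp

lemma lintegral_pow_gaussianReal (v : ℝ≥0) (n : ℕ) :
    ∫⁻ x, ‖x‖ₑ ^ (2 * n) ∂(gaussianReal 0 v) =
      ((2 * n - 1).doubleFactorial : ℝ≥0∞) * (v : ℝ≥0∞) ^ n := by
  have h1 : ∫⁻ x, ‖x‖ₑ ^ (2 * n) ∂(gaussianReal 0 1) =
      ((2 * n - 1).doubleFactorial : ℝ≥0∞) := by
    have hint : Integrable (fun x : ℝ => x ^ (2 * n)) (gaussianReal 0 1) := by
      rcases Nat.eq_zero_or_pos n with rfl | hn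
      · simp
      have := (memLp_id_gaussianReal' (μ := 0) (v := 1) ((2 * n : ℕ) : ℝ≥0∞)
        (ENNReal.natCast_ne_top _)).integrable_norm_pow (by omega)
      simpa [pow_mul] using this
    rw [← ENNReal.ofReal_natCast, ← integral_pow_gaussianReal_one,
      ofReal_integral_eq_lintegral_ofReal hint
        (Eventually.of_forall fun x => by simp only [Pi.zero_apply]; rw [pow_mul]; positivity)]
    congr 1 with x
    rw [← enorm_pow, Real.enorm_eq_ofReal]
    rw [pow_mul]; positivity
  have h2 : gaussianReal 0 v = (gaussianReal 0 1).map (fun x => (√v) * x) := by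
    rw [gaussianReal_map_const_mul]
    congr 1
    · simp
    · ext; simp
  rw [h2, lintegral_map (by fun_prop) (by fun_prop)]
  simp_rw [enorm_mul, mul_pow]
  rw [lintegral_const_mul _ (by fun_prop), h1, mul_comm]
  congr 1
  rw [pow_mul, ← enorm_pow, Real.sq_sqrt v.coe_nonneg, Real.enorm_eq_ofReal v.coe_nonneg]
  simp

variable {Ω : Type*} {mΩ : MeasurableSpace Ω} {μ : Measure Ω}

lemma lintegral_pow_of_hasLaw_gaussian {X : Ω → ℝ} {v : ℝ≥0}
    (hX : HasLaw X (gaussianReal 0 v) μ) (n : ℕ) :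
    ∫⁻ ω, ‖X ω‖ₑ ^ (2 * n) ∂μ =
      ((2 * n - 1).doubleFactorial : ℝ≥0∞) * (v : ℝ≥0∞) ^ n := by
  rw [← lintegral_pow_gaussianReal, ← hX.lintegral_comp (by fun_prop)]

/-- All linear combinations `∑ k, c k * ξ k` are normal with mean `0` and variance
`v * ∑ k, (c k)²`. -/
def IsGaussianFamily {ι : Type*} [Fintype ι] (μ : Measure Ω) (v : ℝ≥0) (ξ : ι → Ω → ℝ) : Prop :=
  (∀ k, Measurable (ξ k)) ∧
  ∀ c : ι → ℝ, HasLaw (fun ω => ∑ k, c k * ξ k ω) (gaussianReal 0 (v * ∑ k, ‖c k‖₊ ^ 2)) μ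

lemma IsGaussianFamily.lintegral_pow {ι : Type*} [Fintype ι] {v : ℝ≥0} {ξ : ι → Ω → ℝ}
    (h : IsGaussianFamily μ v ξ) (c : ι → ℝ) (n : ℕ) :
    ∫⁻ ω, ‖∑ k, c k * ξ k ω‖ₑ ^ (2 * n) ∂μ =
      ((2 * n - 1).doubleFactorial : ℝ≥0∞) * (v * ∑ k, ‖c k‖ₑ ^ 2) ^ n := by
  rw [lintegral_pow_of_hasLaw_gaussian (h.2 c)]
  simp [enorm_eq_nnnorm]

variable [IsProbabilityMeasure μ] {ι κ : Type*} [Fintype ι] [Fintype κ]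

/-- The moments of a bilinear form in two independent Gaussian families, by conditioning on
the first one. -/
lemma lintegral_bilinear_pow {v : ℝ≥0} {ξ : ι → Ω → ℝ} {η : κ → Ω → ℝ}
    (hξ : IsGaussianFamily μ v ξ) (hη : IsGaussianFamily μ v η)
    (hind : IndepFun (fun ω k => ξ k ω) (fun ω k => η k ω) μ) (a : ι → κ → ℝ) (n : ℕ) :
    ∫⁻ ω, ‖∑ k, ∑ l, a k l * ξ k ω * η l ω‖ₑ ^ (2 * n) ∂μ =
      ((2 * n - 1).doubleFactorial : ℝ≥0∞) *
        ∫⁻ ω, (v * ∑ l, ‖∑ k, a k l * ξ k ω‖ₑ ^ 2) ^ n ∂μ := by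
  have hmξ : Measurable (fun ω k => ξ k ω) := measurable_pi_lambda _ hξ.1
  have hmη : Measurable (fun ω k => η k ω) := measurable_pi_lambda _ hη.1
  have hlaw := (indepFun_iff_map_prod_eq_prod_map_map hmξ.aemeasurable hmη.aemeasurable).1 hind
  have : IsProbabilityMeasure (μ.map fun ω k => η k ω) :=
    Measure.isProbabilityMeasure_map hmη.aemeasurable
  let F : (ι → ℝ) × (κ → ℝ) → ℝ≥0∞ := fun p => ‖∑ k, ∑ l, a k l * p.1 k * p.2 l‖ₑ ^ (2 * n)
  have hF : Measurable F := by fun_prop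
  calc ∫⁻ ω, ‖∑ k, ∑ l, a k l * ξ k ω * η l ω‖ₑ ^ (2 * n) ∂μ
      = ∫⁻ p, F p ∂(μ.map fun ω => (fun k => ξ k ω, fun k => η k ω)) :=
        (lintegral_map hF (hmξ.prodMk hmη)).symm
    _ = ∫⁻ x, ∫⁻ y, F (x, y) ∂(μ.map fun ω k => η k ω) ∂(μ.map fun ω k => ξ k ω) := by
        rw [hlaw, lintegral_prod _ hF.aemeasurable]
    _ = ∫⁻ x, ((2 * n - 1).doubleFactorial : ℝ≥0∞) * (v * ∑ l, ‖∑ k, a k l * x k‖ₑ ^ 2) ^ n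
          ∂(μ.map fun ω k => ξ k ω) := by
        congr 1 with x
        rw [lintegral_map (by fun_prop) hmη, ← hη.lintegral_pow]
        congr 1 with ω
        simp only [F]
        rw [Finset.sum_comm]
        simp_rw [Finset.sum_mul]
    _ = _ := by
        rw [lintegral_map (by fun_prop) hmξ, lintegral_const_mul]
        have := hξ.1
        fun_prop

/-- For `n = 1` the conditional formula is linear in the sum of squares, so nothing is lost. This is
what makes the mean-square errors exact. -/
lemma lintegral_bilinear_sq {v : ℝ≥0} {ξ : ι → Ω → ℝ} {η : κ → Ω → ℝ}
    (hξ : IsGaussianFamily μ v ξ) (hη : IsGaussianFamily μ v η)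
    (hind : IndepFun (fun ω k => ξ k ω) (fun ω k => η k ω) μ) (a : ι → κ → ℝ) :
    ∫⁻ ω, ‖∑ k, ∑ l, a k l * ξ k ω * η l ω‖ₑ ^ 2 ∂μ =
      v ^ 2 * ∑ k, ∑ l, ‖a k l‖ₑ ^ 2 := by
  have h := lintegral_bilinear_pow hξ hη hind a 1
  have hm := hξ.1
  simp only [mul_one, pow_one] at h
  rw [h, lintegral_const_mul _ (by fun_prop), lintegral_finsetSum _ (by fun_prop)]
  have : ∀ l, ∫⁻ ω, ‖∑ k, a k l * ξ k ω‖ₑ ^ 2 ∂μ = v * ∑ k, ‖a k l‖ₑ ^ 2 := fun l => by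
    simpa using hξ.lintegral_pow (fun k => a k l) 1
  simp_rw [this]
  rw [← Finset.mul_sum, Finset.sum_comm]
  simp [sq, mul_assoc]

/-- After conditioning, the `n`-th moment of a sum of squares of dependent Gaussians remains.
Minkowski's inequality in `L^n` separates the squares, and each has `L^n` norm `((2n - 1)!!)^(1/n)`
times its mean, so the dependence does not matter. -/
lemma lintegral_bilinear_pow_le {v : ℝ≥0} {ξ : ι → Ω → ℝ} {η : κ → Ω → ℝ}
    (hξ : IsGaussianFamily μ v ξ) (hη : IsGaussianFamily μ v η)
    (hind : IndepFun (fun ω k => ξ k ω) (fun ω k => η k ω) μ) (a : ι → κ → ℝ) {n : ℕ}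
    (hn : 1 ≤ n) :
    ∫⁻ ω, ‖∑ k, ∑ l, a k l * ξ k ω * η l ω‖ₑ ^ (2 * n) ∂μ ≤
      ((2 * n - 1).doubleFactorial : ℝ≥0∞) ^ 2 * (v ^ 2 * ∑ k, ∑ l, ‖a k l‖ₑ ^ 2) ^ n := by
  have hm := hξ.1
  have hn0 : n ≠ 0 := by omega
  rw [lintegral_bilinear_pow hξ hη hind a n, sq, mul_assoc]
  gcongr
  set D : ℝ≥0∞ := ((2 * n - 1).doubleFactorial : ℝ≥0∞) with hD
  -- The `L^n` norm of the square of a standard Gaussian.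
  set C : ℝ≥0∞ := D ^ (1 / (n : ℝ)) with hC
  have hCn : C ^ n = D := by
    rw [hC, ← ENNReal.rpow_natCast, ← ENNReal.rpow_mul, one_div,
      inv_mul_cancel₀ (by exact_mod_cast hn0), ENNReal.rpow_one]
  let f : κ → Ω → ℝ := fun l ω => (∑ k, a k l * ξ k ω) ^ 2
  have hf : ∀ l, AEStronglyMeasurable (f l) μ := fun l =>
    (by fun_prop : Measurable (f l)).aestronglyMeasurable
  have key : ∀ g : Ω → ℝ, eLpNorm g n μ ^ n = ∫⁻ ω, ‖g ω‖ₑ ^ n ∂μ := fun g => by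
    have := eLpNorm_nnreal_pow_eq_lintegral (μ := μ) (f := g) (p := (n : ℝ≥0))
      (by exact_mod_cast hn0)
    simpa using this
  have hfl : ∀ l, eLpNorm (f l) n μ ≤ C * (v * ∑ k, ‖a k l‖ₑ ^ 2) := fun l => by
    rw [← ENNReal.pow_le_pow_left_iff hn0, key, mul_pow, hCn, hD, ← hξ.lintegral_pow]
    simp [f, pow_mul]
  have hsum : eLpNorm (∑ l, f l) n μ ≤ C * (v * ∑ k, ∑ l, ‖a k l‖ₑ ^ 2) := by
    refine (eLpNorm_sum_le (fun l _ => hf l) (by exact_mod_cast hn)).trans ?_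
    refine (Finset.sum_le_sum fun l _ => hfl l).trans ?_
    rw [← Finset.mul_sum, ← Finset.mul_sum, Finset.sum_comm]
  have hsum' := pow_le_pow_left' hsum n
  rw [key, mul_pow, hCn] at hsum'
  calc ∫⁻ ω, (v * ∑ l, ‖∑ k, a k l * ξ k ω‖ₑ ^ 2) ^ n ∂μ
      = v ^ n * ∫⁻ ω, ‖(∑ l, f l) ω‖ₑ ^ n ∂μ := by
        simp_rw [mul_pow]
        rw [lintegral_const_mul _ (by fun_prop)]
        congr 2 with ω
        congr 1
        rw [Finset.sum_apply, Real.enorm_eq_ofReal (Finset.sum_nonneg fun l _ => sq_nonneg _),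
          ENNReal.ofReal_sum_of_nonneg fun l _ => sq_nonneg _]
        refine Finset.sum_congr rfl fun l _ => ?_
        rw [← enorm_pow, Real.enorm_eq_ofReal (sq_nonneg _)]
    _ ≤ v ^ n * (D * (v * ∑ k, ∑ l, ‖a k l‖ₑ ^ 2) ^ n) := by gcongr
    _ = D * (v ^ 2 * ∑ k, ∑ l, ‖a k l‖ₑ ^ 2) ^ n := by
        simp only [mul_pow]; ring

end Chaos

/-! ### The Itô isometry for step processes -/

section Isometry

variable {Ω : Type*} {mΩ : MeasurableSpace Ω} {μ : Measure Ω} {ℱ : Filtration ℝ mΩ} {Θ : ℝ}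
  {B : ℝ → Ω → ℝ}

lemma _root_.MeasureTheory.MemLp.integrable_fun_mul_two {f g : Ω → ℝ} (hf : MemLp f 2 μ)
    (hg : MemLp g 2 μ) : Integrable (fun ω => f ω * g ω) μ := hf.integrable_mul hg

/-- A one-dimensional Brownian motion on `[0, Θ]`, without path regularity. -/
structure IsBrownian (μ : Measure Ω) (ℱ : Filtration ℝ mΩ) (Θ : ℝ) (B : ℝ → Ω → ℝ) : Prop where
  adapted : ∀ s ∈ Set.Icc 0 Θ, Measurable[ℱ s] (B s)
  law : ∀ r s, 0 ≤ r → r ≤ s → s ≤ Θ →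
    HasLaw (fun ω => B s ω - B r ω) (gaussianReal 0 (s - r).toNNReal) μ
  indep : ∀ r s, 0 ≤ r → r ≤ s → s ≤ Θ →
    Indep (MeasurableSpace.comap (fun ω => B s ω - B r ω) inferInstance) (ℱ r) μ

lemma IsWienerProcess.isBrownian {m : ℕ} {w : Fin m → ℝ → Ω → ℝ}
    (hw : IsWienerProcess μ ℱ Θ w) (i : Fin m) : IsBrownian μ ℱ Θ (w i) where
  adapted := hw.adapted i
  law := hw.increment_law i
  indep r s hr hrs hs := by
    refine indep_of_indep_of_le_left (hw.increment_indep r s hr hrs hs) ?_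
    rintro _ ⟨A, hA, rfl⟩
    exact ⟨(fun x : Fin m → ℝ => x i) ⁻¹' A, measurable_pi_apply i hA, rfl⟩

variable {r s : ℝ}

lemma IsBrownian.measurable (hB : IsBrownian μ ℱ Θ B) (hs : 0 ≤ s) (hsΘ : s ≤ Θ) :
    Measurable (B s) := (hB.adapted s ⟨hs, hsΘ⟩).mono (ℱ.le s) le_rfl

lemma IsBrownian.lintegral_sq (hB : IsBrownian μ ℱ Θ B) (hr : 0 ≤ r) (hrs : r ≤ s)
    (hs : s ≤ Θ) : ∫⁻ ω, ‖B s ω - B r ω‖ₑ ^ 2 ∂μ = ENNReal.ofReal (s - r) := by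
  have := lintegral_pow_of_hasLaw_gaussian (hB.law r s hr hrs hs) 1
  simpa [ENNReal.ofReal] using this

lemma IsBrownian.memLp (hB : IsBrownian μ ℱ Θ B) (hr : 0 ≤ r) (hrs : r ≤ s) (hs : s ≤ Θ) :
    MemLp (fun ω => B s ω - B r ω) 2 μ := by
  have hl := hB.law r s hr hrs hs
  have := memLp_id_gaussianReal' (μ := 0) (v := (s - r).toNNReal) 2 (by norm_num)
  rw [← hl.map_eq] at this
  exact (memLp_map_measure_iff (by fun_prop) hl.aemeasurable).1 this

lemma IsBrownian.integral_increment (hB : IsBrownian μ ℱ Θ B) (hr : 0 ≤ r) (hrs : r ≤ s)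
    (hs : s ≤ Θ) : ∫ ω, (B s ω - B r ω) ∂μ = 0 := by
  rw [(hB.law r s hr hrs hs).integral_eq, integral_id_gaussianReal]

lemma IsBrownian.integral_increment_sq (hB : IsBrownian μ ℱ Θ B) (hr : 0 ≤ r) (hrs : r ≤ s)
    (hs : s ≤ Θ) : ∫ ω, (B s ω - B r ω) ^ 2 ∂μ = s - r := by
  have h := hB.lintegral_sq hr hrs hs
  have h2 := ofReal_integral_eq_lintegral_ofReal (hB.memLp hr hrs hs).integrable_sq
    (Eventually.of_forall fun ω => sq_nonneg _)
  have h3 : ∫⁻ ω, ENNReal.ofReal ((B s ω - B r ω) ^ 2) ∂μ = ∫⁻ ω, ‖B s ω - B r ω‖ₑ ^ 2 ∂μ := by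
    congr 1 with ω
    rw [← enorm_pow, Real.enorm_eq_ofReal (sq_nonneg _)]
  rw [h3, h] at h2
  exact (ENNReal.ofReal_eq_ofReal_iff (integral_nonneg fun ω => sq_nonneg _)
    (sub_nonneg.2 hrs)).1 h2

lemma IsBrownian.indepFun (hB : IsBrownian μ ℱ Θ B) (hr : 0 ≤ r) (hrs : r ≤ s)
    (hs : s ≤ Θ) {ξ : Ω → ℝ} (hξ : Measurable[ℱ r] ξ) :
    IndepFun ξ (fun ω => B s ω - B r ω) μ := by
  rw [IndepFun_iff_Indep]
  exact indep_of_indep_of_le_left (hB.indep r s hr hrs hs).symm hξ.comap_le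

lemma IsBrownian.memLp_mul (hB : IsBrownian μ ℱ Θ B) (hr : 0 ≤ r) (hrs : r ≤ s)
    (hs : s ≤ Θ) {ξ : Ω → ℝ} (hξ : Measurable[ℱ r] ξ) (hξ2 : MemLp ξ 2 μ) :
    MemLp (fun ω => ξ ω * (B s ω - B r ω)) 2 μ := by
  have hm : Measurable ξ := hξ.mono (ℱ.le r) le_rfl
  have hm2 := hB.measurable (hr.trans hrs) hs
  have hm3 := hB.measurable hr (hrs.trans hs)
  rw [memLp_two_iff_integrable_sq (by fun_prop)]
  have hi : IndepFun (fun ω => ξ ω ^ 2) (fun ω => (B s ω - B r ω) ^ 2) μ :=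
    (hB.indepFun hr hrs hs hξ).comp (φ := fun x => x ^ 2) (ψ := fun x => x ^ 2)
      (by fun_prop) (by fun_prop)
  have := hi.integrable_mul hξ2.integrable_sq (hB.memLp hr hrs hs).integrable_sq
  simpa [mul_pow, Pi.mul_def] using this

lemma IsBrownian.integral_mul (hB : IsBrownian μ ℱ Θ B) (hr : 0 ≤ r) (hrs : r ≤ s)
    (hs : s ≤ Θ) {ξ : Ω → ℝ} (hξ : Measurable[ℱ r] ξ) :
    ∫ ω, ξ ω * (B s ω - B r ω) ∂μ = 0 := by
  have hm : Measurable ξ := hξ.mono (ℱ.le r) le_rfl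
  have hm2 := hB.measurable (hr.trans hrs) hs
  have hm3 := hB.measurable hr (hrs.trans hs)
  rw [(hB.indepFun hr hrs hs hξ).integral_fun_mul_eq_mul_integral (by fun_prop) (by fun_prop),
    hB.integral_increment hr hrs hs, mul_zero]

lemma IsBrownian.integral_mul_sq (hB : IsBrownian μ ℱ Θ B) (hr : 0 ≤ r) (hrs : r ≤ s)
    (hs : s ≤ Θ) {ξ : Ω → ℝ} (hξ : Measurable[ℱ r] ξ) :
    ∫ ω, ξ ω * (B s ω - B r ω) ^ 2 ∂μ = (∫ ω, ξ ω ∂μ) * (s - r) := by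
  have hm : Measurable ξ := hξ.mono (ℱ.le r) le_rfl
  have hm2 := hB.measurable (hr.trans hrs) hs
  have hm3 := hB.measurable hr (hrs.trans hs)
  have hi : IndepFun ξ (fun ω => (B s ω - B r ω) ^ 2) μ :=
    (hB.indepFun hr hrs hs hξ).comp (φ := id) (ψ := fun x => x ^ 2) (by fun_prop) (by fun_prop)
  rw [hi.integral_fun_mul_eq_mul_integral (by fun_prop) (by fun_prop),
    hB.integral_increment_sq hr hrs hs]

/-- Everything except the later increment is known at time `c`, and that increment is centred and
independent of `ℱ c`. -/
lemma IsBrownian.integral_mul_mul_disjoint (hB : IsBrownian μ ℱ Θ B) {a b c d : ℝ} (ha : 0 ≤ a)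
    (hab : a ≤ b) (hbc : b ≤ c) (hcd : c ≤ d) (hd : d ≤ Θ) {ξ η : Ω → ℝ}
    (hξ : Measurable[ℱ a] ξ) (hη : Measurable[ℱ c] η) :
    ∫ ω, (ξ ω * (B b ω - B a ω)) * (η ω * (B d ω - B c ω)) ∂μ = 0 := by
  have hc : 0 ≤ c := (ha.trans hab).trans hbc
  have h1 : Measurable[ℱ c] (B b) :=
    (hB.adapted b ⟨ha.trans hab, by linarith⟩).mono (ℱ.mono hbc) le_rfl
  have h2 : Measurable[ℱ c] (B a) :=
    (hB.adapted a ⟨ha, by linarith⟩).mono (ℱ.mono (hab.trans hbc)) le_rfl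
  have h3 : Measurable[ℱ c] ξ := hξ.mono (ℱ.mono (hab.trans hbc)) le_rfl
  have := hB.integral_mul hc hcd hd (ξ := fun ω => (ξ ω * (B b ω - B a ω)) * η ω)
    ((h3.mul (h1.sub h2)).mul hη)
  rw [← this]
  congr 1 with ω
  ring

lemma IsBrownian.integral_mul_mul_left (hB : IsBrownian μ ℱ Θ B) {a b d : ℝ} (ha : 0 ≤ a)
    (hab : a ≤ b) (hbd : b ≤ d) (hd : d ≤ Θ) {ξ η : Ω → ℝ}
    (hξ : Measurable[ℱ a] ξ) (hη : Measurable[ℱ a] η) (hξ2 : MemLp ξ 2 μ) (hη2 : MemLp η 2 μ) :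
    ∫ ω, (ξ ω * (B b ω - B a ω)) * (η ω * (B d ω - B a ω)) ∂μ =
      (∫ ω, ξ ω * η ω ∂μ) * (b - a) := by
  have hη' : Measurable[ℱ b] η := hη.mono (ℱ.mono hab) le_rfl
  have i0 := hB.memLp_mul ha hab (hbd.trans hd) hξ hξ2
  have i1 := hB.memLp_mul ha hab (hbd.trans hd) hη hη2
  have i2 := hB.memLp_mul (ha.trans hab) hbd hd hη' hη2
  have h0 := hB.integral_mul_mul_disjoint ha hab le_rfl hbd hd hξ hη'
  have h1 := hB.integral_mul_sq ha hab (hbd.trans hd) (hξ.mul hη)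
  calc _ = ∫ ω, ((ξ ω * (B b ω - B a ω)) * (η ω * (B b ω - B a ω)) +
            (ξ ω * (B b ω - B a ω)) * (η ω * (B d ω - B b ω))) ∂μ := by
        congr 1 with ω; ring
    _ = _ := by
        rw [integral_add (i0.integrable_fun_mul_two i1) (i0.integrable_fun_mul_two i2), h0, add_zero]
        simp only [Pi.mul_apply] at h1
        rw [← h1]
        congr 1 with ω; ring

/-- If the intervals overlap, the first one is cut at `c`: the piece before `c` is orthogonal to the
second increment, and the rest has the same left endpoint as it. The factor `max 0 (min b d - max a
c)` is the length of the overlap. -/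
lemma IsBrownian.integral_mul_mul_of_le (hB : IsBrownian μ ℱ Θ B) {a b c d : ℝ} (ha : 0 ≤ a)
    (hab : a ≤ b) (hb : b ≤ Θ) (hac : a ≤ c) (hcd : c ≤ d) (hd : d ≤ Θ) {ξ η : Ω → ℝ}
    (hξ : Measurable[ℱ a] ξ) (hη : Measurable[ℱ c] η) (hξ2 : MemLp ξ 2 μ) (hη2 : MemLp η 2 μ) :
    ∫ ω, (ξ ω * (B b ω - B a ω)) * (η ω * (B d ω - B c ω)) ∂μ =
      (∫ ω, ξ ω * η ω ∂μ) * max 0 (min b d - max a c) := by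
  have hc := ha.trans hac
  rcases le_total b c with hbc | hcb
  · rw [hB.integral_mul_mul_disjoint ha hab hbc hcd hd hξ hη, max_eq_left, mul_zero]
    have := min_le_left b d
    have := le_max_right a c
    linarith
  · have hξ' : Measurable[ℱ c] ξ := hξ.mono (ℱ.mono hac) le_rfl
    have i0 := hB.memLp_mul ha hac (hcb.trans hb) hξ hξ2
    have i1 := hB.memLp_mul hc hcb hb hξ' hξ2
    have i2 := hB.memLp_mul hc hcd hd hη hη2
    have h0 := hB.integral_mul_mul_disjoint ha hac le_rfl hcd hd hξ hη
    have h1 : ∫ ω, (ξ ω * (B b ω - B c ω)) * (η ω * (B d ω - B c ω)) ∂μ =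
        (∫ ω, ξ ω * η ω ∂μ) * (min b d - c) := by
      rcases le_total b d with h | h
      · rw [hB.integral_mul_mul_left hc hcb h hd hξ' hη hξ2 hη2, min_eq_left h]
      · rw [min_eq_right h]
        have := hB.integral_mul_mul_left hc hcd h hb hη hξ' hη2 hξ2
        simp_rw [mul_comm (η _) (ξ _)] at this
        rw [← this]
        congr 1 with ω; ring
    rw [max_eq_right hac, max_eq_right (sub_nonneg.2 (le_min hcb hcd)), ← h1]
    conv_rhs => rw [← zero_add (∫ ω, _ ∂μ), ← h0]
    rw [← integral_add (i0.integrable_fun_mul_two i2) (i1.integrable_fun_mul_two i2)]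
    congr 1 with ω; ring

lemma IsBrownian.integral_mul_mul (hB : IsBrownian μ ℱ Θ B) {a b c d : ℝ} (ha : 0 ≤ a)
    (hab : a ≤ b) (hb : b ≤ Θ) (hc : 0 ≤ c) (hcd : c ≤ d) (hd : d ≤ Θ) {ξ η : Ω → ℝ}
    (hξ : Measurable[ℱ a] ξ) (hη : Measurable[ℱ c] η) (hξ2 : MemLp ξ 2 μ) (hη2 : MemLp η 2 μ) :
    ∫ ω, (ξ ω * (B b ω - B a ω)) * (η ω * (B d ω - B c ω)) ∂μ =
      (∫ ω, ξ ω * η ω ∂μ) * max 0 (min b d - max a c) := by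
  rcases le_total a c with h | h
  · exact hB.integral_mul_mul_of_le ha hab hb h hcd hd hξ hη hξ2 hη2
  · have := hB.integral_mul_mul_of_le hc hcd hd h hab hb hη hξ hη2 hξ2
    simp_rw [mul_comm (η _) (ξ _)] at this
    rw [min_comm b d, max_comm a c, ← this]
    congr 1 with ω; ring

lemma setIntegral_indicator_mul_indicator {a b a₁ b₁ : ℝ} (a₂ b₂ : ℝ) (h₁ : a ≤ a₁)
    (h₂ : b₁ ≤ b) :
    ∫ s in Set.Icc a b, (Set.Ico a₁ b₁).indicator (fun _ => (1 : ℝ)) s *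
        (Set.Ico a₂ b₂).indicator (fun _ => (1 : ℝ)) s = max 0 (min b₁ b₂ - max a₁ a₂) := by
  have h : ∀ s, (Set.Ico a₁ b₁).indicator (fun _ => (1 : ℝ)) s *
        (Set.Ico a₂ b₂).indicator (fun _ => (1 : ℝ)) s =
        (Set.Ico (max a₁ a₂) (min b₁ b₂)).indicator (fun _ => (1 : ℝ)) s := fun s => by
    rw [← Set.Ico_inter_Ico, ← Set.inter_indicator_mul]
    simp
  have hsub : Set.Ico (max a₁ a₂) (min b₁ b₂) ⊆ Set.Icc a b :=
    (Set.Ico_subset_Ico (h₁.trans (le_max_left _ _)) ((min_le_left _ _).trans h₂)).trans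
      Set.Ico_subset_Icc_self
  simp_rw [h]
  rw [setIntegral_indicator measurableSet_Ico, Set.inter_eq_self_of_subset_right hsub]
  simp [max_comm]

lemma lintegral_enorm_sum_sq {ι : Type*} (S : Finset ι) {X : ι → Ω → ℝ}
    (hX : ∀ k ∈ S, MemLp (X k) 2 μ) :
    ∫⁻ ω, ‖∑ k ∈ S, X k ω‖ₑ ^ 2 ∂μ =
      ENNReal.ofReal (∑ k ∈ S, ∑ l ∈ S, ∫ ω, X k ω * X l ω ∂μ) := by
  have h1 : ∫ ω, (∑ k ∈ S, X k ω) ^ 2 ∂μ = ∑ k ∈ S, ∑ l ∈ S, ∫ ω, X k ω * X l ω ∂μ := by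
    simp_rw [sq, Finset.sum_mul_sum]
    rw [integral_finsetSum _ fun k hk => integrable_finsetSum _ fun l hl =>
      (hX k hk).integrable_fun_mul_two (hX l hl)]
    exact Finset.sum_congr rfl fun k hk => integral_finsetSum _ fun l hl =>
      (hX k hk).integrable_fun_mul_two (hX l hl)
  rw [← h1, ofReal_integral_eq_lintegral_ofReal (memLp_finsetSum S hX).integrable_sq
    (Eventually.of_forall fun ω => sq_nonneg _)]
  congr 1 with ω
  rw [← enorm_pow, Real.enorm_eq_ofReal (sq_nonneg _)]

/-- The Ito isometry for finite sums of elementary integrals. -/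
lemma IsBrownian.lintegral_sum_sq (hB : IsBrownian μ ℱ Θ B) {a b : ℝ} (ha : 0 ≤ a)
    (hb : b ≤ Θ) {ι : Type*} (S : Finset ι) {α β : ι → ℝ} {ξ : ι → Ω → ℝ}
    (hα : ∀ k ∈ S, a ≤ α k) (hαβ : ∀ k ∈ S, α k ≤ β k) (hβ : ∀ k ∈ S, β k ≤ b)
    (hm : ∀ k ∈ S, Measurable[ℱ (α k)] (ξ k)) (hξ : ∀ k ∈ S, MemLp (ξ k) 2 μ) :
    ∫⁻ ω, ‖∑ k ∈ S, ξ k ω * (B (β k) ω - B (α k) ω)‖ₑ ^ 2 ∂μ =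
      ∫⁻ s in Set.Icc a b, ∫⁻ ω,
        ‖∑ k ∈ S, (Set.Ico (α k) (β k)).indicator (fun _ => ξ k ω) s‖ₑ ^ 2 ∂μ := by
  have h0 : ∀ k ∈ S, 0 ≤ α k := fun k hk => ha.trans (hα k hk)
  have h1 : ∀ k ∈ S, β k ≤ Θ := fun k hk => (hβ k hk).trans hb
  rw [lintegral_enorm_sum_sq S fun k hk =>
    hB.memLp_mul (h0 k hk) (hαβ k hk) (h1 k hk) (hm k hk) (hξ k hk)]
  -- Separating time from chance turns both sides into the same double sum of `E ξ_k ξ_l` times the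
  -- overlap of the intervals `k` and `l`.
  let J : ι → ℝ → ℝ := fun k s => (Set.Ico (α k) (β k)).indicator (fun _ => (1 : ℝ)) s
  have hJ : ∀ k s ω, (Set.Ico (α k) (β k)).indicator (fun _ => ξ k ω) s = J k s * ξ k ω := by
    intro k s ω
    by_cases hs : s ∈ Set.Ico (α k) (β k) <;> simp [J, hs]
  have h2 : ∀ s, ∫⁻ ω, ‖∑ k ∈ S, (Set.Ico (α k) (β k)).indicator (fun _ => ξ k ω) s‖ₑ ^ 2 ∂μ =
      ENNReal.ofReal (∑ k ∈ S, ∑ l ∈ S, (∫ ω, ξ k ω * ξ l ω ∂μ) * (J k s * J l s)) := by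
    intro s
    simp_rw [hJ]
    rw [lintegral_enorm_sum_sq S fun k hk => (hξ k hk).const_mul (J k s)]
    congr 1
    refine Finset.sum_congr rfl fun k _ => Finset.sum_congr rfl fun l _ => ?_
    rw [← integral_mul_const]
    congr 1 with ω; ring
  -- The double sum is a second moment; its sign is needed to move `ENNReal.ofReal` out of the time
  -- integral.
  have h3 : ∀ s, 0 ≤ ∑ k ∈ S, ∑ l ∈ S, (∫ ω, ξ k ω * ξ l ω ∂μ) * (J k s * J l s) := by
    intro s
    have : ∑ k ∈ S, ∑ l ∈ S, (∫ ω, ξ k ω * ξ l ω ∂μ) * (J k s * J l s) =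
        ∫ ω, (∑ k ∈ S, J k s * ξ k ω) ^ 2 ∂μ := by
      have i1 : ∀ k ∈ S, ∀ l ∈ S, Integrable (fun ω => J k s * ξ k ω * (J l s * ξ l ω)) μ :=
        fun k hk l hl => ((hξ k hk).const_mul _).integrable_fun_mul_two ((hξ l hl).const_mul _)
      simp_rw [sq, Finset.sum_mul_sum]
      rw [integral_finsetSum _ fun k hk => integrable_finsetSum _ fun l hl => i1 k hk l hl]
      refine Finset.sum_congr rfl fun k hk => ?_
      rw [integral_finsetSum _ fun l hl => i1 k hk l hl]
      refine Finset.sum_congr rfl fun l hl => ?_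
      rw [← integral_mul_const]
      congr 1 with ω; ring
    rw [this]
    exact integral_nonneg fun ω => sq_nonneg _
  have h4 : ∀ k l, Integrable (fun s => J k s * J l s) (volume.restrict (Set.Icc a b)) := by
    intro k l
    have : (fun s => J k s * J l s) =
        (Set.Ico (α k) (β k) ∩ Set.Ico (α l) (β l)).indicator (fun _ => (1 : ℝ)) := by
      ext s
      rw [show (fun _ : ℝ => (1 : ℝ)) = fun j => (fun _ => 1) j * (fun _ => 1) j by simp,
        Set.inter_indicator_mul]
    rw [this]
    exact (integrable_const _).indicator (measurableSet_Ico.inter measurableSet_Ico)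
  simp_rw [h2]
  rw [← ofReal_integral_eq_lintegral_ofReal
    (integrable_finsetSum _ fun k _ => integrable_finsetSum _ fun l _ => (h4 k l).const_mul _)
    (Eventually.of_forall h3)]
  congr 1
  rw [integral_finsetSum _ fun k _ => integrable_finsetSum _ fun l _ => (h4 k l).const_mul _]
  refine Finset.sum_congr rfl fun k hk => ?_
  rw [integral_finsetSum _ fun l _ => (h4 k l).const_mul _]
  refine Finset.sum_congr rfl fun l hl => ?_
  rw [hB.integral_mul_mul (h0 k hk) (hαβ k hk) (h1 k hk) (h0 l hl) (hαβ l hl) (h1 l hl)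
    (hm k hk) (hm l hl) (hξ k hk) (hξ l hl), integral_const_mul,
    setIntegral_indicator_mul_indicator _ _ (hα k hk) (hβ k hk)]

variable {a b : ℝ}

lemma StepProcess.mem_Icc (Φ : StepProcess μ ℱ a b) {k : ℕ} (hk : k ≤ Φ.N) :
    Φ.τ k ∈ Set.Icc a b :=
  ⟨Φ.left.symm.le.trans (Φ.mono (Nat.zero_le k)), (Φ.mono hk).trans Φ.right.le⟩

/-- The two partitions need no common refinement: the difference is one sum over the disjoint union
of the index sets, with the second family negated, and `lintegral_sum_sq` allows arbitrary
overlapping intervals. -/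
lemma IsBrownian.lintegral_integral_sub_sq (hB : IsBrownian μ ℱ Θ B) (ha : 0 ≤ a)
    (hb : b ≤ Θ) (Φ Ψ : StepProcess μ ℱ a b) :
    ∫⁻ ω, ‖Φ.integral B ω - Ψ.integral B ω‖ₑ ^ 2 ∂μ =
      ∫⁻ s in Set.Icc a b, ∫⁻ ω, ‖Φ.value s ω - Ψ.value s ω‖ₑ ^ 2 ∂μ := by
  have h := hB.lintegral_sum_sq ha hb ((Finset.range Φ.N).disjSum (Finset.range Ψ.N))
    (α := Sum.elim Φ.τ Ψ.τ) (β := Sum.elim (fun k => Φ.τ (k + 1)) (fun k => Ψ.τ (k + 1)))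
    (ξ := Sum.elim Φ.ξ (fun k ω => - Ψ.ξ k ω)) ?_ ?_ ?_ ?_ ?_
  · simp only [Finset.sum_disjSum, Sum.elim_inl, Sum.elim_inr] at h
    convert h using 4 with ω s
    · simp only [StepProcess.integral, neg_mul, Finset.sum_neg_distrib, sub_eq_add_neg]
    · congr 3 with ω
      simp only [StepProcess.value, sub_eq_add_neg, ← Finset.sum_neg_distrib]
      congr 4 with k
      by_cases hs : s ∈ Set.Ico (Ψ.τ k) (Ψ.τ (k + 1)) <;> simp [hs]
  · rintro (k | k) hk <;> simp only [Finset.inl_mem_disjSum, Finset.inr_mem_disjSum,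
      Finset.mem_range] at hk
    · exact (Φ.mem_Icc hk.le).1
    · exact (Ψ.mem_Icc hk.le).1
  · rintro (k | k) hk
    · exact Φ.mono (Nat.le_succ k)
    · exact Ψ.mono (Nat.le_succ k)
  · rintro (k | k) hk <;> simp only [Finset.inl_mem_disjSum, Finset.inr_mem_disjSum,
      Finset.mem_range] at hk
    · exact (Φ.mem_Icc (Nat.succ_le_of_lt hk)).2
    · exact (Ψ.mem_Icc (Nat.succ_le_of_lt hk)).2
  · rintro (k | k) hk <;> simp only [Finset.inl_mem_disjSum, Finset.inr_mem_disjSum,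
      Finset.mem_range] at hk
    · exact Φ.measurable k hk
    · exact (Ψ.measurable k hk).neg
  · rintro (k | k) hk <;> simp only [Finset.inl_mem_disjSum, Finset.inr_mem_disjSum,
      Finset.mem_range] at hk
    · exact Φ.memLp k hk
    · exact (Ψ.memLp k hk).neg

end Isometry

/-! ### Existence of Itô integrals and control of an arbitrary version -/

section Existence

variable {Ω : Type*} {mΩ : MeasurableSpace Ω} {μ : Measure Ω} {ℱ : Filtration ℝ mΩ} {Θ : ℝ}
  {B : ℝ → Ω → ℝ} {a b : ℝ}

lemma eLpNorm_two_sq (g : Ω → ℝ) : eLpNorm g 2 μ ^ 2 = ∫⁻ ω, ‖g ω‖ₑ ^ 2 ∂μ := by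
  have := eLpNorm_nnreal_pow_eq_lintegral (μ := μ) (f := g) (p := 2) (by norm_num)
  simpa using this

lemma enorm_sub_sq_le (x y z : ℝ) : ‖x - z‖ₑ ^ 2 ≤ 2 * ‖x - y‖ₑ ^ 2 + 2 * ‖y - z‖ₑ ^ 2 := by
  simp only [← enorm_pow, Real.enorm_eq_ofReal (sq_nonneg _)]
  rw [show (2 : ℝ≥0∞) = ENNReal.ofReal 2 by simp, ← ENNReal.ofReal_mul (by norm_num),
    ← ENNReal.ofReal_mul (by norm_num), ← ENNReal.ofReal_add (by positivity) (by positivity)]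
  exact ENNReal.ofReal_le_ofReal (by nlinarith [sq_nonneg ((x - y) - (y - z))])

lemma lintegral_sub_sq_le {X Y Z : Ω → ℝ} (hX : AEMeasurable X μ) (hY : AEMeasurable Y μ) :
    ∫⁻ ω, ‖X ω - Z ω‖ₑ ^ 2 ∂μ ≤
      2 * ∫⁻ ω, ‖X ω - Y ω‖ₑ ^ 2 ∂μ + 2 * ∫⁻ ω, ‖Y ω - Z ω‖ₑ ^ 2 ∂μ := by
  calc ∫⁻ ω, ‖X ω - Z ω‖ₑ ^ 2 ∂μ
      ≤ ∫⁻ ω, (2 * ‖X ω - Y ω‖ₑ ^ 2 + 2 * ‖Y ω - Z ω‖ₑ ^ 2) ∂μ :=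
        lintegral_mono fun ω => enorm_sub_sq_le _ _ _
    _ = _ := by
        rw [lintegral_add_left' (by fun_prop), lintegral_const_mul' _ _ (by simp),
          lintegral_const_mul' _ _ (by simp)]

lemma StepProcess.aemeasurable_value (Φ : StepProcess μ ℱ a b) (s : ℝ) :
    AEMeasurable (Φ.value s) μ := by
  unfold StepProcess.value
  refine Finset.aemeasurable_fun_sum _ fun k hk => ?_
  have := (Φ.memLp k (Finset.mem_range.1 hk)).aemeasurable
  by_cases hs : s ∈ Set.Ico (Φ.τ k) (Φ.τ (k + 1))
  · simpa [hs] using this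
  · simp [hs]

lemma StepProcess.memLp_integral (hB : IsBrownian μ ℱ Θ B) (ha : 0 ≤ a) (hb : b ≤ Θ)
    (Φ : StepProcess μ ℱ a b) : MemLp (Φ.integral B) 2 μ := by
  refine memLp_finsetSum _ fun k hk => ?_
  have hk := Finset.mem_range.1 hk
  exact hB.memLp_mul (ha.trans (Φ.mem_Icc hk.le).1) (Φ.mono (Nat.le_succ k))
    ((Φ.mem_Icc (Nat.succ_le_of_lt hk)).2.trans hb) (Φ.measurable k hk) (Φ.memLp k hk)

lemma StepProcess.exists_value_eq (Φ : StepProcess μ ℱ a b) {s : ℝ} (hs : s ∈ Set.Ico a b) :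
    ∃ k < Φ.N, s ∈ Set.Ico (Φ.τ k) (Φ.τ (k + 1)) ∧ ∀ ω, Φ.value s ω = Φ.ξ k ω := by
  have hex : ∃ n, s < Φ.τ (n + 1) :=
    ⟨Φ.N, hs.2.trans_le (Φ.right.symm.le.trans (Φ.mono (Nat.le_succ _)))⟩
  classical
  -- Partition points may coincide; the least such `k` picks the nonempty interval that contains
  -- `s`.
  obtain ⟨k, hk, hmin⟩ : ∃ k, s < Φ.τ (k + 1) ∧ ∀ j < k, ¬ s < Φ.τ (j + 1) :=
    ⟨Nat.find hex, Nat.find_spec hex, fun j hj => Nat.find_min hex hj⟩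
  have hle : Φ.τ k ≤ s := by
    rcases Nat.eq_zero_or_pos k with rfl | hpos
    · exact Φ.left.le.trans hs.1
    · have := hmin (k - 1) (by omega)
      rwa [Nat.sub_add_cancel hpos, not_lt] at this
  have hkN : k < Φ.N := by
    by_contra h
    exact absurd (hle.trans_lt hs.2) (not_lt.2 (Φ.right.symm.le.trans (Φ.mono (not_lt.1 h))))
  refine ⟨k, hkN, ⟨hle, hk⟩, fun ω => ?_⟩
  rw [StepProcess.value, Finset.sum_eq_single k]
  · rw [Set.indicator_of_mem (show s ∈ Set.Ico (Φ.τ k) (Φ.τ (k + 1)) from ⟨hle, hk⟩)]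
  · intro j _ hjk
    refine Set.indicator_of_notMem (fun hj => ?_) _
    have := Φ.mono.pairwise_disjoint_on_Ico_succ hjk
    exact Set.disjoint_left.1 this hj ⟨hle, hk⟩
  · intro h
    exact absurd (Finset.mem_range.2 hkN) h

/-- The endpoint `b` has to be discarded as a null set, because step processes built from half-open
intervals vanish there. -/
lemma lintegral_Icc_le {g : ℝ → ℝ≥0∞} {ε : ℝ≥0∞} (hg : ∀ s ∈ Set.Ico a b, g s ≤ ε) :
    ∫⁻ s in Set.Icc a b, g s ≤ ε * ENNReal.ofReal (b - a) := by
  rw [setLIntegral_congr (Ico_ae_eq_Icc (a := a) (b := b)).symm]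
  calc ∫⁻ s in Set.Ico a b, g s ≤ ∫⁻ _ in Set.Ico a b, ε := setLIntegral_mono measurable_const hg
    _ = _ := by simp

/-- The isometry replaces the integrals by the step processes themselves, which are compared through
`f`. -/
lemma IsBrownian.lintegral_integral_sub_le (hB : IsBrownian μ ℱ Θ B) (ha : 0 ≤ a)
    (hb : b ≤ Θ) {f : ℝ → Ω → ℝ} (hf : ∀ s ∈ Set.Ico a b, AEMeasurable (f s) μ)
    (Φ Ψ : StepProcess μ ℱ a b) {ε : ℝ≥0∞}
    (hΨ : ∀ s ∈ Set.Ico a b, ∫⁻ ω, ‖f s ω - Ψ.value s ω‖ₑ ^ 2 ∂μ ≤ ε) :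
    ∫⁻ ω, ‖Φ.integral B ω - Ψ.integral B ω‖ₑ ^ 2 ∂μ ≤
      2 * (∫⁻ s in Set.Icc a b, ∫⁻ ω, ‖f s ω - Φ.value s ω‖ₑ ^ 2 ∂μ) +
        2 * (ε * ENNReal.ofReal (b - a)) := by
  rw [hB.lintegral_integral_sub_sq ha hb,
    setLIntegral_congr (Ico_ae_eq_Icc (a := a) (b := b)).symm,
    setLIntegral_congr (Ico_ae_eq_Icc (a := a) (b := b)).symm]
  calc ∫⁻ s in Set.Ico a b, ∫⁻ ω, ‖Φ.value s ω - Ψ.value s ω‖ₑ ^ 2 ∂μ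
      ≤ ∫⁻ s in Set.Ico a b, (2 * (∫⁻ ω, ‖f s ω - Φ.value s ω‖ₑ ^ 2 ∂μ) + 2 * ε) := by
        refine setLIntegral_mono' measurableSet_Ico fun s hs => ?_
        refine (lintegral_sub_sq_le (Φ.aemeasurable_value s) (hf s hs)).trans ?_
        simp_rw [enorm_sub_rev (Φ.value s _)]
        gcongr
        exact hΨ s hs
    _ = _ := by
        -- Only the constant summand has to be measurable in `s`, so no joint measurability of `f`
        -- is required.
        rw [lintegral_add_right _ measurable_const, lintegral_const_mul' _ _ (by simp)]
        simp [mul_assoc]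

/-- An Ito integral of `f` is close to the integral of each step process uniformly close to `f`. -/
lemma IsItoIntegral.lintegral_sub_le (hB : IsBrownian μ ℱ Θ B) (ha : 0 ≤ a)
    (hb : b ≤ Θ) {f : ℝ → Ω → ℝ} (hf : ∀ s ∈ Set.Ico a b, AEMeasurable (f s) μ) {X : Ω → ℝ}
    (hX : IsItoIntegral μ ℱ B a b f X) (Ψ : StepProcess μ ℱ a b) {ε : ℝ≥0∞}
    (hΨ : ∀ s ∈ Set.Ico a b, ∫⁻ ω, ‖f s ω - Ψ.value s ω‖ₑ ^ 2 ∂μ ≤ ε) :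
    ∫⁻ ω, ‖X ω - Ψ.integral B ω‖ₑ ^ 2 ∂μ ≤ 4 * (ε * ENNReal.ofReal (b - a)) := by
  obtain ⟨hX2, Φ, hΦ, hΦX⟩ := hX
  -- The steps `Φ m` defining `X` disappear as `m → ∞`; the final factor `4` comes from using `(x +
  -- y)² ≤ 2x² + 2y²` twice. Since `X` is any version, the chosen `itoIntegral` can be computed
  -- without a separate uniqueness statement.
  have hlim : Tendsto (fun m => 2 * (∫⁻ ω, ‖X ω - (Φ m).integral B ω‖ₑ ^ 2 ∂μ) +
      2 * (2 * (∫⁻ s in Set.Icc a b, ∫⁻ ω, ‖f s ω - (Φ m).value s ω‖ₑ ^ 2 ∂μ) +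
        2 * (ε * ENNReal.ofReal (b - a)))) atTop
      (𝓝 (2 * 0 + 2 * (2 * 0 + 2 * (ε * ENNReal.ofReal (b - a))))) := by
    refine (ENNReal.Tendsto.const_mul hΦX (by simp)).add (ENNReal.Tendsto.const_mul
      ((ENNReal.Tendsto.const_mul hΦ (by simp)).add tendsto_const_nhds) (by simp))
  have : 2 * 0 + 2 * (2 * 0 + 2 * (ε * ENNReal.ofReal (b - a))) =
      4 * (ε * ENNReal.ofReal (b - a)) := by ring
  rw [this] at hlim
  refine ge_of_tendsto' hlim fun m => ?_
  refine (lintegral_sub_sq_le hX2.aemeasurable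
    ((Φ m).memLp_integral hB ha hb).aemeasurable).trans ?_
  gcongr
  exact hB.lintegral_integral_sub_le ha hb hf (Φ m) Ψ hΨ

/-- The integrals of the approximating steps are Cauchy in `L²` by the preceding comparison, and
`Lp` is complete. -/
lemma itoIntegrable_of_uniform (hB : IsBrownian μ ℱ Θ B) (ha : 0 ≤ a)
    (hb : b ≤ Θ) {f : ℝ → Ω → ℝ} (hf : ∀ s ∈ Set.Ico a b, AEMeasurable (f s) μ)
    (Ψ : ℕ → StepProcess μ ℱ a b) {ε : ℕ → ℝ≥0∞} (hε : Tendsto ε atTop (𝓝 0))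
    (hΨ : ∀ n, ∀ s ∈ Set.Ico a b, ∫⁻ ω, ‖f s ω - (Ψ n).value s ω‖ₑ ^ 2 ∂μ ≤ ε n) :
    ItoIntegrable μ ℱ B a b f := by
  have hI : ∀ n, MemLp ((Ψ n).integral B) 2 μ := fun n => (Ψ n).memLp_integral hB ha hb
  set δ : ℕ → ℝ≥0∞ := fun n => ε n * ENNReal.ofReal (b - a) with hδ
  have hδ0 : Tendsto δ atTop (𝓝 0) := by
    simpa using ENNReal.Tendsto.mul_const hε (b := ENNReal.ofReal (b - a)) (by simp)
  have hD : ∀ n, ∫⁻ s in Set.Icc a b, ∫⁻ ω, ‖f s ω - (Ψ n).value s ω‖ₑ ^ 2 ∂μ ≤ δ n :=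
    fun n => lintegral_Icc_le (hΨ n)
  have hdist : ∀ m n, eLpNorm ((Ψ m).integral B - (Ψ n).integral B) 2 μ ^ 2 ≤
      2 * δ m + 2 * δ n := fun m n => by
    rw [eLpNorm_two_sq]
    refine (hB.lintegral_integral_sub_le ha hb hf (Ψ m) (Ψ n) (hΨ n)).trans ?_
    gcongr
    exact hD m
  let u : ℕ → Lp ℝ 2 μ := fun n => (hI n).toLp
  have hu : CauchySeq u := by
    rw [EMetric.cauchySeq_iff]
    intro η hη
    have hη2 : 0 < η ^ 2 / 8 := ENNReal.div_pos (pow_ne_zero 2 hη.ne') (by simp)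
    obtain ⟨N, hN⟩ := eventually_atTop.1 (hδ0.eventually (gt_mem_nhds hη2))
    refine ⟨N, fun m hm n hn => ?_⟩
    rw [Lp.edist_toLp_toLp, ← ENNReal.pow_lt_pow_left_iff two_ne_zero]
    refine (hdist m n).trans_lt ?_
    calc 2 * δ m + 2 * δ n < 2 * (η ^ 2 / 8) + 2 * (η ^ 2 / 8) := by
          exact ENNReal.add_lt_add
            (ENNReal.mul_lt_mul_right (by simp) (by simp) (hN m hm))
            (ENNReal.mul_lt_mul_right (by simp) (by simp) (hN n hn))
      _ = 4 * (η ^ 2 / 8) := by ring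
      _ ≤ 8 * (η ^ 2 / 8) := by gcongr; norm_num
      _ ≤ η ^ 2 := ENNReal.mul_div_le
  obtain ⟨Y, hY⟩ := cauchySeq_tendsto_of_complete hu
  refine ⟨Y, Lp.memLp Y, Ψ, tendsto_of_tendsto_of_tendsto_of_le_of_le tendsto_const_nhds hδ0
    (fun _ => zero_le) hD, ?_⟩
  have hY' := tendsto_iff_edist_tendsto_0.1 hY
  have hY2 : Tendsto (fun n => edist (u n) Y ^ 2) atTop (𝓝 (0 ^ 2)) := ENNReal.Tendsto.pow hY'
  rw [zero_pow two_ne_zero] at hY2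
  refine hY2.congr fun n => ?_
  rw [edist_comm, Lp.edist_def, eLpNorm_two_sq]
  refine lintegral_congr_ae ?_
  filter_upwards [(hI n).coeFn_toLp] with ω hω
  simp only [Pi.sub_apply, u, hω]

lemma isItoIntegral_itoIntegral {f : ℝ → Ω → ℝ} (h : ItoIntegrable μ ℱ B a b f) :
    IsItoIntegral μ ℱ B a b f (itoIntegral μ ℱ B a b f) := by
  rw [itoIntegral, dif_pos h]
  exact h.choose_spec

end Existence

/-! ### Itô integrals as limits over uniform partitions -/

section Grid

variable {Ω : Type*} {mΩ : MeasurableSpace Ω} {μ : Measure Ω} {ℱ : Filtration ℝ mΩ} {Θ : ℝ}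
  {B : ℝ → Ω → ℝ} {t T : ℝ}

/-- The points of the uniform partition of `[t, T]` into `n + 1` intervals. -/
noncomputable def gridPoint (t T : ℝ) (n k : ℕ) : ℝ := t + k * ((T - t) / (n + 1))

lemma gridPoint_zero (n : ℕ) : gridPoint t T n 0 = t := by simp [gridPoint]

lemma gridPoint_last (n : ℕ) : gridPoint t T n (n + 1) = T := by
  have : (n : ℝ) + 1 ≠ 0 := by positivity
  simp only [gridPoint]; push_cast; field_simp; ring

lemma gridPoint_succ_sub (n k : ℕ) :
    gridPoint t T n (k + 1) - gridPoint t T n k = (T - t) / (n + 1) := by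
  simp only [gridPoint]; push_cast; ring

lemma gridPoint_mono (h : t ≤ T) (n : ℕ) : Monotone (gridPoint t T n) := by
  intro j k hjk
  have : 0 ≤ (T - t) / ((n : ℝ) + 1) := div_nonneg (sub_nonneg.2 h) (by positivity)
  have hjk' : (j : ℝ) ≤ k := by exact_mod_cast hjk
  simp only [gridPoint]
  gcongr

lemma gridPoint_mem (h : t ≤ T) {n k : ℕ} (hk : k ≤ n + 1) :
    gridPoint t T n k ∈ Set.Icc t T :=
  ⟨(gridPoint_zero n).symm.le.trans (gridPoint_mono h n (Nat.zero_le k)),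
    (gridPoint_mono h n hk).trans (gridPoint_last n).le⟩

lemma tendsto_mesh (t T : ℝ) : Tendsto (fun n : ℕ => (T - t) / ((n : ℝ) + 1)) atTop (𝓝 0) := by
  have := (tendsto_one_div_add_atTop_nhds_zero_nat (𝕜 := ℝ)).const_mul (T - t)
  simpa [div_eq_mul_inv] using this

/-- The step process on the uniform partition with values `ξ k`. -/
noncomputable def gridStep (h : t ≤ T) (n : ℕ) (ξ : ℕ → Ω → ℝ)
    (hm : ∀ k < n + 1, Measurable[ℱ (gridPoint t T n k)] (ξ k))
    (hξ : ∀ k < n + 1, MemLp (ξ k) 2 μ) : StepProcess μ ℱ t T where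
  N := n + 1
  τ := gridPoint t T n
  mono := gridPoint_mono h n
  left := gridPoint_zero n
  right := gridPoint_last n
  ξ := ξ
  measurable := hm
  memLp := hξ

/-- Existence of an Ito integral, and its approximation by sums over uniform partitions. -/
lemma itoIntegral_grid (hB : IsBrownian μ ℱ Θ B) (ht : 0 ≤ t) (htT : t ≤ T) (hT : T ≤ Θ)
    {f : ℝ → Ω → ℝ} (hf : ∀ s ∈ Set.Ico t T, AEMeasurable (f s) μ) {ξ : ℕ → ℕ → Ω → ℝ}
    (hm : ∀ n, ∀ k < n + 1, Measurable[ℱ (gridPoint t T n k)] (ξ n k))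
    (hξ : ∀ n, ∀ k < n + 1, MemLp (ξ n k) 2 μ) {ε : ℕ → ℝ≥0∞} (hε : Tendsto ε atTop (𝓝 0))
    (h : ∀ n, ∀ k < n + 1, ∀ s ∈ Set.Ico (gridPoint t T n k) (gridPoint t T n (k + 1)),
      ∫⁻ ω, ‖f s ω - ξ n k ω‖ₑ ^ 2 ∂μ ≤ ε n) :
    ItoIntegrable μ ℱ B t T f ∧ MemLp (itoIntegral μ ℱ B t T f) 2 μ ∧
      Tendsto (fun n => ∫⁻ ω, ‖itoIntegral μ ℱ B t T f ω -
        ∑ k : Fin (n + 1), ξ n k ω * (B (gridPoint t T n (k + 1)) ω -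
          B (gridPoint t T n k) ω)‖ₑ ^ 2 ∂μ) atTop (𝓝 0) := by
  let Ψ : ℕ → StepProcess μ ℱ t T := fun n => gridStep htT n (ξ n) (hm n) (hξ n)
  have hΨ : ∀ n, ∀ s ∈ Set.Ico t T, ∫⁻ ω, ‖f s ω - (Ψ n).value s ω‖ₑ ^ 2 ∂μ ≤ ε n := by
    intro n s hs
    obtain ⟨k, hk, hsk, hv⟩ := (Ψ n).exists_value_eq hs
    simp_rw [hv]
    exact h n k hk s hsk
  have hI := itoIntegrable_of_uniform hB ht hT hf Ψ hε hΨ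
  have hX := isItoIntegral_itoIntegral hI
  refine ⟨hI, hX.1, ?_⟩
  have hlim : Tendsto (fun n => 4 * (ε n * ENNReal.ofReal (T - t))) atTop (𝓝 0) := by
    simpa using ENNReal.Tendsto.const_mul (a := 4)
      (ENNReal.Tendsto.mul_const hε (b := ENNReal.ofReal (T - t)) (by simp)) (by simp)
  refine tendsto_of_tendsto_of_tendsto_of_le_of_le tendsto_const_nhds hlim
    (fun _ => zero_le) fun n => ?_
  refine le_trans (le_of_eq ?_) (hX.lintegral_sub_le hB ht hT hf (Ψ n) (hΨ n))
  congr 1 with ω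
  simp only [StepProcess.integral, Ψ, gridStep, Finset.sum_range]

variable [IsProbabilityMeasure μ]

/-- The integrand is itself a step process, so the approximation error is `0` and the grid sums
telescope to the increment. The squared distance is then a constant sequence with limit `0`. -/
lemma itoIntegral_one (hB : IsBrownian μ ℱ Θ B) (ht : 0 ≤ t) (htT : t ≤ T) (hT : T ≤ Θ) :
    ItoIntegrable μ ℱ B t T (fun _ _ => 1) ∧
      itoIntegral μ ℱ B t T (fun _ _ => 1) =ᵐ[μ] fun ω => B T ω - B t ω := by
  obtain ⟨h1, h2, h3⟩ := itoIntegral_grid hB ht htT hT (f := fun _ _ => 1)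
    (ξ := fun _ _ _ => 1) (ε := fun _ => 0) (fun _ _ => aemeasurable_const)
    (fun _ _ _ => measurable_const) (fun _ _ _ => memLp_const _) tendsto_const_nhds
    (by simp)
  refine ⟨h1, ?_⟩
  have hsum : ∀ n ω, ∑ k : Fin (n + 1), (1 : ℝ) * (B (gridPoint t T n (k + 1)) ω -
      B (gridPoint t T n k) ω) = B T ω - B t ω := fun n ω => by
    simp_rw [one_mul]
    rw [← Finset.sum_range (fun k => B (gridPoint t T n (k + 1)) ω - B (gridPoint t T n k) ω),
      Finset.sum_range_sub (fun k => B (gridPoint t T n k) ω), gridPoint_last, gridPoint_zero]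
  simp_rw [hsum] at h3
  have h0 := tendsto_nhds_unique h3 tendsto_const_nhds
  have hm := (hB.memLp ht htT hT).aemeasurable
  rw [eq_comm, lintegral_eq_zero_iff' (by have := h2.aemeasurable; fun_prop)] at h0
  filter_upwards [h0] with ω hω
  simpa [sub_eq_zero] using hω

/-- The modulus of continuity of a continuous function tends to `0` along uniform partitions. -/
lemma exists_gridModulus (htT : t ≤ T) {φ : ℝ → ℝ} (hφ : Continuous φ) :
    ∃ δ : ℕ → ℝ, (∀ n, 0 ≤ δ n) ∧ Tendsto δ atTop (𝓝 0) ∧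
      ∀ n, ∀ k < n + 1, ∀ s ∈ Set.Icc (gridPoint t T n k) (gridPoint t T n (k + 1)),
        |φ s - φ (gridPoint t T n k)| ≤ δ n := by
  have huc := isCompact_Icc.uniformContinuousOn_of_continuous (hφ.continuousOn (s := Set.Icc t T))
  rw [Metric.uniformContinuousOn_iff] at huc
  let A : ℕ → Set ℝ := fun n =>
    {x | ∃ k < n + 1, ∃ s ∈ Set.Icc (gridPoint t T n k) (gridPoint t T n (k + 1)),
      x = |φ s - φ (gridPoint t T n k)|}
  obtain ⟨M, hM⟩ := isCompact_Icc.exists_bound_of_continuousOn (hφ.continuousOn (s := Set.Icc t T))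
  have hmem : ∀ n, ∀ k < n + 1, ∀ s ∈ Set.Icc (gridPoint t T n k) (gridPoint t T n (k + 1)),
      s ∈ Set.Icc t T := fun n k hk s hs =>
    ⟨(gridPoint_mem htT hk.le).1.trans hs.1, hs.2.trans (gridPoint_mem htT hk).2⟩
  have hbdd : ∀ n, BddAbove (A n) := fun n => ⟨M + M, by
    rintro _ ⟨k, hk, s, hs, rfl⟩
    exact (abs_sub _ _).trans (add_le_add (hM s (hmem n k hk s hs))
      (hM _ (gridPoint_mem htT hk.le)))⟩
  have hnn : ∀ n, 0 ≤ sSup (A n) := fun n => Real.sSup_nonneg (by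
    rintro _ ⟨k, hk, s, hs, rfl⟩
    exact abs_nonneg _)
  refine ⟨fun n => sSup (A n), hnn, ?_, fun n k hk s hs => le_csSup (hbdd n) ⟨k, hk, s, hs, rfl⟩⟩
  rw [Metric.tendsto_atTop]
  intro η hη
  obtain ⟨δ, hδ, hδη⟩ := huc (η / 2) (by positivity)
  obtain ⟨N, hN⟩ := eventually_atTop.1 ((tendsto_mesh t T).eventually (gt_mem_nhds hδ))
  refine ⟨N, fun n hn => ?_⟩
  rw [Real.dist_eq, sub_zero, abs_of_nonneg (hnn n)]
  refine lt_of_le_of_lt (Real.sSup_le ?_ (by positivity)) (half_lt_self hη)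
  rintro _ ⟨k, hk, s, hs, rfl⟩
  refine (hδη s (hmem n k hk s hs) _ (gridPoint_mem htT hk.le) ?_).le
  rw [Real.dist_eq, abs_of_nonneg (sub_nonneg.2 hs.1)]
  have := gridPoint_succ_sub (t := t) (T := T) n k
  have := hN n hn
  linarith [hs.2]

lemma itoIntegral_continuous (hB : IsBrownian μ ℱ Θ B) (ht : 0 ≤ t) (htT : t ≤ T) (hT : T ≤ Θ)
    {φ : ℝ → ℝ} (hφ : Continuous φ) :
    ItoIntegrable μ ℱ B t T (fun s _ => φ s) ∧
      MemLp (itoIntegral μ ℱ B t T (fun s _ => φ s)) 2 μ ∧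
      Tendsto (fun n => ∫⁻ ω, ‖itoIntegral μ ℱ B t T (fun s _ => φ s) ω -
        ∑ k : Fin (n + 1), φ (gridPoint t T n k) * (B (gridPoint t T n (k + 1)) ω -
          B (gridPoint t T n k) ω)‖ₑ ^ 2 ∂μ) atTop (𝓝 0) := by
  obtain ⟨δ, hδ0, hδ, hφδ⟩ := exists_gridModulus htT hφ
  refine itoIntegral_grid hB ht htT hT (f := fun s _ => φ s)
    (ξ := fun n k _ => φ (gridPoint t T n k)) (ε := fun n => ENNReal.ofReal (δ n) ^ 2)
    (fun _ _ => aemeasurable_const) (fun _ _ _ => measurable_const) (fun _ _ _ => memLp_const _)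
    ?_ ?_
  · have := ENNReal.Tendsto.pow (n := 2) (ENNReal.tendsto_ofReal hδ)
    simpa using this
  · intro n k hk s hs
    rw [lintegral_const, measure_univ, mul_one, Real.enorm_eq_ofReal_abs]
    gcongr
    exact hφδ n k hk s ⟨hs.1, hs.2.le⟩

/-- For each `s` the inner integral is almost surely `B₁ s - B₁ t`. Freezing it at the left grid
point costs in mean square the elapsed time, which is at most the mesh. -/
lemma iteratedIto_grid {B₁ B₂ : ℝ → Ω → ℝ} (hB₁ : IsBrownian μ ℱ Θ B₁)
    (hB₂ : IsBrownian μ ℱ Θ B₂) (ht : 0 ≤ t) (htT : t ≤ T) (hT : T ≤ Θ) :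
    ItoIntegrable μ ℱ B₂ t T (fun s => itoIntegral μ ℱ B₁ t s (fun _ _ => 1)) ∧
      MemLp (iteratedIto μ ℱ B₁ B₂ t T) 2 μ ∧
      Tendsto (fun n => ∫⁻ ω, ‖iteratedIto μ ℱ B₁ B₂ t T ω -
        ∑ k : Fin (n + 1), (B₁ (gridPoint t T n k) ω - B₁ t ω) *
          (B₂ (gridPoint t T n (k + 1)) ω - B₂ (gridPoint t T n k) ω)‖ₑ ^ 2 ∂μ) atTop (𝓝 0) := by
  refine itoIntegral_grid hB₂ ht htT hT
    (ξ := fun n k ω => B₁ (gridPoint t T n k) ω - B₁ t ω)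
    (ε := fun n => ENNReal.ofReal ((T - t) / (n + 1))) ?_ ?_ ?_ ?_ ?_
  · intro s hs
    exact (hB₁.memLp ht hs.1 (hs.2.le.trans hT)).aemeasurable.congr
      (itoIntegral_one hB₁ ht hs.1 (hs.2.le.trans hT)).2.symm
  · intro n k hk
    have hg := gridPoint_mem htT hk.le
    exact (hB₁.adapted _ ⟨ht.trans hg.1, hg.2.trans hT⟩).sub
      ((hB₁.adapted t ⟨ht, htT.trans hT⟩).mono (ℱ.mono hg.1) le_rfl)
  · intro n k hk
    have hg := gridPoint_mem htT hk.le
    exact hB₁.memLp ht hg.1 (hg.2.trans hT)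
  · simpa using ENNReal.tendsto_ofReal (tendsto_mesh t T)
  · intro n k hk s hs
    have hg := gridPoint_mem htT hk.le
    have hg' := gridPoint_mem htT (Nat.succ_le_of_lt hk)
    have hsT : s ≤ T := hs.2.le.trans hg'.2
    have e : ∫⁻ ω, ‖itoIntegral μ ℱ B₁ t s (fun _ _ => 1) ω -
        (B₁ (gridPoint t T n k) ω - B₁ t ω)‖ₑ ^ 2 ∂μ =
        ∫⁻ ω, ‖B₁ s ω - B₁ (gridPoint t T n k) ω‖ₑ ^ 2 ∂μ := by
      refine lintegral_congr_ae ?_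
      filter_upwards [(itoIntegral_one hB₁ ht (hg.1.trans hs.1) (hsT.trans hT)).2] with ω hω
      rw [hω]
      congr 2
      ring
    rw [e, hB₁.lintegral_sq (ht.trans hg.1) hs.1 (hsT.trans hT)]
    refine ENNReal.ofReal_le_ofReal ?_
    rw [← gridPoint_succ_sub n k]
    linarith [hs.2]

end Grid

/-! ### Riemann sums and the norm of the kernel -/

section Riemann

variable {t T : ℝ}

/-- The bound does not depend on the upper limit `l`; this uniformity is what the inner sums of
iterated Riemann sums need. -/
lemma integral_sub_riemann_le (htT : t ≤ T) {φ : ℝ → ℝ} (hφ : Continuous φ) {n : ℕ} {δ : ℝ}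
    (hδ0 : 0 ≤ δ)
    (hδ : ∀ k < n + 1, ∀ s ∈ Set.Icc (gridPoint t T n k) (gridPoint t T n (k + 1)),
        |φ s - φ (gridPoint t T n k)| ≤ δ) {l : ℕ} (hl : l ≤ n + 1) :
    |(∫ s in t..gridPoint t T n l, φ s) -
      (T - t) / (n + 1) * ∑ k ∈ Finset.range l, φ (gridPoint t T n k)| ≤ δ * (T - t) := by
  have hint : ∀ x y, IntervalIntegrable φ volume x y := fun x y => hφ.intervalIntegrable x y
  have h1 : ∫ s in t..gridPoint t T n l, φ s =
      ∑ k ∈ Finset.range l, ∫ s in gridPoint t T n k..gridPoint t T n (k + 1), φ s := by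
    rw [intervalIntegral.sum_integral_adjacent_intervals fun k _ => hint _ _, gridPoint_zero]
  have h2 : ∀ k ∈ Finset.range l,
      |(∫ s in gridPoint t T n k..gridPoint t T n (k + 1), φ s) -
        (T - t) / (n + 1) * φ (gridPoint t T n k)| ≤
      δ * (gridPoint t T n (k + 1) - gridPoint t T n k) := by
    intro k hk
    have hk' : k < n + 1 := (Finset.mem_range.1 hk).trans_le hl
    have hle := gridPoint_mono htT n (Nat.le_succ k)
    have e : (∫ s in gridPoint t T n k..gridPoint t T n (k + 1), φ s) -
        (T - t) / (n + 1) * φ (gridPoint t T n k) =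
        ∫ s in gridPoint t T n k..gridPoint t T n (k + 1), (φ s - φ (gridPoint t T n k)) := by
      rw [intervalIntegral.integral_sub (hint _ _) (by simp), intervalIntegral.integral_const,
        gridPoint_succ_sub, smul_eq_mul]
    rw [e, ← Real.norm_eq_abs, ← abs_of_nonneg (sub_nonneg.2 hle)]
    refine intervalIntegral.norm_integral_le_of_norm_le_const fun s hs => ?_
    rw [Set.uIoc_of_le hle] at hs
    exact hδ k hk' s ⟨hs.1.le, hs.2⟩
  rw [h1, Finset.mul_sum, ← Finset.sum_sub_distrib]
  refine (Finset.abs_sum_le_sum_abs _ _).trans ((Finset.sum_le_sum h2).trans ?_)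
  rw [← Finset.mul_sum, Finset.sum_range_sub (gridPoint t T n), gridPoint_zero]
  gcongr
  exact (gridPoint_mem htT hl).2

lemma tendsto_riemann (htT : t ≤ T) {φ : ℝ → ℝ} (hφ : Continuous φ) :
    Tendsto (fun n : ℕ => (T - t) / (n + 1) * ∑ k ∈ Finset.range (n + 1), φ (gridPoint t T n k))
      atTop (𝓝 (∫ s in t..T, φ s)) := by
  obtain ⟨δ, hδ0, hδ, hφδ⟩ := exists_gridModulus htT hφ
  rw [tendsto_iff_norm_sub_tendsto_zero]
  refine squeeze_zero (fun _ => norm_nonneg _) (fun n => ?_)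
    (by simpa using hδ.mul_const (T - t))
  have := integral_sub_riemann_le htT hφ (hδ0 n) (hφδ n) le_rfl
  rwa [gridPoint_last, abs_sub_comm] at this

/-- `∫_t^T r(s) ∫_t^s p(τ) dτ ds`. -/
noncomputable def iteratedIntegral (t T : ℝ) (p r : ℝ → ℝ) : ℝ :=
  ∫ s in t..T, r s * ∫ τ in t..s, p τ

/-- The inner sums are uniformly close to the primitive of `p`. Replacing them leaves an ordinary
Riemann sum of `r` times that primitive. -/
lemma tendsto_iterated_riemann (htT : t ≤ T) {p r : ℝ → ℝ} (hp : Continuous p)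
    (hr : Continuous r) :
    Tendsto (fun n : ℕ => ((T - t) / (n + 1)) ^ 2 * ∑ l ∈ Finset.range (n + 1),
        ∑ k ∈ Finset.range l, p (gridPoint t T n k) * r (gridPoint t T n l))
      atTop (𝓝 (iteratedIntegral t T p r)) := by
  have hP : Continuous fun s => ∫ τ in t..s, p τ :=
    intervalIntegral.continuous_primitive (fun x y => hp.intervalIntegrable x y) t
  have h1 := tendsto_riemann htT (hr.mul hP)
  obtain ⟨δ, hδ0, hδ, hpδ⟩ := exists_gridModulus htT hp
  obtain ⟨M, hM⟩ := isCompact_Icc.exists_bound_of_continuousOn (hr.continuousOn (s := Set.Icc t T))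
  have hM0 : 0 ≤ M := (norm_nonneg _).trans (hM t ⟨le_rfl, htT⟩)
  have h2 : Tendsto (fun n : ℕ => ((T - t) / (n + 1)) ^ 2 * ∑ l ∈ Finset.range (n + 1),
        ∑ k ∈ Finset.range l, p (gridPoint t T n k) * r (gridPoint t T n l) -
        (T - t) / (n + 1) * ∑ l ∈ Finset.range (n + 1),
          (r (gridPoint t T n l) * ∫ τ in t..gridPoint t T n l, p τ)) atTop (𝓝 0) := by
    rw [tendsto_zero_iff_norm_tendsto_zero]
    refine squeeze_zero (fun _ => norm_nonneg _) (fun n => ?_)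
      (by simpa using hδ.mul_const (M * (T - t) ^ 2))
    have hn : (0 : ℝ) < (n : ℝ) + 1 := by positivity
    have e : ((T - t) / (n + 1)) ^ 2 * ∑ l ∈ Finset.range (n + 1),
        ∑ k ∈ Finset.range l, p (gridPoint t T n k) * r (gridPoint t T n l) -
        (T - t) / (n + 1) * ∑ l ∈ Finset.range (n + 1),
          (r (gridPoint t T n l) * ∫ τ in t..gridPoint t T n l, p τ) =
        (T - t) / (n + 1) * ∑ l ∈ Finset.range (n + 1), r (gridPoint t T n l) *
          ((T - t) / (n + 1) * ∑ k ∈ Finset.range l, p (gridPoint t T n k) -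
            ∫ τ in t..gridPoint t T n l, p τ) := by
      simp_rw [mul_sub, Finset.sum_sub_distrib, mul_sub, ← Finset.sum_mul]
      congr 1
      rw [sq, mul_assoc, Finset.mul_sum (a := (T - t) / ((n : ℝ) + 1))]
      congr 1
      refine Finset.sum_congr rfl fun l _ => ?_
      ring
    have hle : ‖∑ l ∈ Finset.range (n + 1), r (gridPoint t T n l) *
          ((T - t) / (n + 1) * ∑ k ∈ Finset.range l, p (gridPoint t T n k) -
            ∫ τ in t..gridPoint t T n l, p τ)‖ ≤
        ∑ _l ∈ Finset.range (n + 1), M * (δ n * (T - t)) := by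
      refine norm_sum_le_of_le _ fun l hl => ?_
      have hl' := (Finset.mem_range.1 hl).le
      rw [norm_mul]
      refine mul_le_mul (hM _ (gridPoint_mem htT hl')) ?_ (norm_nonneg _) hM0
      rw [Real.norm_eq_abs, abs_sub_comm]
      exact integral_sub_riemann_le htT hp (hδ0 n) (hpδ n) hl'
    have h0 : 0 ≤ (T - t) / ((n : ℝ) + 1) := div_nonneg (sub_nonneg.2 htT) hn.le
    rw [e, norm_mul, Real.norm_of_nonneg h0]
    refine (mul_le_mul_of_nonneg_left hle h0).trans (le_of_eq ?_)
    simp only [Finset.sum_const, Finset.card_range, nsmul_eq_mul]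
    push_cast
    field_simp
  have h3 := h2.add h1
  simp only [Pi.mul_apply, sub_add_cancel, zero_add] at h3
  exact h3

variable {ι : Type*}

/-- The kernel `α 1_{k < l} + β 1_{l < k} - ∑ i, c i * p i (s_k) * r i (s_l)` on the uniform
partition. -/
noncomputable def gridKernel (t T α β : ℝ) (S : Finset ι) (c : ι → ℝ) (p r : ι → ℝ → ℝ)
    (n k l : ℕ) : ℝ :=
  (if k < l then α else 0) + (if l < k then β else 0) -
    ∑ i ∈ S, c i * (p i (gridPoint t T n k) * r i (gridPoint t T n l))

/-- The squared norm in `L²([t, T]²)` of the kernel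
`α 1_{u < v} + β 1_{v < u} - ∑ i, c i * p i (u) * r i (v)`. -/
noncomputable def kernelNormSq (t T α β : ℝ) (S : Finset ι) (c : ι → ℝ) (p r : ι → ℝ → ℝ) : ℝ :=
  (α ^ 2 + β ^ 2) * ((T - t) ^ 2 / 2) -
    2 * ∑ i ∈ S, c i * (α * iteratedIntegral t T (p i) (r i) +
      β * iteratedIntegral t T (r i) (p i)) +
    ∑ i ∈ S, ∑ j ∈ S, c i * c j *
      ((∫ s in t..T, p i s * p j s) * ∫ s in t..T, r i s * r j s)

lemma sum_range_ite_lt {n l : ℕ} (hl : l ∈ Finset.range n) (f : ℕ → ℝ) :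
    (∑ k ∈ Finset.range n, if k < l then f k else 0) = ∑ k ∈ Finset.range l, f k := by
  rw [← Finset.sum_filter]
  congr 1
  ext k
  simp only [Finset.mem_filter, Finset.mem_range] at hl ⊢
  omega

/-- Expanding the square leaves three kinds of sums, each a Riemann sum over a triangle or over the
square. The two indicators have disjoint supports, so `α` and `β` do not interact. -/
lemma tendsto_gridKernel (htT : t ≤ T) (α β : ℝ) (S : Finset ι) (c : ι → ℝ) {p r : ι → ℝ → ℝ}
    (hp : ∀ i, Continuous (p i)) (hr : ∀ i, Continuous (r i)) :
    Tendsto (fun n : ℕ => ((T - t) / (n + 1)) ^ 2 * ∑ k ∈ Finset.range (n + 1),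
      ∑ l ∈ Finset.range (n + 1), gridKernel t T α β S c p r n k l ^ 2)
      atTop (𝓝 (kernelNormSq t T α β S c p r)) := by
  have h1 : iteratedIntegral t T (fun _ => 1) (fun _ => 1) = (T - t) ^ 2 / 2 := by
    simp [iteratedIntegral, integral_id]; ring
  have t1 := (tendsto_iterated_riemann htT (p := fun _ => 1) (r := fun _ => 1)
    continuous_const continuous_const).const_mul (α ^ 2 + β ^ 2)
  rw [h1] at t1
  have t2 := (tendsto_finsetSum S fun i _ =>
    (((tendsto_iterated_riemann htT (hp i) (hr i)).const_mul α).add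
      ((tendsto_iterated_riemann htT (hr i) (hp i)).const_mul β)).const_mul (c i)).const_mul 2
  have t3 := tendsto_finsetSum S fun i _ => tendsto_finsetSum S fun j _ =>
    ((tendsto_riemann htT ((hp i).mul (hp j))).mul
      (tendsto_riemann htT ((hr i).mul (hr j)))).const_mul (c i * c j)
  refine ((t1.sub t2).add t3).congr fun n => ?_
  set h := (T - t) / ((n : ℝ) + 1)
  set g := gridPoint t T n
  have e : ∀ k l, gridKernel t T α β S c p r n k l ^ 2 =
      ((if k < l then α ^ 2 else 0) + (if l < k then β ^ 2 else 0)) -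
      2 * ∑ i ∈ S, c i * (α * (if k < l then p i (g k) * r i (g l) else 0) +
        β * (if l < k then r i (g l) * p i (g k) else 0)) +
      ∑ i ∈ S, ∑ j ∈ S, c i * c j * ((p i (g k) * p j (g k)) * (r i (g l) * r j (g l))) := by
    intro k l
    have e3 : (∑ i ∈ S, c i * (p i (g k) * r i (g l))) ^ 2 =
        ∑ i ∈ S, ∑ j ∈ S, c i * c j * ((p i (g k) * p j (g k)) * (r i (g l) * r j (g l))) := by
      rw [sq, Finset.sum_mul_sum]
      exact Finset.sum_congr rfl fun i _ => Finset.sum_congr rfl fun j _ => by ring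
    have e2 : ∑ i ∈ S, c i * (α * (if k < l then p i (g k) * r i (g l) else 0) +
        β * (if l < k then r i (g l) * p i (g k) else 0)) =
        ((if k < l then α else 0) + (if l < k then β else 0)) *
          ∑ i ∈ S, c i * (p i (g k) * r i (g l)) := by
      rw [Finset.mul_sum]
      refine Finset.sum_congr rfl fun i _ => ?_
      split_ifs <;> ring
    rw [gridKernel, sub_sq, e3, e2]
    congr 1
    rw [mul_assoc]
    congr 1
    split_ifs with h1 h2 <;> first | omega | ring
  simp_rw [e, Finset.sum_add_distrib, Finset.sum_sub_distrib, Finset.sum_add_distrib]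
  have s1 : ∀ a : ℝ, (∑ k ∈ Finset.range (n + 1), ∑ l ∈ Finset.range (n + 1),
      if l < k then a else 0) = a * ∑ l ∈ Finset.range (n + 1), ∑ k ∈ Finset.range l, 1 * 1 := by
    intro a
    rw [Finset.mul_sum]
    refine Finset.sum_congr rfl fun k hk => ?_
    rw [sum_range_ite_lt hk]
    simp [mul_comm]
  have s1' : ∀ a : ℝ, (∑ k ∈ Finset.range (n + 1), ∑ l ∈ Finset.range (n + 1),
      if k < l then a else 0) = a * ∑ l ∈ Finset.range (n + 1), ∑ k ∈ Finset.range l, 1 * 1 := by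
    intro a
    rw [Finset.sum_comm, s1]
  have s2 : ∑ k ∈ Finset.range (n + 1), ∑ l ∈ Finset.range (n + 1),
      2 * ∑ i ∈ S, c i * (α * (if k < l then p i (g k) * r i (g l) else 0) +
        β * (if l < k then r i (g l) * p i (g k) else 0)) =
      2 * ∑ i ∈ S, c i * (α * ∑ l ∈ Finset.range (n + 1), ∑ k ∈ Finset.range l,
        p i (g k) * r i (g l) + β * ∑ l ∈ Finset.range (n + 1), ∑ k ∈ Finset.range l,
        r i (g k) * p i (g l)) := by
    simp_rw [← Finset.mul_sum]
    congr 1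
    have : ∀ k ∈ Finset.range (n + 1), ∑ l ∈ Finset.range (n + 1), ∑ i ∈ S,
        c i * (α * (if k < l then p i (g k) * r i (g l) else 0) +
        β * (if l < k then r i (g l) * p i (g k) else 0)) =
        ∑ i ∈ S, c i * (α * (∑ l ∈ Finset.range (n + 1),
          if k < l then p i (g k) * r i (g l) else 0) +
        β * ∑ l ∈ Finset.range k, r i (g l) * p i (g k)) := by
      intro k hk
      rw [Finset.sum_comm]
      refine Finset.sum_congr rfl fun i _ => ?_
      rw [← Finset.mul_sum, Finset.sum_add_distrib, ← Finset.mul_sum, ← Finset.mul_sum,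
        sum_range_ite_lt hk]
    rw [Finset.sum_congr rfl this, Finset.sum_comm]
    refine Finset.sum_congr rfl fun i _ => ?_
    rw [← Finset.mul_sum, Finset.sum_add_distrib, ← Finset.mul_sum, ← Finset.mul_sum]
    congr 3
    rw [Finset.sum_comm]
    exact Finset.sum_congr rfl fun l hl => sum_range_ite_lt hl fun k => p i (g k) * r i (g l)
  have s3 : ∑ k ∈ Finset.range (n + 1), ∑ l ∈ Finset.range (n + 1), ∑ i ∈ S, ∑ j ∈ S,
      c i * c j * ((p i (g k) * p j (g k)) * (r i (g l) * r j (g l))) =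
      ∑ i ∈ S, ∑ j ∈ S, c i * c j * ((∑ k ∈ Finset.range (n + 1), p i (g k) * p j (g k)) *
        ∑ l ∈ Finset.range (n + 1), r i (g l) * r j (g l)) := by
    have : ∀ k, ∑ l ∈ Finset.range (n + 1), ∑ i ∈ S, ∑ j ∈ S,
        c i * c j * ((p i (g k) * p j (g k)) * (r i (g l) * r j (g l))) =
        ∑ i ∈ S, ∑ j ∈ S, c i * c j * ((p i (g k) * p j (g k)) *
          ∑ l ∈ Finset.range (n + 1), r i (g l) * r j (g l)) := by
      intro k
      rw [Finset.sum_comm]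
      refine Finset.sum_congr rfl fun i _ => ?_
      rw [Finset.sum_comm]
      refine Finset.sum_congr rfl fun j _ => ?_
      rw [← Finset.mul_sum, ← Finset.mul_sum]
    simp_rw [this]
    rw [Finset.sum_comm]
    refine Finset.sum_congr rfl fun i _ => ?_
    rw [Finset.sum_comm]
    refine Finset.sum_congr rfl fun j _ => ?_
    rw [← Finset.mul_sum, ← Finset.sum_mul]
  have m2 : ∀ U V : ι → ℝ, ∑ i ∈ S, c i * (α * (h ^ 2 * U i) + β * (h ^ 2 * V i)) =
      h ^ 2 * ∑ i ∈ S, c i * (α * U i + β * V i) := fun U V => by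
    rw [Finset.mul_sum]
    exact Finset.sum_congr rfl fun i _ => by ring
  have m3 : ∀ P R : ι → ι → ℝ, ∑ i ∈ S, ∑ j ∈ S, c i * c j * ((h * P i j) * (h * R i j)) =
      h ^ 2 * ∑ i ∈ S, ∑ j ∈ S, c i * c j * (P i j * R i j) := fun P R => by
    simp_rw [Finset.mul_sum]
    exact Finset.sum_congr rfl fun i _ => Finset.sum_congr rfl fun j _ => by ring
  rw [s1, s1', s2, s3, m2, m3]
  simp only [Pi.mul_apply]
  ring

end Riemann

/-! ### Brownian increments on a grid as Gaussian families -/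

section Increments

variable {Ω : Type*} {mΩ : MeasurableSpace Ω} {μ : Measure Ω} {ℱ : Filtration ℝ mΩ} {Θ : ℝ}
  {B : ℝ → Ω → ℝ} {t T : ℝ}

/-- The increment of `B` over the `k`-th interval of the uniform partition. -/
noncomputable def gridIncrement (t T : ℝ) (n : ℕ) (B : ℝ → Ω → ℝ) (k : ℕ) (ω : Ω) : ℝ :=
  B (gridPoint t T n (k + 1)) ω - B (gridPoint t T n k) ω

lemma IsBrownian.measurable_gridIncrement (hB : IsBrownian μ ℱ Θ B) (ht : 0 ≤ t) (htT : t ≤ T)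
    (hT : T ≤ Θ) {n k l : ℕ} (hk : k < l) (hl : l ≤ n + 1) :
    Measurable[ℱ (gridPoint t T n l)] (gridIncrement t T n B k) := by
  have h : ∀ j ≤ l, Measurable[ℱ (gridPoint t T n l)] (B (gridPoint t T n j)) := fun j hj => by
    have hg := gridPoint_mem htT (n := n) (hj.trans hl)
    exact (hB.adapted _ ⟨ht.trans hg.1, hg.2.trans hT⟩).mono
      (ℱ.mono (gridPoint_mono htT n hj)) le_rfl
  exact (h _ hk).sub (h _ hk.le)

lemma IsWienerProcess.indepFun_gridIncrement {m : ℕ} {w : Fin m → ℝ → Ω → ℝ}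
    (hw : IsWienerProcess μ ℱ Θ w) {i j : Fin m} (hij : i ≠ j) (ht : 0 ≤ t) (htT : t ≤ T)
    (hT : T ≤ Θ) (n : ℕ) :
    IndepFun (fun ω (k : Fin (n + 1)) => gridIncrement t T n (w i) k ω)
      (fun ω (k : Fin (n + 1)) => gridIncrement t T n (w j) k ω) μ := by
  have hmem : ∀ k ≤ n + 1, gridPoint t T n k ∈ Set.Icc 0 Θ := fun k hk => by
    have hg := gridPoint_mem htT hk
    exact ⟨ht.trans hg.1, hg.2.trans hT⟩
  let F : (Set.Icc (0 : ℝ) Θ → ℝ) → Fin (n + 1) → ℝ := fun x k =>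
    x ⟨gridPoint t T n (k + 1), hmem _ k.2⟩ - x ⟨gridPoint t T n k, hmem _ k.2.le⟩
  have hF : Measurable F := by fun_prop
  exact (hw.indep_components.indepFun hij).comp hF hF

variable [IsProbabilityMeasure μ]

/-- Induction on the number of increments: the next one is independent of the past, to which the
partial sum belongs, so Gaussian laws convolve and variances add. -/
lemma IsBrownian.hasLaw_sum_gridIncrement (hB : IsBrownian μ ℱ Θ B) (ht : 0 ≤ t) (htT : t ≤ T)
    (hT : T ≤ Θ) (n : ℕ) (c : ℕ → ℝ) {N : ℕ} (hN : N ≤ n + 1) :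
    HasLaw (fun ω => ∑ k ∈ Finset.range N, c k * gridIncrement t T n B k ω)
      (gaussianReal 0 (((T - t) / (n + 1)).toNNReal * ∑ k ∈ Finset.range N, ‖c k‖₊ ^ 2)) μ := by
  induction N with
  | zero =>
    simp only [Finset.range_zero, Finset.sum_empty, mul_zero, gaussianReal_zero_var]
    exact hasLaw_dirac_of_ae_eq (Eventually.of_forall fun _ => rfl)
  | succ N ih =>
    have hN' : N ≤ n + 1 := (Nat.le_succ N).trans hN
    have ih := ih hN'
    have hg := gridPoint_mem htT hN'
    have hg' := gridPoint_mem htT hN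
    have hle := gridPoint_mono htT n (Nat.le_succ N)
    have hmeas : Measurable[ℱ (gridPoint t T n N)]
        (fun ω => ∑ k ∈ Finset.range N, c k * gridIncrement t T n B k ω) :=
      Finset.measurable_fun_sum _ fun k hk =>
        (hB.measurable_gridIncrement ht htT hT (Finset.mem_range.1 hk) hN').const_mul _
    have hlaw := hB.law _ _ (ht.trans hg.1) hle (hg'.2.trans hT)
    rw [gridPoint_succ_sub] at hlaw
    have hY := gaussianReal_const_mul hlaw (c N)
    have hind := (hB.indepFun (ht.trans hg.1) hle (hg'.2.trans hT) hmeas).comp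
      (φ := id) (ψ := fun x => c N * x) measurable_id (by fun_prop)
    have hsum := gaussianReal_add_gaussianReal_of_indepFun hind ih.map_eq hY.map_eq
    refine ⟨?_, ?_⟩
    · simp_rw [Finset.sum_range_succ]
      exact ih.aemeasurable.add hY.aemeasurable
    · simp_rw [Finset.sum_range_succ]
      convert hsum using 2
      · rfl
      · simp
      · rw [mul_add]
        congr 1
        rw [mul_comm]
        congr 1
        ext
        simp

lemma IsBrownian.isGaussianFamily (hB : IsBrownian μ ℱ Θ B) (ht : 0 ≤ t) (htT : t ≤ T)
    (hT : T ≤ Θ) (n : ℕ) :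
    IsGaussianFamily μ ((T - t) / (n + 1)).toNNReal
      (fun k : Fin (n + 1) => gridIncrement t T n B k) := by
  refine ⟨fun k => ?_, fun c => ?_⟩
  · exact (hB.measurable_gridIncrement ht htT hT k.2 le_rfl).mono (ℱ.le _) le_rfl
  · have h := hB.hasLaw_sum_gridIncrement ht htT hT n
      (fun k => if hk : k < n + 1 then c ⟨k, hk⟩ else 0) le_rfl
    simp only [Finset.sum_range, Fin.is_lt, dite_true, Fin.eta] at h
    exact h

end Increments

/-! ### Passing moments to the limit -/

section Limit

variable {Ω : Type*} {mΩ : MeasurableSpace Ω} {μ : Measure Ω}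

lemma eLpNorm_two_eq (g : Ω → ℝ) :
    eLpNorm g 2 μ = (∫⁻ ω, ‖g ω‖ₑ ^ 2 ∂μ) ^ (1 / 2 : ℝ) := by
  rw [← eLpNorm_two_sq, ← ENNReal.rpow_natCast, ← ENNReal.rpow_mul]
  norm_num

lemma tendsto_rpow_zero {u : ℕ → ℝ≥0∞} (hu : Tendsto u atTop (𝓝 0)) {x : ℝ} (hx : 0 < x) :
    Tendsto (fun n => u n ^ x) atTop (𝓝 0) := by
  have := (ENNReal.continuous_rpow_const (y := x)).tendsto 0 |>.comp hu
  rwa [ENNReal.zero_rpow_of_pos hx] at this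

lemma lintegral_enorm_mul_le {f g : Ω → ℝ} (hf : AEMeasurable f μ) (hg : AEMeasurable g μ) :
    ∫⁻ ω, ‖f ω * g ω‖ₑ ∂μ ≤
      (∫⁻ ω, ‖f ω‖ₑ ^ 2 ∂μ) ^ (1 / 2 : ℝ) * (∫⁻ ω, ‖g ω‖ₑ ^ 2 ∂μ) ^ (1 / 2 : ℝ) := by
  have := ENNReal.lintegral_mul_le_Lp_mul_Lq μ (p := 2) (q := 2)
    (Real.HolderConjugate.two_two) hf.enorm hg.enorm
  simpa [enorm_mul] using this

lemma tendsto_lintegral_of_sq [IsProbabilityMeasure μ] {U : Ω → ℝ} {u : ℕ → Ω → ℝ}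
    (hU : AEMeasurable U μ) (hu : ∀ n, AEMeasurable (u n) μ)
    (h : Tendsto (fun n => ∫⁻ ω, ‖U ω - u n ω‖ₑ ^ 2 ∂μ) atTop (𝓝 0)) :
    Tendsto (fun n => ∫⁻ ω, ‖U ω - u n ω‖ₑ ∂μ) atTop (𝓝 0) := by
  refine tendsto_of_tendsto_of_tendsto_of_le_of_le tendsto_const_nhds
    (tendsto_rpow_zero h (x := 1 / 2) (by norm_num)) (fun _ => zero_le) fun n => ?_
  have := lintegral_enorm_mul_le (hU.sub (hu n)) (aemeasurable_const (b := (1 : ℝ)) (μ := μ))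
  simpa using this

/-- Cauchy–Schwarz is applied to `U(V - v) + V(U - u) - (U - u)(V - v)`, a form that needs norms of
the limits only. Mean-square convergence of the factors gives no more than `L¹` for the products,
which is why the later limit lemmas start from `L¹`. -/
lemma tendsto_lintegral_mul {U V : Ω → ℝ} {u v : ℕ → Ω → ℝ} (hU : MemLp U 2 μ)
    (hV : MemLp V 2 μ) (hu : ∀ n, AEMeasurable (u n) μ) (hv : ∀ n, AEMeasurable (v n) μ)
    (hUu : Tendsto (fun n => ∫⁻ ω, ‖U ω - u n ω‖ₑ ^ 2 ∂μ) atTop (𝓝 0))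
    (hVv : Tendsto (fun n => ∫⁻ ω, ‖V ω - v n ω‖ₑ ^ 2 ∂μ) atTop (𝓝 0)) :
    Tendsto (fun n => ∫⁻ ω, ‖U ω * V ω - u n ω * v n ω‖ₑ ∂μ) atTop (𝓝 0) := by
  have mU := hU.aemeasurable
  have mV := hV.aemeasurable
  have fin : ∀ {W : Ω → ℝ}, MemLp W 2 μ → (∫⁻ ω, ‖W ω‖ₑ ^ 2 ∂μ) ^ (1 / 2 : ℝ) ≠ ⊤ :=
    fun hW => by rw [← eLpNorm_two_eq]; exact hW.2.ne
  have h1 := tendsto_rpow_zero hUu (x := 1 / 2) (by norm_num)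
  have h2 := tendsto_rpow_zero hVv (x := 1 / 2) (by norm_num)
  have hlim := ((ENNReal.Tendsto.const_mul h2 (Or.inr (fin hU))).add
    (ENNReal.Tendsto.const_mul h1 (Or.inr (fin hV)))).add
    (ENNReal.Tendsto.mul h1 (Or.inr (by simp)) h2 (Or.inr (by simp)))
  simp only [mul_zero, add_zero] at hlim
  refine tendsto_of_tendsto_of_tendsto_of_le_of_le tendsto_const_nhds hlim
    (fun _ => zero_le) fun n => ?_
  have mu := hu n
  have mv := hv n
  calc ∫⁻ ω, ‖U ω * V ω - u n ω * v n ω‖ₑ ∂μ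
      ≤ ∫⁻ ω, (‖U ω * (V ω - v n ω)‖ₑ + ‖V ω * (U ω - u n ω)‖ₑ +
          ‖(U ω - u n ω) * (V ω - v n ω)‖ₑ) ∂μ := by
        refine lintegral_mono fun ω => ?_
        have : U ω * V ω - u n ω * v n ω = U ω * (V ω - v n ω) + V ω * (U ω - u n ω) -
          (U ω - u n ω) * (V ω - v n ω) := by ring
        rw [this]
        exact enorm_sub_le.trans (add_le_add_left (enorm_add_le _ _) _)
    _ = _ := by
        rw [lintegral_add_left' (by fun_prop), lintegral_add_left' (by fun_prop)]
    _ ≤ _ := by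
        refine add_le_add (add_le_add ?_ ?_) ?_
        · exact lintegral_enorm_mul_le mU (mV.sub mv)
        · exact lintegral_enorm_mul_le mV (mU.sub mu)
        · exact lintegral_enorm_mul_le (mU.sub mu) (mV.sub mv)

/-- Hölder's inequality with exponents `3/2` and `3` for `|g|² = |g|^(2/3) |g|^(4/3)`. It turns `L¹`
convergence with bounded fourth moments into `L²` convergence. -/
lemma lintegral_sq_le_interpolation {g : Ω → ℝ} (hg : AEMeasurable g μ) :
    ∫⁻ ω, ‖g ω‖ₑ ^ 2 ∂μ ≤
      (∫⁻ ω, ‖g ω‖ₑ ∂μ) ^ (2 / 3 : ℝ) * (∫⁻ ω, ‖g ω‖ₑ ^ 4 ∂μ) ^ (1 / 3 : ℝ) := by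
  have h := ENNReal.lintegral_mul_le_Lp_mul_Lq μ (p := 3 / 2) (q := 3)
    (Real.holderConjugate_iff.2 (by norm_num)) (hg.enorm.pow_const (2 / 3 : ℝ))
    (hg.enorm.pow_const (4 / 3 : ℝ))
  convert h using 2
  · ext ω
    simp only [Pi.mul_apply]
    rw [← ENNReal.rpow_add_of_nonneg _ _ (by norm_num) (by norm_num), ← ENNReal.rpow_natCast]
    norm_num
  · simp_rw [← ENNReal.rpow_mul]
    norm_num
  · simp_rw [← ENNReal.rpow_mul]
    congr 2 with ω
    rw [← ENNReal.rpow_natCast]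
    norm_num

/-- Fatou's lemma along an almost surely convergent subsequence. -/
lemma lintegral_pow_le_of_tendsto {X : Ω → ℝ} {x : ℕ → Ω → ℝ}
    (hX : AEMeasurable X μ) (hx : ∀ n, AEMeasurable (x n) μ)
    (h : Tendsto (fun n => ∫⁻ ω, ‖X ω - x n ω‖ₑ ∂μ) atTop (𝓝 0)) {p : ℕ} {C : ℕ → ℝ≥0∞}
    {C' : ℝ≥0∞} (hC : Tendsto C atTop (𝓝 C')) (hxC : ∀ n, ∫⁻ ω, ‖x n ω‖ₑ ^ p ∂μ ≤ C n) :
    ∫⁻ ω, ‖X ω‖ₑ ^ p ∂μ ≤ C' := by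
  have hmeas : TendstoInMeasure μ x atTop X := by
    refine tendstoInMeasure_of_tendsto_eLpNorm (p := 1) one_ne_zero
      (fun n => (hx n).aestronglyMeasurable) hX.aestronglyMeasurable ?_
    refine h.congr fun n => ?_
    rw [eLpNorm_one_eq_lintegral_enorm]
    congr 1 with ω
    exact enorm_sub_rev _ _
  obtain ⟨ns, hns, hae⟩ := hmeas.exists_seq_tendsto_ae
  have e : ∫⁻ ω, ‖X ω‖ₑ ^ p ∂μ = ∫⁻ ω, liminf (fun k => ‖x (ns k) ω‖ₑ ^ p) atTop ∂μ := by
    refine lintegral_congr_ae ?_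
    filter_upwards [hae] with ω hω
    exact (ENNReal.Tendsto.pow hω.enorm).liminf_eq.symm
  rw [e]
  refine (lintegral_liminf_le' fun k => (hx (ns k)).enorm.pow_const p).trans ?_
  rw [← (hC.comp hns.tendsto_atTop).liminf_eq]
  exact liminf_le_liminf (Eventually.of_forall fun k => hxC (ns k))

/-- Moment bounds and the second moment pass to limits in the mean. -/
lemma moments_of_tendsto {X : Ω → ℝ} {x : ℕ → Ω → ℝ}
    (hX : AEMeasurable X μ) (hx : ∀ n, AEMeasurable (x n) μ)
    (h : Tendsto (fun n => ∫⁻ ω, ‖X ω - x n ω‖ₑ ∂μ) atTop (𝓝 0)) {V : ℕ → ℝ≥0∞} {V' : ℝ≥0∞}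
    (hV' : V' ≠ ⊤) (hV : Tendsto V atTop (𝓝 V'))
    (h2 : ∀ n, ∫⁻ ω, ‖x n ω‖ₑ ^ 2 ∂μ = V n)
    (hp : ∀ n p, 1 ≤ p → ∫⁻ ω, ‖x n ω‖ₑ ^ (2 * p) ∂μ ≤
      ((2 * p - 1).doubleFactorial : ℝ≥0∞) ^ 2 * V n ^ p) :
    (∀ p, 1 ≤ p → ∫⁻ ω, ‖X ω‖ₑ ^ (2 * p) ∂μ ≤
      ((2 * p - 1).doubleFactorial : ℝ≥0∞) ^ 2 * V' ^ p) ∧ ∫⁻ ω, ‖X ω‖ₑ ^ 2 ∂μ = V' := by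
  have hmom : ∀ p, 1 ≤ p → ∫⁻ ω, ‖X ω‖ₑ ^ (2 * p) ∂μ ≤
      ((2 * p - 1).doubleFactorial : ℝ≥0∞) ^ 2 * V' ^ p := fun p hp1 =>
    lintegral_pow_le_of_tendsto hX hx h
      (ENNReal.Tendsto.const_mul (ENNReal.Tendsto.pow hV) (Or.inr (by finiteness)))
      fun n => hp n p hp1
  refine ⟨hmom, ?_⟩
  set D : ℝ≥0∞ := ((2 * 2 - 1).doubleFactorial : ℝ≥0∞) ^ 2 with hD
  -- The case `p = 2` of the bounds controls the fourth moments of `X - x n`, so interpolation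
  -- applies.
  have hlim2 : Tendsto (fun n => ∫⁻ ω, ‖X ω - x n ω‖ₑ ^ 2 ∂μ) atTop (𝓝 0) := by
    have h4 : ∀ n, ∫⁻ ω, ‖X ω - x n ω‖ₑ ^ 4 ∂μ ≤ 8 * (D * V' ^ 2) + 8 * (D * V n ^ 2) := by
      intro n
      calc ∫⁻ ω, ‖X ω - x n ω‖ₑ ^ 4 ∂μ
          ≤ ∫⁻ ω, (8 * ‖X ω‖ₑ ^ 4 + 8 * ‖x n ω‖ₑ ^ 4) ∂μ := by
            refine lintegral_mono fun ω => ?_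
            simp only [← enorm_pow, Real.enorm_eq_ofReal (Even.pow_nonneg (by decide : Even 4) _)]
            rw [show (8 : ℝ≥0∞) = ENNReal.ofReal 8 by simp, ← ENNReal.ofReal_mul (by norm_num),
              ← ENNReal.ofReal_mul (by norm_num), ← ENNReal.ofReal_add (by positivity)
              (by positivity)]
            refine ENNReal.ofReal_le_ofReal ?_
            have h1 : (X ω - x n ω) ^ 2 ≤ 2 * X ω ^ 2 + 2 * x n ω ^ 2 := by
              nlinarith [sq_nonneg (X ω + x n ω)]
            calc (X ω - x n ω) ^ 4 = ((X ω - x n ω) ^ 2) ^ 2 := by ring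
              _ ≤ (2 * X ω ^ 2 + 2 * x n ω ^ 2) ^ 2 := by gcongr
              _ ≤ _ := by nlinarith [sq_nonneg (X ω ^ 2 - x n ω ^ 2)]
        _ = 8 * ∫⁻ ω, ‖X ω‖ₑ ^ 4 ∂μ + 8 * ∫⁻ ω, ‖x n ω‖ₑ ^ 4 ∂μ := by
            have := hx n
            rw [lintegral_add_left' (by fun_prop), lintegral_const_mul' _ _ (by simp),
              lintegral_const_mul' _ _ (by simp)]
        _ ≤ _ := by
            gcongr
            · exact hmom 2 (by norm_num)
            · exact hp n 2 (by norm_num)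
    have hC : Tendsto (fun n => 8 * (D * V' ^ 2) + 8 * (D * V n ^ 2)) atTop
        (𝓝 (8 * (D * V' ^ 2) + 8 * (D * V' ^ 2))) :=
      tendsto_const_nhds.add (ENNReal.Tendsto.const_mul (ENNReal.Tendsto.const_mul
        (ENNReal.Tendsto.pow hV) (Or.inr (by finiteness))) (Or.inr (by simp)))
    have hC' := ((ENNReal.continuous_rpow_const (y := (1 / 3 : ℝ))).tendsto _).comp hC
    have hlim := ENNReal.Tendsto.mul (tendsto_rpow_zero h (x := 2 / 3) (by norm_num))
      (Or.inr (by finiteness)) hC' (Or.inr (by simp))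
    rw [zero_mul] at hlim
    refine tendsto_of_tendsto_of_tendsto_of_le_of_le tendsto_const_nhds hlim
      (fun _ => zero_le) fun n => ?_
    refine (lintegral_sq_le_interpolation (hX.sub (hx n))).trans ?_
    simp only [Function.comp_apply, Pi.sub_apply]
    gcongr
    exact h4 n
  have hnorm : Tendsto (fun n => eLpNorm (x n) 2 μ) atTop (𝓝 (V' ^ (1 / 2 : ℝ))) := by
    have := ((ENNReal.continuous_rpow_const (y := (1 / 2 : ℝ))).tendsto _).comp hV
    refine this.congr fun n => ?_
    rw [eLpNorm_two_eq, h2]; rfl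
  have hdiff : Tendsto (fun n => eLpNorm X 2 μ + eLpNorm (X - x n) 2 μ) atTop
      (𝓝 (eLpNorm X 2 μ + 0)) := by
    refine tendsto_const_nhds.add ((tendsto_rpow_zero hlim2 (x := 1 / 2) (by norm_num)).congr
      fun n => ?_)
    rw [eLpNorm_two_eq]; rfl
  -- Fatou gave only the upper bound for the second moment; the lower one is the triangle inequality
  -- for `x n = X - (X - x n)`.
  have hle : V' ^ (1 / 2 : ℝ) ≤ eLpNorm X 2 μ + 0 := by
    refine le_of_tendsto_of_tendsto' hnorm hdiff fun n => ?_
    calc eLpNorm (x n) 2 μ = eLpNorm (X - (X - x n)) 2 μ := by rw [sub_sub_cancel]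
      _ ≤ _ := eLpNorm_sub_le hX.aestronglyMeasurable
        (hX.sub (hx n)).aestronglyMeasurable (by norm_num)
  rw [add_zero, eLpNorm_two_eq, ENNReal.rpow_le_rpow_iff (by norm_num)] at hle
  refine le_antisymm ?_ hle
  simpa using hmom 1 le_rfl

end Limit

/-! ### Moments of forms in the second chaos -/

section ChaosForm

variable {Ω : Type*} {mΩ : MeasurableSpace Ω} {ι : Type*}

/-- `α I⁽¹²⁾ + β I⁽²¹⁾ - ∑ i, c i * ∫ p i dB₁ * ∫ r i dB₂`. -/
noncomputable def chaosForm (μ : Measure Ω) (ℱ : Filtration ℝ mΩ) (B₁ B₂ : ℝ → Ω → ℝ)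
    (t T α β : ℝ) (S : Finset ι) (c : ι → ℝ) (p r : ι → ℝ → ℝ) (ω : Ω) : ℝ :=
  α * iteratedIto μ ℱ B₁ B₂ t T ω + β * iteratedIto μ ℱ B₂ B₁ t T ω -
    ∑ i ∈ S, c i * (itoIntegral μ ℱ B₁ t T (fun s _ => p i s) ω *
      itoIntegral μ ℱ B₂ t T (fun s _ => r i s) ω)

variable {μ : Measure Ω} {ℱ : Filtration ℝ mΩ} {Θ : ℝ} {B₁ B₂ : ℝ → Ω → ℝ} {t T : ℝ}

lemma sum_gridIncrement {n l : ℕ} (hl : l ∈ Finset.range (n + 1)) (B : ℝ → Ω → ℝ) (ω : Ω) :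
    B (gridPoint t T n l) ω - B t ω =
      ∑ k ∈ Finset.range (n + 1), if k < l then gridIncrement t T n B k ω else 0 := by
  rw [sum_range_ite_lt hl]
  simp only [gridIncrement]
  rw [Finset.sum_range_sub (fun k => B (gridPoint t T n k) ω), gridPoint_zero]

/-- The bilinear form on the uniform partition approximating `chaosForm`. -/
lemma sum_gridKernel_eq (α β : ℝ) (S : Finset ι) (c : ι → ℝ) (p r : ι → ℝ → ℝ) (n : ℕ)
    (B₁ B₂ : ℝ → Ω → ℝ) (ω : Ω) :
    ∑ k : Fin (n + 1), ∑ l : Fin (n + 1), gridKernel t T α β S c p r n k l *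
        gridIncrement t T n B₁ k ω * gridIncrement t T n B₂ l ω =
      α * (∑ l : Fin (n + 1), (B₁ (gridPoint t T n l) ω - B₁ t ω) *
          gridIncrement t T n B₂ l ω) +
      β * (∑ k : Fin (n + 1), (B₂ (gridPoint t T n k) ω - B₂ t ω) *
          gridIncrement t T n B₁ k ω) -
      ∑ i ∈ S, c i * ((∑ k : Fin (n + 1), p i (gridPoint t T n k) * gridIncrement t T n B₁ k ω) *
        ∑ l : Fin (n + 1), r i (gridPoint t T n l) * gridIncrement t T n B₂ l ω) := by
  set x : ℕ → ℝ := fun k => gridIncrement t T n B₁ k ω with hx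
  set y : ℕ → ℝ := fun k => gridIncrement t T n B₂ k ω with hy
  change ∑ k : Fin (n + 1), ∑ l : Fin (n + 1), gridKernel t T α β S c p r n k l * x k * y l =
      α * (∑ l : Fin (n + 1), (B₁ (gridPoint t T n l) ω - B₁ t ω) * y l) +
      β * (∑ k : Fin (n + 1), (B₂ (gridPoint t T n k) ω - B₂ t ω) * x k) -
      ∑ i ∈ S, c i * ((∑ k : Fin (n + 1), p i (gridPoint t T n k) * x k) *
        ∑ l : Fin (n + 1), r i (gridPoint t T n l) * y l)
  set g := gridPoint t T n
  set R := Finset.range (n + 1) with hR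
  have e1 : ∑ l ∈ R, (B₁ (g l) ω - B₁ t ω) * y l =
      ∑ k ∈ R, ∑ l ∈ R, (if k < l then (1 : ℝ) else 0) * x k * y l := by
    rw [Finset.sum_comm]
    refine Finset.sum_congr rfl fun l hl => ?_
    rw [sum_gridIncrement hl, Finset.sum_mul]
    exact Finset.sum_congr rfl fun k _ => by simp [hx]
  have e2 : ∑ k ∈ R, (B₂ (g k) ω - B₂ t ω) * x k =
      ∑ k ∈ R, ∑ l ∈ R, (if l < k then (1 : ℝ) else 0) * x k * y l := by
    refine Finset.sum_congr rfl fun k hk => ?_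
    rw [sum_gridIncrement hk, Finset.sum_mul]
    exact Finset.sum_congr rfl fun k _ => by simp [hy, mul_comm]
  have e3 : ∑ i ∈ S, c i * ((∑ k ∈ R, p i (g k) * x k) * ∑ l ∈ R, r i (g l) * y l) =
      ∑ k ∈ R, ∑ l ∈ R, (∑ i ∈ S, c i * (p i (g k) * r i (g l))) * x k * y l := by
    simp_rw [Finset.sum_mul_sum, Finset.sum_mul, Finset.mul_sum]
    rw [Finset.sum_comm]
    refine Finset.sum_congr rfl fun k _ => ?_
    rw [Finset.sum_comm]
    exact Finset.sum_congr rfl fun l _ => Finset.sum_congr rfl fun i _ => by ring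
  rw [Fin.sum_univ_eq_sum_range (fun k => ∑ l : Fin (n + 1),
      gridKernel t T α β S c p r n k l * x k * y l) (n + 1),
    Fin.sum_univ_eq_sum_range (fun l => (B₁ (g l) ω - B₁ t ω) * y l) (n + 1),
    Fin.sum_univ_eq_sum_range (fun k => (B₂ (g k) ω - B₂ t ω) * x k) (n + 1)]
  have f1 : ∀ i, ∑ k : Fin (n + 1), p i (g k) * x k = ∑ k ∈ R, p i (g k) * x k := fun i =>
    Fin.sum_univ_eq_sum_range (fun k => p i (g k) * x k) (n + 1)
  have f2 : ∀ i, ∑ k : Fin (n + 1), r i (g k) * y k = ∑ k ∈ R, r i (g k) * y k := fun i =>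
    Fin.sum_univ_eq_sum_range (fun k => r i (g k) * y k) (n + 1)
  have f3 : ∀ k, ∑ l : Fin (n + 1), gridKernel t T α β S c p r n k l * x k * y l =
      ∑ l ∈ R, gridKernel t T α β S c p r n k l * x k * y l := fun k =>
    Fin.sum_univ_eq_sum_range (fun l => gridKernel t T α β S c p r n k l * x k * y l) (n + 1)
  simp_rw [f1, f2, f3]
  rw [e1, e2, e3, Finset.mul_sum, Finset.mul_sum, ← Finset.sum_add_distrib,
    ← Finset.sum_sub_distrib]
  refine Finset.sum_congr rfl fun k _ => ?_
  rw [Finset.mul_sum, Finset.mul_sum, ← Finset.sum_add_distrib, ← Finset.sum_sub_distrib]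
  refine Finset.sum_congr rfl fun l _ => ?_
  simp only [gridKernel]
  split_ifs <;> ring

/-- The defining formula does not show the sign; as a limit of sums of squares the quantity is
nonnegative. -/
lemma kernelNormSq_nonneg (htT : t ≤ T) (α β : ℝ) (S : Finset ι) (c : ι → ℝ)
    {p r : ι → ℝ → ℝ} (hp : ∀ i, Continuous (p i)) (hr : ∀ i, Continuous (r i)) :
    0 ≤ kernelNormSq t T α β S c p r :=
  ge_of_tendsto' (tendsto_gridKernel htT α β S c hp hr) fun n => by positivity

lemma tendsto_lintegral_combination {U V : Ω → ℝ} {u v : ℕ → Ω → ℝ} {A : ι → Ω → ℝ}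
    {a : ι → ℕ → Ω → ℝ} (α β : ℝ) (S : Finset ι) (c : ι → ℝ)
    (hU : AEMeasurable U μ) (hV : AEMeasurable V μ) (hA : ∀ i, AEMeasurable (A i) μ)
    (hu : ∀ n, AEMeasurable (u n) μ) (hv : ∀ n, AEMeasurable (v n) μ)
    (ha : ∀ i n, AEMeasurable (a i n) μ)
    (hUu : Tendsto (fun n => ∫⁻ ω, ‖U ω - u n ω‖ₑ ∂μ) atTop (𝓝 0))
    (hVv : Tendsto (fun n => ∫⁻ ω, ‖V ω - v n ω‖ₑ ∂μ) atTop (𝓝 0))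
    (hAa : ∀ i, Tendsto (fun n => ∫⁻ ω, ‖A i ω - a i n ω‖ₑ ∂μ) atTop (𝓝 0)) :
    Tendsto (fun n => ∫⁻ ω, ‖(α * U ω + β * V ω - ∑ i ∈ S, c i * A i ω) -
      (α * u n ω + β * v n ω - ∑ i ∈ S, c i * a i n ω)‖ₑ ∂μ) atTop (𝓝 0) := by
  have hsum := ((ENNReal.Tendsto.const_mul hUu (a := ‖α‖ₑ) (by simp)).add
    (ENNReal.Tendsto.const_mul hVv (a := ‖β‖ₑ) (by simp))).add
    (tendsto_finsetSum S fun i _ => ENNReal.Tendsto.const_mul (hAa i) (a := ‖c i‖ₑ) (by simp))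
  simp only [mul_zero, add_zero, Finset.sum_const_zero] at hsum
  refine tendsto_of_tendsto_of_tendsto_of_le_of_le tendsto_const_nhds hsum
    (fun _ => zero_le) fun n => ?_
  have b1 : AEMeasurable (fun ω => ‖α‖ₑ * ‖U ω - u n ω‖ₑ) μ :=
    (hU.sub (hu n)).enorm.const_mul _
  have b2 : AEMeasurable (fun ω => ‖β‖ₑ * ‖V ω - v n ω‖ₑ) μ :=
    (hV.sub (hv n)).enorm.const_mul _
  have b12 : AEMeasurable (fun ω => ‖α‖ₑ * ‖U ω - u n ω‖ₑ + ‖β‖ₑ * ‖V ω - v n ω‖ₑ) μ := b1.add b2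
  have b3 : ∀ i ∈ S, AEMeasurable (fun ω => ‖c i‖ₑ * ‖A i ω - a i n ω‖ₑ) μ := fun i _ =>
    ((hA i).sub (ha i n)).enorm.const_mul _
  have hpt : ∀ ω, ‖(α * U ω + β * V ω - ∑ i ∈ S, c i * A i ω) -
      (α * u n ω + β * v n ω - ∑ i ∈ S, c i * a i n ω)‖ₑ ≤
      ‖α‖ₑ * ‖U ω - u n ω‖ₑ + ‖β‖ₑ * ‖V ω - v n ω‖ₑ +
        ∑ i ∈ S, ‖c i‖ₑ * ‖A i ω - a i n ω‖ₑ := by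
    intro ω
    have : (α * U ω + β * V ω - ∑ i ∈ S, c i * A i ω) -
        (α * u n ω + β * v n ω - ∑ i ∈ S, c i * a i n ω) =
        α * (U ω - u n ω) + β * (V ω - v n ω) - ∑ i ∈ S, c i * (A i ω - a i n ω) := by
      simp_rw [mul_sub, Finset.sum_sub_distrib]
      ring
    rw [this]
    refine enorm_sub_le.trans (add_le_add ((enorm_add_le _ _).trans ?_) ?_)
    · simp only [enorm_mul, le_refl]
    · refine (enorm_sum_le _ _).trans ?_
      simp only [enorm_mul, le_refl]
  refine (lintegral_mono hpt).trans (le_of_eq ?_)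
  rw [lintegral_add_left' b12, lintegral_add_left' b1,
    lintegral_const_mul' _ _ (by simp), lintegral_const_mul' _ _ (by simp),
    lintegral_finsetSum' _ b3]
  congr 1
  exact Finset.sum_congr rfl fun i _ => lintegral_const_mul' _ _ (by simp)

variable [IsProbabilityMeasure μ] {m : ℕ} {w : Fin m → ℝ → Ω → ℝ}

/-- All integrals in the form are discretized on the same grid, which makes the approximation a
single bilinear form with matrix `gridKernel`. Independence of the two components enters only
through this bilinear form. -/
theorem lintegral_chaosForm (hw : IsWienerProcess μ ℱ Θ w) {i₁ i₂ : Fin m} (hi : i₁ ≠ i₂)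
    (ht : 0 ≤ t) (htT : t ≤ T) (hT : T ≤ Θ) (α β : ℝ) (S : Finset ι) (c : ι → ℝ)
    {p r : ι → ℝ → ℝ} (hp : ∀ i, Continuous (p i)) (hr : ∀ i, Continuous (r i)) :
    AEMeasurable (chaosForm μ ℱ (w i₁) (w i₂) t T α β S c p r) μ ∧
    (∀ n, 1 ≤ n → ∫⁻ ω, ‖chaosForm μ ℱ (w i₁) (w i₂) t T α β S c p r ω‖ₑ ^ (2 * n) ∂μ ≤
      ((2 * n - 1).doubleFactorial : ℝ≥0∞) ^ 2 *
        ENNReal.ofReal (kernelNormSq t T α β S c p r) ^ n) ∧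
    ∫⁻ ω, ‖chaosForm μ ℱ (w i₁) (w i₂) t T α β S c p r ω‖ₑ ^ 2 ∂μ =
      ENNReal.ofReal (kernelNormSq t T α β S c p r) := by
  have hB₁ := hw.isBrownian i₁
  have hB₂ := hw.isBrownian i₂
  obtain ⟨-, m12, l12⟩ := iteratedIto_grid hB₁ hB₂ ht htT hT
  obtain ⟨-, m21, l21⟩ := iteratedIto_grid hB₂ hB₁ ht htT hT
  have z1 := fun i => (itoIntegral_continuous hB₁ ht htT hT (hp i)).2
  have z2 := fun i => (itoIntegral_continuous hB₂ ht htT hT (hr i)).2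
  have hm : ∀ s ∈ Set.Icc t T, Measurable (w i₁ s) ∧ Measurable (w i₂ s) := fun s hs =>
    ⟨hB₁.measurable (ht.trans hs.1) (hs.2.trans hT), hB₂.measurable (ht.trans hs.1) (hs.2.trans hT)⟩
  have hmt := hm t ⟨le_rfl, htT⟩
  have g1 : ∀ n (k : Fin (n + 1)), Measurable (gridIncrement t T n (w i₁) k) :=
    fun n => (hB₁.isGaussianFamily ht htT hT n).1
  have g2 : ∀ n (k : Fin (n + 1)), Measurable (gridIncrement t T n (w i₂) k) :=
    fun n => (hB₂.isGaussianFamily ht htT hT n).1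
  have hmg : ∀ n (k : Fin (n + 1)), Measurable (w i₁ (gridPoint t T n k)) ∧
      Measurable (w i₂ (gridPoint t T n k)) := fun n k => hm _ (gridPoint_mem htT k.2.le)
  have hmX : AEMeasurable (chaosForm μ ℱ (w i₁) (w i₂) t T α β S c p r) μ := by
    exact ((m12.aemeasurable.const_mul α).add (m21.aemeasurable.const_mul β)).sub
      (Finset.aemeasurable_fun_sum _ fun i _ =>
        ((z1 i).1.aemeasurable.mul (z2 i).1.aemeasurable).const_mul _)
  refine ⟨hmX, ?_⟩
  let x : ℕ → Ω → ℝ := fun n ω => ∑ k : Fin (n + 1), ∑ l : Fin (n + 1),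
    gridKernel t T α β S c p r n k l * gridIncrement t T n (w i₁) k ω *
      gridIncrement t T n (w i₂) l ω
  have hmx : ∀ n, AEMeasurable (x n) μ := fun n =>
    (Finset.measurable_fun_sum _ fun k _ => Finset.measurable_fun_sum _ fun l _ =>
      ((g1 n k).const_mul _).mul (g2 n l)).aemeasurable
  let J12 : ℕ → Ω → ℝ := fun n ω => ∑ l : Fin (n + 1),
    (w i₁ (gridPoint t T n l) ω - w i₁ t ω) * gridIncrement t T n (w i₂) l ω
  let J21 : ℕ → Ω → ℝ := fun n ω => ∑ l : Fin (n + 1),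
    (w i₂ (gridPoint t T n l) ω - w i₂ t ω) * gridIncrement t T n (w i₁) l ω
  let Z1 : ι → ℕ → Ω → ℝ := fun i n ω => ∑ k : Fin (n + 1),
    p i (gridPoint t T n k) * gridIncrement t T n (w i₁) k ω
  let Z2 : ι → ℕ → Ω → ℝ := fun i n ω => ∑ k : Fin (n + 1),
    r i (gridPoint t T n k) * gridIncrement t T n (w i₂) k ω
  have mJ12 : ∀ n, AEMeasurable (J12 n) μ := fun n =>
    (Finset.measurable_fun_sum _ fun k _ =>
      ((hmg n k).1.sub hmt.1).mul (g2 n k)).aemeasurable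
  have mJ21 : ∀ n, AEMeasurable (J21 n) μ := fun n =>
    (Finset.measurable_fun_sum _ fun k _ =>
      ((hmg n k).2.sub hmt.2).mul (g1 n k)).aemeasurable
  have mZ1 : ∀ i n, AEMeasurable (Z1 i n) μ := fun i n =>
    (Finset.measurable_fun_sum _ fun k _ => (g1 n k).const_mul _).aemeasurable
  have mZ2 : ∀ i n, AEMeasurable (Z2 i n) μ := fun i n =>
    (Finset.measurable_fun_sum _ fun k _ => (g2 n k).const_mul _).aemeasurable
  have L12 := tendsto_lintegral_of_sq m12.aemeasurable mJ12 l12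
  have L21 := tendsto_lintegral_of_sq m21.aemeasurable mJ21 l21
  have LZ := fun i => tendsto_lintegral_mul (z1 i).1 (z2 i).1 (mZ1 i) (mZ2 i) (z1 i).2 (z2 i).2
  have hlim : Tendsto (fun n => ∫⁻ ω, ‖chaosForm μ ℱ (w i₁) (w i₂) t T α β S c p r ω -
      x n ω‖ₑ ∂μ) atTop (𝓝 0) := by
    refine (tendsto_lintegral_combination α β S c m12.aemeasurable m21.aemeasurable
      (fun i => (z1 i).1.aemeasurable.mul (z2 i).1.aemeasurable) mJ12 mJ21
      (fun i n => (mZ1 i n).mul (mZ2 i n)) L12 L21 LZ).congr fun n => ?_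
    refine lintegral_congr fun ω => ?_
    simp only [x, sum_gridKernel_eq]
    rfl
  -- The variance of the bilinear form: both families have variance equal to the mesh, hence its
  -- square.
  set V : ℕ → ℝ≥0∞ := fun n => (((T - t) / (n + 1)).toNNReal : ℝ≥0∞) ^ 2 *
    ∑ k : Fin (n + 1), ∑ l : Fin (n + 1), ‖gridKernel t T α β S c p r n k l‖ₑ ^ 2 with hVdef
  have hV : Tendsto V atTop (𝓝 (ENNReal.ofReal (kernelNormSq t T α β S c p r))) := by
    refine (ENNReal.tendsto_ofReal (tendsto_gridKernel htT α β S c hp hr)).congr fun n => ?_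
    have h0 : 0 ≤ (T - t) / ((n : ℝ) + 1) := div_nonneg (sub_nonneg.2 htT) (by positivity)
    rw [ENNReal.ofReal_mul (by positivity), ENNReal.ofReal_pow h0, hVdef]
    simp only [ENNReal.ofReal]
    congr 1
    change ENNReal.ofReal _ = _
    rw [ENNReal.ofReal_sum_of_nonneg fun _ _ => Finset.sum_nonneg fun _ _ => sq_nonneg _,
      Finset.sum_range]
    refine Finset.sum_congr rfl fun k _ => ?_
    rw [ENNReal.ofReal_sum_of_nonneg fun _ _ => sq_nonneg _, Finset.sum_range]
    refine Finset.sum_congr rfl fun l _ => ?_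
    rw [← enorm_pow, Real.enorm_eq_ofReal (sq_nonneg _)]
  exact moments_of_tendsto hmX hmx hlim ENNReal.ofReal_ne_top hV
    (fun n => lintegral_bilinear_sq (hB₁.isGaussianFamily ht htT hT n)
      (hB₂.isGaussianFamily ht htT hT n) (hw.indepFun_gridIncrement hi ht htT hT n) _)
    (fun n p hp => lintegral_bilinear_pow_le (hB₁.isGaussianFamily ht htT hT n)
      (hB₂.isGaussianFamily ht htT hT n) (hw.indepFun_gridIncrement hi ht htT hT n) _ hp)

/-- The second moment and bounds for all even moments of a form in the second chaos. -/
theorem chaosForm_moments (hw : IsWienerProcess μ ℱ Θ w) {i₁ i₂ : Fin m} (hi : i₁ ≠ i₂)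
    (ht : 0 ≤ t) (htT : t ≤ T) (hT : T ≤ Θ) (α β : ℝ) (S : Finset ι) (c : ι → ℝ)
    {p r : ι → ℝ → ℝ} (hp : ∀ i, Continuous (p i)) (hr : ∀ i, Continuous (r i)) :
    (∀ n, Integrable (fun ω => chaosForm μ ℱ (w i₁) (w i₂) t T α β S c p r ω ^ (2 * n)) μ) ∧
    (∀ n, 1 ≤ n → ∫ ω, chaosForm μ ℱ (w i₁) (w i₂) t T α β S c p r ω ^ (2 * n) ∂μ ≤
      ((2 * n - 1).doubleFactorial : ℝ) ^ 2 * kernelNormSq t T α β S c p r ^ n) ∧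
    ∫ ω, chaosForm μ ℱ (w i₁) (w i₂) t T α β S c p r ω ^ 2 ∂μ = kernelNormSq t T α β S c p r := by
  obtain ⟨hm, hle, h2⟩ := lintegral_chaosForm hw hi ht htT hT α β S c hp hr
  have hK := kernelNormSq_nonneg htT α β S c hp hr
  set X := chaosForm μ ℱ (w i₁) (w i₂) t T α β S c p r
  have hint : ∀ n, ∫ ω, X ω ^ (2 * n) ∂μ = (∫⁻ ω, ‖X ω‖ₑ ^ (2 * n) ∂μ).toReal := fun n => by
    rw [integral_eq_lintegral_of_nonneg_ae
      (Eventually.of_forall fun ω => (even_two_mul n).pow_nonneg _)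
      (hm.pow_const _).aestronglyMeasurable]
    congr 2 with ω
    rw [← enorm_pow, Real.enorm_eq_ofReal ((even_two_mul n).pow_nonneg _)]
  refine ⟨fun n => ?_, fun n hn => ?_, ?_⟩
  · rcases Nat.eq_zero_or_pos n with rfl | hn
    · simp
    refine ⟨(hm.pow_const _).aestronglyMeasurable, ?_⟩
    rw [hasFiniteIntegral_iff_enorm]
    simp_rw [enorm_pow]
    exact (hle n hn).trans_lt (by finiteness)
  · rw [hint]
    refine (ENNReal.toReal_mono (by finiteness) (hle n hn)).trans (le_of_eq ?_)
    simp [ENNReal.toReal_ofReal hK]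
  · have := hint 1
    rw [mul_one] at this
    rw [this, h2, ENNReal.toReal_ofReal hK]

end ChaosForm

/-! ### Iterated integrals of basis functions and the error of an orthonormal truncation -/

section Kernel

variable {t T : ℝ}

/-- Integration by parts. If one function has mean zero, exchanging the two changes the sign, so
only one order has to be computed. -/
lemma iteratedIntegral_add_swap {p r : ℝ → ℝ} (hp : Continuous p) (hr : Continuous r) :
    iteratedIntegral t T p r + iteratedIntegral t T r p =
      (∫ s in t..T, p s) * ∫ s in t..T, r s := by
  have hp' : ∀ x, HasDerivAt (fun s => ∫ τ in t..s, p τ) (p x) x := fun x =>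
    intervalIntegral.integral_hasDerivAt_right (hp.intervalIntegrable _ _)
      (hp.stronglyMeasurableAtFilter _ _) hp.continuousAt
  have hr' : ∀ x, HasDerivAt (fun s => ∫ τ in t..s, r τ) (r x) x := fun x =>
    intervalIntegral.integral_hasDerivAt_right (hr.intervalIntegrable _ _)
      (hr.stronglyMeasurableAtFilter _ _) hr.continuousAt
  have := intervalIntegral.integral_mul_deriv_eq_deriv_mul (a := t) (b := T)
    (fun x _ => hp' x) (fun x _ => hr' x) (hp.intervalIntegrable _ _) (hr.intervalIntegrable _ _)
  simp only [intervalIntegral.integral_same, mul_zero, sub_zero] at this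
  simp only [iteratedIntegral, mul_comm (r _)]
  linarith

/-- The coefficients of an orthonormal expansion minimize the norm of the kernel of the Levy
area. -/
lemma kernelNormSq_orthonormal {ι : Type*} (S : Finset ι) {φ : ℕ → ℝ → ℝ} {e₁ e₂ : ι → ℕ}
    {c : ι → ℝ}
    (horth : ∀ i j, ∫ s in t..T, φ i s * φ j s = if i = j then 1 else 0)
    (hinj : ∀ i ∈ S, ∀ j ∈ S, e₁ i = e₁ j → e₂ i = e₂ j → i = j)
    (hc : ∀ i ∈ S, iteratedIntegral t T (φ (e₁ i)) (φ (e₂ i)) = c i)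
    (hc' : ∀ i ∈ S, iteratedIntegral t T (φ (e₂ i)) (φ (e₁ i)) = - c i) :
    kernelNormSq t T (1 / 2) (-1 / 2) S c (fun i => φ (e₁ i)) (fun i => φ (e₂ i)) =
      (T - t) ^ 2 / 4 - ∑ i ∈ S, c i ^ 2 := by
  have h1 : ∑ i ∈ S, c i * (1 / 2 * iteratedIntegral t T (φ (e₁ i)) (φ (e₂ i)) +
      -1 / 2 * iteratedIntegral t T (φ (e₂ i)) (φ (e₁ i))) = ∑ i ∈ S, c i ^ 2 :=
    Finset.sum_congr rfl fun i hi => by rw [hc i hi, hc' i hi]; ring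
  have h2 : ∑ i ∈ S, ∑ j ∈ S, c i * c j * ((∫ s in t..T, φ (e₁ i) s * φ (e₁ j) s) *
      ∫ s in t..T, φ (e₂ i) s * φ (e₂ j) s) = ∑ i ∈ S, c i ^ 2 := by
    refine Finset.sum_congr rfl fun i hi => ?_
    -- Distinct indices give distinct pairs of basis functions, so in each off-diagonal term at
    -- least one of the two integrals vanishes.
    rw [Finset.sum_eq_single_of_mem i hi]
    · simp [horth, sq]
    · intro j hj hji
      rw [horth, horth]
      split_ifs with h h'
      · exact absurd (hinj i hi j hj h h').symm hji
      all_goals simp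
  rw [kernelNormSq, h1, h2]
  ring

end Kernel

/-! ### The symmetric part of the iterated integral -/

section Symmetrization

variable {Ω : Type*} {mΩ : MeasurableSpace Ω} {μ : Measure Ω} {ℱ : Filtration ℝ mΩ} {Θ : ℝ}
  [IsProbabilityMeasure μ] {m : ℕ} {w : Fin m → ℝ → Ω → ℝ} {t T : ℝ}

/-- `I⁽¹²⁾ + I⁽²¹⁾ = (B₁(T) - B₁(t)) (B₂(T) - B₂(t))`, written with `ζ₀`. -/
lemma iteratedIto_add_swap (hw : IsWienerProcess μ ℱ Θ w) {i₁ i₂ : Fin m} (hi : i₁ ≠ i₂)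
    (ht : 0 ≤ t) (htT : t < T) (hT : T ≤ Θ) {φ : ℕ → ℝ → ℝ} (hφ : ∀ s, φ 0 s = 1 / √(T - t)) :
    ∀ᵐ ω ∂μ, iteratedIto μ ℱ (w i₁) (w i₂) t T ω + iteratedIto μ ℱ (w i₂) (w i₁) t T ω =
      (T - t) * (zeta μ ℱ φ (w i₁) t T 0 ω * zeta μ ℱ φ (w i₂) t T 0 ω) := by
  have hφ' : φ 0 = fun _ => 1 / √(T - t) := funext hφ
  have hcont : Continuous (φ 0) := by rw [hφ']; exact continuous_const
  have hpos : 0 < T - t := sub_pos.2 htT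
  have hs : √(T - t) * √(T - t) = T - t := Real.mul_self_sqrt hpos.le
  have hs0 : √(T - t) ≠ 0 := (Real.sqrt_pos.2 hpos).ne'
  -- With `α = β = 1` and the single coefficient `T - t` the kernel vanishes off the diagonal, since
  -- `φ 0` has the constant value `1 / √(T - t)`. Its norm is `0`, so the form vanishes almost
  -- surely.
  obtain ⟨hint, -, h2⟩ := chaosForm_moments hw hi ht htT.le hT 1 1 (Finset.univ : Finset Unit)
    (fun _ => T - t) (p := fun _ => φ 0) (r := fun _ => φ 0) (fun _ => hcont) (fun _ => hcont)
  have h1 : ∫ s in t..T, φ 0 s = √(T - t) := by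
    rw [hφ']
    simp only [intervalIntegral.integral_const, smul_eq_mul]
    field_simp
    linarith
  have hsq : ∫ s in t..T, φ 0 s * φ 0 s = 1 := by
    rw [hφ']
    simp only [intervalIntegral.integral_const, smul_eq_mul]
    field_simp
    linarith
  have hI : iteratedIntegral t T (φ 0) (φ 0) = (T - t) / 2 := by
    have := iteratedIntegral_add_swap (t := t) (T := T) hcont hcont
    rw [h1, hs] at this
    linarith
  have hK : kernelNormSq t T 1 1 (Finset.univ : Finset Unit) (fun _ => T - t)
      (fun _ => φ 0) (fun _ => φ 0) = 0 := by
    simp only [kernelNormSq, hI, hsq, Finset.univ_unique, Finset.sum_singleton]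
    ring
  rw [hK] at h2
  have hint1 := hint 1
  rw [mul_one] at hint1
  rw [integral_eq_zero_iff_of_nonneg (fun ω => sq_nonneg _) hint1] at h2
  filter_upwards [h2] with ω hω
  have := pow_eq_zero_iff (two_ne_zero) |>.1 hω
  simp only [chaosForm, Finset.univ_unique, Finset.sum_singleton] at this
  simp only [zeta]
  linarith

end Symmetrization

/-! ### Constants and tails of the error series -/

section Constants

/-- One double factorial is already a factor of the constant; the other is at most `(2n - 1)^n`,
which the power of `n (2n - 1)` absorbs. -/
lemma doubleFactorial_sq_le_momentConst {n : ℕ} (hn : 1 ≤ n) :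
    ((2 * n - 1).doubleFactorial : ℝ) ^ 2 ≤ momentConst n 2 := by
  have h1 : ∀ k : ℕ, (2 * k + 1).doubleFactorial ≤ (2 * k + 1) ^ (k + 1) := by
    intro k
    induction k with
    | zero => simp
    | succ k ih =>
      rw [show 2 * (k + 1) + 1 = 2 * k + 1 + 2 by ring, Nat.doubleFactorial_add_two,
        pow_succ' _ (k + 1)]
      exact Nat.mul_le_mul le_rfl (ih.trans (Nat.pow_le_pow_left (by omega) _))
  obtain ⟨k, rfl⟩ : ∃ k, n = k + 1 := ⟨n - 1, by omega⟩
  have h2 : ((2 * (k + 1) - 1).doubleFactorial : ℝ) ≤ (2 * ((k + 1 : ℕ) : ℝ) - 1) ^ (k + 1) := by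
    rw [show 2 * (k + 1) - 1 = 2 * k + 1 by omega]
    have := h1 k
    have h3 : ((2 * k + 1).doubleFactorial : ℝ) ≤ ((2 * k + 1 : ℕ) : ℝ) ^ (k + 1) := by
      exact_mod_cast this
    refine h3.trans (le_of_eq ?_)
    push_cast
    ring
  have hbase : (1 : ℝ) ≤ 2 * ((k + 1 : ℕ) : ℝ) - 1 := by push_cast; linarith [k.cast_nonneg (α := ℝ)]
  rw [momentConst, sq]
  refine mul_le_mul_of_nonneg_right (h2.trans ?_) (Nat.cast_nonneg _)
  have h4 : (1 : ℝ) ≤ (Nat.factorial 2 : ℝ) ^ (2 * (k + 1)) := one_le_pow₀ (by norm_num)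
  have h5 : (2 * ((k + 1 : ℕ) : ℝ) - 1) ^ (k + 1) ≤
      (((k + 1 : ℕ) : ℝ) * (2 * ((k + 1 : ℕ) : ℝ) - 1)) ^ ((k + 1) * (2 - 1)) := by
    rw [show (k + 1) * (2 - 1) = k + 1 by omega]
    refine pow_le_pow_left₀ (by linarith) ?_ _
    refine le_mul_of_one_le_left (by linarith) ?_
    exact_mod_cast Nat.le_add_left 1 k
  calc (2 * ((k + 1 : ℕ) : ℝ) - 1) ^ (k + 1) ≤ _ := h5
    _ ≤ _ := le_mul_of_one_le_left (by positivity) h4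

/-- The sum telescopes because `4i² - 1 = (2i - 1)(2i + 1)`. The closed form shows the decay `1/q`
and the sign of the error. -/
lemma sum_one_div_four_sq_sub_one (q : ℕ) :
    1 / 2 - ∑ i ∈ Finset.Icc 1 q, 1 / (4 * (i : ℝ) ^ 2 - 1) =
      1 / (2 * (2 * (q : ℝ) + 1)) := by
  induction q with
  | zero => simp
  | succ q ih =>
    rw [Finset.sum_Icc_succ_top (by omega), ← sub_sub, ih]
    have h1 : (2 * (q : ℝ) + 1) ≠ 0 := by positivity
    have h2 : (2 * (q : ℝ) + 3) ≠ 0 := by positivity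
    have h3 : 4 * ((q + 1 : ℕ) : ℝ) ^ 2 - 1 = (2 * q + 1) * (2 * q + 3) := by push_cast; ring
    rw [h3]
    push_cast
    rw [show 2 * ((q : ℝ) + 1) + 1 = 2 * q + 3 by ring]
    field_simp
    ring

lemma tendsto_basel : Tendsto (fun q : ℕ => Real.pi ^ 2 / 6 -
    ∑ r ∈ Finset.Icc 1 q, 1 / (r : ℝ) ^ 2) atTop (𝓝 0) := by
  have h := hasSum_zeta_two.tendsto_sum_nat.comp (tendsto_add_atTop_nat 1)
  have h2 := h.const_sub (Real.pi ^ 2 / 6)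
  rw [sub_self] at h2
  refine h2.congr fun q => ?_
  simp only [Function.comp_apply]
  congr 1
  -- The series for `ζ(2)` starts at `0`, where the term is `1 / 0 = 0`.
  rw [Finset.range_eq_Ico, Finset.sum_eq_sum_Ico_succ_bot (by omega)]
  simp only [Nat.cast_zero, ne_eq, OfNat.ofNat_ne_zero, not_false_eq_true, zero_pow, div_zero,
    zero_add]
  rfl

/-- The tail minus `1/q` increases with `q`, by `1/(q+1)² + 1/(q+1) ≤ 1/q`, and tends to `0`, so it
is never positive. -/
lemma basel_tail_le {q : ℕ} (hq : 1 ≤ q) :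
    Real.pi ^ 2 / 6 - ∑ r ∈ Finset.Icc 1 q, 1 / (r : ℝ) ^ 2 ≤ 1 / q := by
  have hmono : Monotone fun k : ℕ => Real.pi ^ 2 / 6 -
      ∑ r ∈ Finset.Icc 1 (k + 1), 1 / (r : ℝ) ^ 2 - 1 / ((k + 1 : ℕ) : ℝ) := by
    refine monotone_nat_of_le_succ fun k => ?_
    rw [Finset.sum_Icc_succ_top (by omega : 1 ≤ k + 1 + 1)]
    have h0 : (0 : ℝ) < k + 1 := by positivity
    have h1 : (0 : ℝ) < (k + 1) + 1 := by positivity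
    have : 1 / ((k : ℝ) + 1 + 1) ^ 2 + 1 / ((k : ℝ) + 1 + 1) ≤ 1 / ((k : ℝ) + 1) := by
      rw [div_add_div _ _ (by positivity) (by positivity), div_le_div_iff₀ (by positivity) h0]
      nlinarith [sq_nonneg ((k : ℝ) + 1)]
    push_cast at this ⊢
    linarith
  have hlim : Tendsto (fun k : ℕ => Real.pi ^ 2 / 6 -
      ∑ r ∈ Finset.Icc 1 (k + 1), 1 / (r : ℝ) ^ 2 - 1 / ((k + 1 : ℕ) : ℝ)) atTop (𝓝 0) := by
    have h1 := tendsto_basel.comp (tendsto_add_atTop_nat 1)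
    have h2 := tendsto_one_div_add_atTop_nhds_zero_nat (𝕜 := ℝ)
    have := h1.sub h2
    rw [sub_zero] at this
    refine this.congr fun k => ?_
    simp
  obtain ⟨k, rfl⟩ : ∃ k, q = k + 1 := ⟨q - 1, by omega⟩
  have := hmono.ge_of_tendsto hlim k
  linarith

end Constants

/-! ### Almost sure convergence -/

section AlmostSure

variable {Ω : Type*} {mΩ : MeasurableSpace Ω} {μ : Measure Ω}

/-- The expectations of `Y q ^ 4` are summable, so the series of fourth powers converges almost
surely and its terms tend to `0`. Second moments bounded by a multiple of `1/q` would not suffice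
for this argument. -/
lemma ae_tendsto_zero_of_fourth_moment {Y : ℕ → Ω → ℝ}
    (hY : ∀ q, Integrable (fun ω => Y q ω ^ 4) μ) {K : ℝ}
    (hK : ∀ q : ℕ, 1 ≤ q → ∫ ω, Y q ω ^ 4 ∂μ ≤ K / (q : ℝ) ^ 2) :
    ∀ᵐ ω ∂μ, Tendsto (fun q => Y q ω) atTop (𝓝 0) := by
  have h4 : ∀ x : ℝ, 0 ≤ x ^ 4 := fun x => (by decide : Even 4).pow_nonneg x
  have hK0 : 0 ≤ K := by
    have := (integral_nonneg fun ω => h4 (Y 1 ω)).trans (hK 1 le_rfl)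
    simpa using this
  have hsum : ∑' q : ℕ, ∫⁻ ω, ENNReal.ofReal (Y (q + 1) ω ^ 4) ∂μ ≠ ⊤ := by
    have hle : ∀ q : ℕ, ∫⁻ ω, ENNReal.ofReal (Y (q + 1) ω ^ 4) ∂μ ≤
        ENNReal.ofReal (K / ((q + 1 : ℕ) : ℝ) ^ 2) := fun q => by
      rw [← ofReal_integral_eq_lintegral_ofReal (hY _) (Eventually.of_forall fun ω => h4 _)]
      exact ENNReal.ofReal_le_ofReal (hK _ (by omega))
    have hs : Summable fun q : ℕ => K / ((q + 1 : ℕ) : ℝ) ^ 2 := by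
      have := (Real.summable_one_div_nat_pow (p := 2)).2 (by norm_num)
      have := ((summable_nat_add_iff 1).2 this).mul_left K
      simpa [mul_one_div, div_eq_mul_inv] using this
    refine ne_top_of_le_ne_top ?_ (ENNReal.tsum_le_tsum hle)
    rw [← ENNReal.ofReal_tsum_of_nonneg (fun q => by positivity) hs]
    exact ENNReal.ofReal_ne_top
  rw [← lintegral_tsum fun q => (hY (q + 1)).aemeasurable.ennreal_ofReal] at hsum
  have hfin := ae_lt_top' (AEMeasurable.tsum fun q =>
    (hY (q + 1)).aemeasurable.ennreal_ofReal) hsum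
  filter_upwards [hfin] with ω hω
  have h0 := ENNReal.tendsto_atTop_zero_of_tsum_ne_top hω.ne
  have h1 := (ENNReal.tendsto_toReal ENNReal.zero_ne_top).comp h0
  simp only [ENNReal.toReal_zero] at h1
  have h2 : Tendsto (fun q => Y (q + 1) ω ^ 4) atTop (𝓝 0) :=
    h1.congr fun q => ENNReal.toReal_ofReal (h4 _)
  rw [← tendsto_add_atTop_iff_nat 1]
  have h3 := h2.sqrt.sqrt
  simp only [Real.sqrt_zero] at h3
  rw [tendsto_zero_iff_abs_tendsto_zero]
  refine h3.congr fun q => ?_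
  simp only [Function.comp_apply]
  rw [show Y (q + 1) ω ^ 4 = (Y (q + 1) ω ^ 2) ^ 2 by ring, Real.sqrt_sq (sq_nonneg _),
    Real.sqrt_sq_eq_abs]

end AlmostSure

/-! ### Legendre polynomials on `[-1, 1]` -/

section Legendre

open Polynomial

/-- `∫_{-1}^1 p`. -/
noncomputable def polyIntegral (p : ℝ[X]) : ℝ := ∫ x in (-1 : ℝ)..1, p.eval x

lemma polyIntegral_add (p q : ℝ[X]) :
    polyIntegral (p + q) = polyIntegral p + polyIntegral q := by
  simp only [polyIntegral, eval_add]
  exact intervalIntegral.integral_add (p.continuous.intervalIntegrable _ _)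
    (q.continuous.intervalIntegrable _ _)

lemma polyIntegral_C_mul (a : ℝ) (p : ℝ[X]) : polyIntegral (C a * p) = a * polyIntegral p := by
  simp [polyIntegral]

lemma integral_derivative (p : ℝ[X]) (a b : ℝ) :
    ∫ x in a..b, (derivative p).eval x = p.eval b - p.eval a :=
  intervalIntegral.integral_eq_sub_of_hasDerivAt (fun x _ => p.hasDerivAt x)
    ((derivative p).continuous.intervalIntegrable _ _)

lemma polyIntegral_derivative_mul (p q : ℝ[X]) (h1 : p.eval 1 = 0) (h2 : p.eval (-1) = 0) :
    polyIntegral (derivative p * q) = - polyIntegral (p * derivative q) := by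
  have h := integral_derivative (p * q) (-1) 1
  change polyIntegral (derivative (p * q)) = _ at h
  rw [derivative_mul, polyIntegral_add, eval_mul, eval_mul, h1, h2] at h
  linarith

lemma eval_iterate_derivative_eq_zero {n k : ℕ} (hk : k < n) {x : ℝ} (hx : x ^ 2 = 1) :
    (derivative^[k] ((X ^ 2 - 1 : ℝ[X]) ^ n)).eval x = 0 := by
  have h1 : (X ^ 2 - 1 : ℝ[X]) ∣ derivative^[k] ((X ^ 2 - 1 : ℝ[X]) ^ n) :=
    (dvd_pow_self _ (by omega)).trans
      (pow_sub_dvd_iterate_derivative_of_pow_dvd k (dvd_refl ((X ^ 2 - 1 : ℝ[X]) ^ n)))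
  obtain ⟨q, hq⟩ := h1
  rw [hq, eval_mul]
  simp [hx]

/-- Integration by parts `n` times; the boundary terms vanish because a derivative of `(X² - 1)^n`
of order below `n` still has the factor `X² - 1`. -/
lemma polyIntegral_rodrigues (n : ℕ) (q : ℝ[X]) :
    polyIntegral (derivative^[n] ((X ^ 2 - 1 : ℝ[X]) ^ n) * q) =
      (-1) ^ n * polyIntegral ((X ^ 2 - 1 : ℝ[X]) ^ n * derivative^[n] q) := by
  have h : ∀ k ≤ n, ∀ q : ℝ[X], polyIntegral (derivative^[k] ((X ^ 2 - 1 : ℝ[X]) ^ n) * q) =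
      (-1) ^ k * polyIntegral ((X ^ 2 - 1 : ℝ[X]) ^ n * derivative^[k] q) := by
    intro k
    induction k with
    | zero => intro _ q; simp
    | succ k ih =>
      intro hk q
      rw [Function.iterate_succ_apply', polyIntegral_derivative_mul _ _
        (eval_iterate_derivative_eq_zero hk (by norm_num))
        (eval_iterate_derivative_eq_zero hk (by norm_num)), ih (by omega),
        Function.iterate_succ_apply]
      ring
  exact h n le_rfl q

/-- `∫_{-1}^1 (1 - x²)^n dx`. -/
noncomputable def legendreWeight (n : ℕ) : ℝ := (-1) ^ n * polyIntegral ((X ^ 2 - 1 : ℝ[X]) ^ n)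

/-- Obtained by integrating the derivative of `X (X² - 1)^(n+1)`, which vanishes at both endpoints.
-/
lemma legendreWeight_succ (n : ℕ) :
    (2 * n + 3) * legendreWeight (n + 1) = (2 * n + 2) * legendreWeight n := by
  have h := integral_derivative (X * (X ^ 2 - 1 : ℝ[X]) ^ (n + 1)) (-1) 1
  have e : derivative (X * (X ^ 2 - 1 : ℝ[X]) ^ (n + 1)) =
      C (2 * n + 3 : ℝ) * (X ^ 2 - 1 : ℝ[X]) ^ (n + 1) +
        C (2 * n + 2 : ℝ) * (X ^ 2 - 1 : ℝ[X]) ^ n := by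
    simp only [derivative_mul, derivative_X, derivative_pow_succ, derivative_sub,
      derivative_one, map_add, map_mul, map_ofNat, map_natCast, C_1]
    push_cast
    ring
  change polyIntegral (derivative _) = _ at h
  rw [e, polyIntegral_add, polyIntegral_C_mul, polyIntegral_C_mul] at h
  simp only [eval_mul, eval_pow, eval_sub, eval_X, eval_one] at h
  norm_num at h
  simp only [legendreWeight, pow_succ (-1 : ℝ)]
  linear_combination (-(-1) ^ n) * h

/-- The recursions of the central binomial coefficient and of the weight combine to this closed
form. It is the squared norm of the Legendre polynomial, whose leading coefficient is `centralBinom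
/ 2^n`. -/
lemma centralBinom_mul_legendreWeight (n : ℕ) :
    (n.centralBinom : ℝ) * legendreWeight n / 4 ^ n = 2 / (2 * n + 1) := by
  induction n with
  | zero => simp [legendreWeight, polyIntegral]; norm_num
  | succ n ih =>
    have h1 : ((n : ℝ) + 1) * ((n + 1).centralBinom : ℝ) = 2 * (2 * n + 1) * n.centralBinom := by
      exact_mod_cast Nat.succ_mul_centralBinom_succ n
    have h2 := legendreWeight_succ n
    have p1 : (2 * (n : ℝ) + 1) ≠ 0 := by positivity
    have p3 : (2 * (n : ℝ) + 3) ≠ 0 := by positivity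
    have p2 : ((n : ℝ) + 1) ≠ 0 := by positivity
    rw [div_eq_div_iff (by positivity) p1] at ih
    push_cast
    rw [show 2 * ((n : ℝ) + 1) + 1 = 2 * n + 3 by ring, div_eq_div_iff (by positivity) p3]
    apply mul_left_cancel₀ p2
    rw [pow_succ]
    linear_combination (legendreWeight (n + 1) * (2 * n + 3)) * h1 +
      2 * (2 * n + 1) * (n.centralBinom : ℝ) * h2 + (4 * (n + 1)) * ih

lemma natDegree_X_sq_sub_one_pow_le (n : ℕ) : ((X ^ 2 - 1 : ℝ[X]) ^ n).natDegree ≤ 2 * n := by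
  have h : (X ^ 2 - 1 : ℝ[X]).natDegree ≤ 2 := by compute_degree
  calc _ ≤ n * (X ^ 2 - 1 : ℝ[X]).natDegree := natDegree_pow_le
    _ ≤ n * 2 := Nat.mul_le_mul_left n h
    _ = 2 * n := mul_comm _ _

lemma natDegree_legendreP_le (n : ℕ) : (legendreP n).natDegree ≤ n := by
  refine (natDegree_C_mul_le _ _).trans ((natDegree_iterate_derivative _ _).trans ?_)
  have := natDegree_X_sq_sub_one_pow_le n
  omega

lemma coeff_legendreP (n : ℕ) : (legendreP n).coeff n = (n.centralBinom : ℝ) / 2 ^ n := by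
  have h1 : ((X ^ 2 - 1 : ℝ[X]) ^ n).coeff (n + n) = 1 := by
    have hm : (X ^ 2 - 1 : ℝ[X]).Monic := by monicity!
    have hd : (X ^ 2 - 1 : ℝ[X]).natDegree = 2 := by compute_degree!
    have h := (hm.pow n).coeff_natDegree
    rw [hm.natDegree_pow, hd] at h
    rwa [show n + n = n * 2 by ring]
  have h2 : ((n + n).descFactorial n : ℝ) = n.centralBinom * n.factorial := by
    rw [Nat.descFactorial_eq_factorial_mul_choose, Nat.centralBinom, two_mul]
    push_cast; ring
  rw [legendreP, coeff_C_mul, coeff_iterate_derivative, h1, nsmul_eq_mul, mul_one, h2]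
  have : (n.factorial : ℝ) ≠ 0 := by positivity
  field_simp

/-- After integration by parts only the constant `n`-th derivative of `q` is left, so only its
coefficient of degree `n` matters. Norms, orthogonality and the pairing with an antiderivative all
follow from this. -/
lemma polyIntegral_legendreP_mul (n : ℕ) {q : ℝ[X]} (hq : q.natDegree ≤ n) :
    polyIntegral (legendreP n * q) = q.coeff n * legendreWeight n / 2 ^ n := by
  have h1 : derivative^[n] q = C (n.factorial * q.coeff n : ℝ) := by
    ext k
    rw [coeff_iterate_derivative, coeff_C, nsmul_eq_mul]
    split_ifs with hk
    · rw [hk, zero_add, Nat.descFactorial_self]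
    · rw [coeff_eq_zero_of_natDegree_lt (by omega), mul_zero]
  rw [legendreP, mul_assoc, polyIntegral_C_mul, polyIntegral_rodrigues, h1, mul_comm _ (C _),
    polyIntegral_C_mul, legendreWeight]
  have : (n.factorial : ℝ) ≠ 0 := by positivity
  field_simp

lemma polyIntegral_legendreP_mul_self (n : ℕ) :
    polyIntegral (legendreP n * legendreP n) = 2 / (2 * n + 1) := by
  rw [polyIntegral_legendreP_mul n (natDegree_legendreP_le n), coeff_legendreP,
    ← centralBinom_mul_legendreWeight, show (4 : ℝ) ^ n = 2 ^ n * 2 ^ n by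
      rw [← mul_pow]; norm_num]
  field_simp

lemma polyIntegral_legendreP_mul_of_lt {i j : ℕ} (h : j < i) :
    polyIntegral (legendreP i * legendreP j) = 0 := by
  have hd := (natDegree_legendreP_le j).trans_lt h
  rw [polyIntegral_legendreP_mul i hd.le, coeff_eq_zero_of_natDegree_lt hd]
  simp

lemma polyIntegral_legendreP_mul_legendreP (i j : ℕ) :
    polyIntegral (legendreP i * legendreP j) = if i = j then 2 / (2 * (i : ℝ) + 1) else 0 := by
  split_ifs with h
  · rw [← h, polyIntegral_legendreP_mul_self]
  · rcases lt_or_gt_of_ne h with h | h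
    · rw [mul_comm, polyIntegral_legendreP_mul_of_lt h]
    · rw [polyIntegral_legendreP_mul_of_lt h]

lemma exists_antiderivative (p : ℝ[X]) {n : ℕ} (hp : p.natDegree ≤ n) :
    ∃ S : ℝ[X], S.natDegree ≤ n + 1 ∧ derivative S = p := by
  refine ⟨∑ k ∈ Finset.range (n + 1), monomial (k + 1) (p.coeff k / (k + 1)), ?_, ?_⟩
  · refine natDegree_sum_le_of_forall_le _ _ fun k hk => ?_
    exact (natDegree_monomial_le _).trans (by have := Finset.mem_range.1 hk; omega)
  · conv_rhs => rw [p.as_sum_range' (n + 1) (by omega)]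
    rw [derivative_sum]
    refine Finset.sum_congr rfl fun k _ => ?_
    rw [derivative_monomial]
    have : (k : ℝ) + 1 ≠ 0 := by positivity
    push_cast
    rw [div_mul_cancel₀ _ this]

/-- The pairing sees only the top coefficient of `S`, which is that of `legendreP n` divided by `n +
1`. No three-term recurrence is needed. -/
lemma polyIntegral_legendreP_mul_antiderivative (n : ℕ) {S : ℝ[X]} (hS : S.natDegree ≤ n + 1)
    (hS' : derivative S = legendreP n) :
    polyIntegral (legendreP (n + 1) * S) = 2 / ((2 * n + 1) * (2 * n + 3)) := by
  have hc : S.coeff (n + 1) * (n + 1) = (n.centralBinom : ℝ) / 2 ^ n := by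
    rw [← coeff_legendreP, ← hS', coeff_derivative]
  have h1 : ((n : ℝ) + 1) * ((n + 1).centralBinom : ℝ) = 2 * (2 * n + 1) * n.centralBinom := by
    exact_mod_cast Nat.succ_mul_centralBinom_succ n
  have h2 := centralBinom_mul_legendreWeight (n + 1)
  have p1 : (2 * (n : ℝ) + 1) ≠ 0 := by positivity
  have p3 : (2 * (n : ℝ) + 3) ≠ 0 := by positivity
  have p2 : ((n : ℝ) + 1) ≠ 0 := by positivity
  have p4 : (2 : ℝ) ^ n ≠ 0 := by positivity
  rw [polyIntegral_legendreP_mul (n + 1) hS]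
  push_cast at h2
  rw [show 2 * ((n : ℝ) + 1) + 1 = 2 * n + 3 by ring, div_eq_div_iff (by positivity) p3,
    show (4 : ℝ) ^ (n + 1) = 4 * (2 ^ n * 2 ^ n) by rw [← mul_pow, pow_succ]; norm_num; ring] at h2
  rw [eq_div_iff p4] at hc
  rw [div_eq_div_iff (by positivity) (by positivity), pow_succ]
  apply mul_left_cancel₀ (mul_ne_zero p2 p4)
  linear_combination (legendreWeight (n + 1) * (2 * n + 1) * (2 * n + 3)) * hc -
    legendreWeight (n + 1) * (2 * n + 3) / 2 * h1 + (n + 1) / 2 * h2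

end Legendre

/-! ### The Legendre system on `[t, T]` -/

section LegendreBasis

open Polynomial

variable {t T : ℝ}

lemma continuous_legendreBasis (t T : ℝ) (j : ℕ) : Continuous (legendreBasis t T j) := by
  unfold legendreBasis
  fun_prop

lemma integral_comp_rescale (htT : t < T) (f : ℝ → ℝ) (s : ℝ) :
    ∫ τ in t..s, f ((τ - t - (T - t) / 2) * (2 / (T - t))) =
      (T - t) / 2 * ∫ x in (-1 : ℝ)..((s - t - (T - t) / 2) * (2 / (T - t))), f x := by
  have hL : T - t ≠ 0 := (sub_pos.2 htT).ne'
  have h := intervalIntegral.integral_comp_mul_sub f (a := t) (b := s)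
    (c := 2 / (T - t)) (by positivity) (2 * t / (T - t) + 1)
  have e : ∀ τ, 2 / (T - t) * τ - (2 * t / (T - t) + 1) =
      (τ - t - (T - t) / 2) * (2 / (T - t)) := fun τ => by field_simp; ring
  simp_rw [e] at h
  rw [h, smul_eq_mul, inv_div]
  congr 2
  field_simp
  ring

lemma rescale_right (htT : t < T) : (T - t - (T - t) / 2) * (2 / (T - t)) = 1 := by
  have hL : T - t ≠ 0 := (sub_pos.2 htT).ne'
  field_simp
  ring

lemma integral_legendreBasis_mul (htT : t < T) (i j : ℕ) :
    ∫ s in t..T, legendreBasis t T i s * legendreBasis t T j s = if i = j then 1 else 0 := by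
  have hL : 0 < T - t := sub_pos.2 htT
  have h := integral_comp_rescale htT (fun x => (legendreP i).eval x * (legendreP j).eval x) T
  rw [rescale_right htT] at h
  have h2 := polyIntegral_legendreP_mul_legendreP i j
  simp only [polyIntegral, eval_mul] at h2
  rw [h2] at h
  have e : ∀ s, legendreBasis t T i s * legendreBasis t T j s =
      √((2 * i + 1) / (T - t)) * √((2 * j + 1) / (T - t)) *
        ((legendreP i).eval ((s - t - (T - t) / 2) * (2 / (T - t))) *
          (legendreP j).eval ((s - t - (T - t) / 2) * (2 / (T - t)))) := fun s => by
    simp only [legendreBasis]; ring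
  simp_rw [e]
  rw [intervalIntegral.integral_const_mul, h]
  split_ifs with hij
  · rw [← hij, Real.mul_self_sqrt (by positivity)]
    field_simp
  · simp

lemma legendreBasis_zero (t T s : ℝ) : legendreBasis t T 0 s = 1 / √(T - t) := by
  simp [legendreBasis, legendreP]

lemma integral_legendreBasis_succ (htT : t < T) (n : ℕ) :
    ∫ s in t..T, legendreBasis t T (n + 1) s = 0 := by
  have hL : 0 < T - t := sub_pos.2 htT
  have h := integral_legendreBasis_mul htT (n + 1) 0
  simp only [legendreBasis_zero, Nat.add_eq_zero_iff, one_ne_zero, and_false, if_false] at h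
  rw [intervalIntegral.integral_mul_const] at h
  have h0 : 1 / √(T - t) ≠ 0 := by positivity
  exact (mul_eq_zero.1 h).resolve_right h0

/-- After rescaling, the primitive of the basis function is a multiple of `S - S(-1)`. The constant
drops out because the next basis function has mean zero, and what is left is the pairing with an
antiderivative. -/
lemma iteratedIntegral_legendreBasis (htT : t < T) (n : ℕ) :
    iteratedIntegral t T (legendreBasis t T n) (legendreBasis t T (n + 1)) =
      (T - t) / 2 * (1 / √(4 * ((n + 1 : ℕ) : ℝ) ^ 2 - 1)) := by
  have hL : 0 < T - t := sub_pos.2 htT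
  obtain ⟨S, hS, hS'⟩ := exists_antiderivative (legendreP n) (natDegree_legendreP_le n)
  have hprim : ∀ s, ∫ τ in t..s, legendreBasis t T n τ = √((2 * n + 1) / (T - t)) *
      ((T - t) / 2 * (S.eval ((s - t - (T - t) / 2) * (2 / (T - t))) - S.eval (-1))) := by
    intro s
    simp only [legendreBasis]
    rw [intervalIntegral.integral_const_mul,
      integral_comp_rescale htT (fun x => (legendreP n).eval x), ← hS', integral_derivative]
  have h := integral_comp_rescale htT
    (fun x => (legendreP (n + 1)).eval x * S.eval x) T
  rw [rescale_right htT] at h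
  have h2 := polyIntegral_legendreP_mul_antiderivative n hS hS'
  simp only [polyIntegral, eval_mul] at h2
  rw [h2] at h
  have h0 := integral_legendreBasis_succ htT n
  set x : ℝ → ℝ := fun s => (s - t - (T - t) / 2) * (2 / (T - t)) with hx
  have hxc : Continuous x := by fun_prop
  have e : ∀ s, legendreBasis t T (n + 1) s * ∫ τ in t..s, legendreBasis t T n τ =
      √((2 * n + 1) / (T - t)) * ((T - t) / 2) * √((2 * (n + 1 : ℕ) + 1) / (T - t)) *
        ((legendreP (n + 1)).eval (x s) * S.eval (x s)) -
      √((2 * n + 1) / (T - t)) * ((T - t) / 2) * S.eval (-1) * legendreBasis t T (n + 1) s := by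
    intro s
    rw [hprim]
    simp only [legendreBasis, hx]
    ring
  rw [iteratedIntegral]
  simp_rw [e]
  rw [intervalIntegral.integral_sub, intervalIntegral.integral_const_mul,
    intervalIntegral.integral_const_mul, h0, h, mul_zero, sub_zero]
  · have e1 : 4 * ((n + 1 : ℕ) : ℝ) ^ 2 - 1 = (2 * n + 1) * (2 * n + 3) := by push_cast; ring
    have e2 : 2 * ((n + 1 : ℕ) : ℝ) + 1 = 2 * n + 3 := by push_cast; ring
    rw [e1, e2, Real.sqrt_mul (by positivity), Real.sqrt_div (by positivity),
      Real.sqrt_div (by positivity)]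
    have s1 : √(T - t) ^ 2 = T - t := Real.sq_sqrt hL.le
    have s2 : √(2 * (n : ℝ) + 1) ^ 2 = 2 * n + 1 := Real.sq_sqrt (by positivity)
    have s3 : √(2 * (n : ℝ) + 3) ^ 2 = 2 * n + 3 := Real.sq_sqrt (by positivity)
    have p0 : √(T - t) ≠ 0 := by positivity
    have p1 : √(2 * (n : ℝ) + 1) ≠ 0 := by positivity
    have p2 : √(2 * (n : ℝ) + 3) ≠ 0 := by positivity
    field_simp
    rw [s1, s2, s3]
  · exact (by fun_prop : Continuous fun s => √((2 * n + 1) / (T - t)) * ((T - t) / 2) *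
      √((2 * (n + 1 : ℕ) + 1) / (T - t)) *
        ((legendreP (n + 1)).eval (x s) * S.eval (x s))).intervalIntegrable _ _
  · exact ((continuous_legendreBasis t T (n + 1)).const_mul _).intervalIntegrable _ _

lemma iteratedIntegral_legendreBasis_swap (htT : t < T) (n : ℕ) :
    iteratedIntegral t T (legendreBasis t T (n + 1)) (legendreBasis t T n) =
      - ((T - t) / 2 * (1 / √(4 * ((n + 1 : ℕ) : ℝ) ^ 2 - 1))) := by
  have h := iteratedIntegral_add_swap (t := t) (T := T) (continuous_legendreBasis t T (n + 1))
    (continuous_legendreBasis t T n)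
  rw [integral_legendreBasis_succ htT, zero_mul, iteratedIntegral_legendreBasis htT] at h
  linarith

end LegendreBasis

/-! ### The trigonometric system on `[t, T]` -/

section Trig

open Real

variable {t T : ℝ}

lemma continuous_trigBasis (t T : ℝ) (j : ℕ) : Continuous (trigBasis t T j) := by
  unfold trigBasis
  split_ifs <;> fun_prop

lemma trigBasis_zero (t T s : ℝ) : trigBasis t T 0 s = 1 / √(T - t) := by
  simp [trigBasis]

/-- The frequency is cast through `ℤ` because the product-to-sum formulas produce differences of
frequencies. -/
lemma trigBasis_odd (t T s : ℝ) (r : ℕ) : trigBasis t T (2 * r + 1) s =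
    √2 / √(T - t) * sin (2 * π * ((r + 1 : ℕ) : ℤ) * (s - t) / (T - t)) := by
  have h : (2 * r + 1 + 1) / 2 = r + 1 := by omega
  rw [trigBasis, if_neg (by omega), if_pos (odd_two_mul_add_one r), h, Int.cast_natCast]
  ring

lemma trigBasis_even (t T s : ℝ) (r : ℕ) : trigBasis t T (2 * r + 2) s =
    √2 / √(T - t) * cos (2 * π * ((r + 1 : ℕ) : ℤ) * (s - t) / (T - t)) := by
  have h : (2 * r + 2) / 2 = r + 1 := by omega
  have h' : ¬ Odd (2 * r + 2) := by rw [Nat.not_odd_iff_even]; exact ⟨r + 1, by ring⟩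
  rw [trigBasis, if_neg (by omega), if_neg h', h, Int.cast_natCast]
  ring

lemma integral_cos_freq_of_ne (htT : t < T) {k : ℤ} (hk : k ≠ 0) (s : ℝ) :
    ∫ τ in t..s, cos (2 * π * k * (τ - t) / (T - t)) =
      (T - t) / (2 * π * k) * sin (2 * π * k * (s - t) / (T - t)) := by
  have hL : T - t ≠ 0 := (sub_pos.2 htT).ne'
  have hk' : (k : ℝ) ≠ 0 := by exact_mod_cast hk
  have h := intervalIntegral.integral_comp_mul_sub cos (a := t) (b := s)
    (c := 2 * π * k / (T - t)) (by positivity) (2 * π * k / (T - t) * t)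
  have e : ∀ τ, 2 * π * k / (T - t) * τ - 2 * π * k / (T - t) * t =
      2 * π * k * (τ - t) / (T - t) := fun τ => by ring
  simp_rw [e] at h
  rw [h, integral_cos]
  simp

lemma integral_sin_freq_of_ne (htT : t < T) {k : ℤ} (hk : k ≠ 0) (s : ℝ) :
    ∫ τ in t..s, sin (2 * π * k * (τ - t) / (T - t)) =
      (T - t) / (2 * π * k) * (1 - cos (2 * π * k * (s - t) / (T - t))) := by
  have hL : T - t ≠ 0 := (sub_pos.2 htT).ne'
  have hk' : (k : ℝ) ≠ 0 := by exact_mod_cast hk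
  have h := intervalIntegral.integral_comp_mul_sub sin (a := t) (b := s)
    (c := 2 * π * k / (T - t)) (by positivity) (2 * π * k / (T - t) * t)
  have e : ∀ τ, 2 * π * k / (T - t) * τ - 2 * π * k / (T - t) * t =
      2 * π * k * (τ - t) / (T - t) := fun τ => by ring
  simp_rw [e] at h
  rw [h, integral_sin]
  simp

lemma freq_right (htT : t < T) (k : ℤ) : 2 * π * k * (T - t) / (T - t) = k * (2 * π) := by
  have hL : T - t ≠ 0 := (sub_pos.2 htT).ne'
  field_simp

lemma integral_cos_freq (htT : t < T) (k : ℤ) :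
    ∫ s in t..T, cos (2 * π * k * (s - t) / (T - t)) = if k = 0 then T - t else 0 := by
  split_ifs with hk
  · simp [hk]
  · rw [integral_cos_freq_of_ne htT hk, freq_right htT, show (k : ℝ) * (2 * π) = (2 * k : ℤ) * π by
      push_cast; ring, sin_int_mul_pi, mul_zero]

lemma integral_sin_freq (htT : t < T) (k : ℤ) :
    ∫ s in t..T, sin (2 * π * k * (s - t) / (T - t)) = 0 := by
  by_cases hk : k = 0
  · simp [hk]
  · rw [integral_sin_freq_of_ne htT hk, freq_right htT, cos_int_mul_two_pi, sub_self, mul_zero]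

lemma intervalIntegrable_cos_freq (a b t T : ℝ) (k : ℤ) :
    IntervalIntegrable (fun s => cos (2 * π * k * (s - t) / (T - t))) volume a b :=
  (by fun_prop : Continuous fun s => cos (2 * π * k * (s - t) / (T - t))).intervalIntegrable _ _

lemma intervalIntegrable_sin_freq (a b t T : ℝ) (k : ℤ) :
    IntervalIntegrable (fun s => sin (2 * π * k * (s - t) / (T - t))) volume a b :=
  (by fun_prop : Continuous fun s => sin (2 * π * k * (s - t) / (T - t))).intervalIntegrable _ _

lemma freq_sub (t T s : ℝ) (k l : ℤ) : 2 * π * k * (s - t) / (T - t) -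
    2 * π * l * (s - t) / (T - t) = 2 * π * (k - l : ℤ) * (s - t) / (T - t) := by
  push_cast; ring

lemma freq_add (t T s : ℝ) (k l : ℤ) : 2 * π * k * (s - t) / (T - t) +
    2 * π * l * (s - t) / (T - t) = 2 * π * (k + l : ℤ) * (s - t) / (T - t) := by
  push_cast; ring

lemma integral_cos_mul_cos_freq (htT : t < T) (k l : ℤ) :
    ∫ s in t..T, cos (2 * π * k * (s - t) / (T - t)) * cos (2 * π * l * (s - t) / (T - t)) =
      ((if k - l = 0 then T - t else 0) + if k + l = 0 then T - t else 0) / 2 := by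
  have e : ∀ s, cos (2 * π * k * (s - t) / (T - t)) * cos (2 * π * l * (s - t) / (T - t)) =
      (cos (2 * π * (k - l : ℤ) * (s - t) / (T - t)) +
        cos (2 * π * (k + l : ℤ) * (s - t) / (T - t))) / 2 := fun s => by
    rw [← freq_sub, ← freq_add, cos_sub, cos_add]; ring
  simp_rw [e]
  rw [intervalIntegral.integral_div, intervalIntegral.integral_add
    (intervalIntegrable_cos_freq _ _ _ _ _) (intervalIntegrable_cos_freq _ _ _ _ _),
    integral_cos_freq htT, integral_cos_freq htT]

lemma integral_sin_mul_sin_freq (htT : t < T) (k l : ℤ) :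
    ∫ s in t..T, sin (2 * π * k * (s - t) / (T - t)) * sin (2 * π * l * (s - t) / (T - t)) =
      ((if k - l = 0 then T - t else 0) - if k + l = 0 then T - t else 0) / 2 := by
  have e : ∀ s, sin (2 * π * k * (s - t) / (T - t)) * sin (2 * π * l * (s - t) / (T - t)) =
      (cos (2 * π * (k - l : ℤ) * (s - t) / (T - t)) -
        cos (2 * π * (k + l : ℤ) * (s - t) / (T - t))) / 2 := fun s => by
    rw [← freq_sub, ← freq_add, cos_sub, cos_add]; ring
  simp_rw [e]
  rw [intervalIntegral.integral_div, intervalIntegral.integral_sub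
    (intervalIntegrable_cos_freq _ _ _ _ _) (intervalIntegrable_cos_freq _ _ _ _ _),
    integral_cos_freq htT, integral_cos_freq htT]

lemma integral_sin_mul_cos_freq (htT : t < T) (k l : ℤ) :
    ∫ s in t..T, sin (2 * π * k * (s - t) / (T - t)) * cos (2 * π * l * (s - t) / (T - t)) =
      0 := by
  have e : ∀ s, sin (2 * π * k * (s - t) / (T - t)) * cos (2 * π * l * (s - t) / (T - t)) =
      (sin (2 * π * (k - l : ℤ) * (s - t) / (T - t)) +
        sin (2 * π * (k + l : ℤ) * (s - t) / (T - t))) / 2 := fun s => by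
    rw [← freq_sub, ← freq_add, sin_sub, sin_add]; ring
  simp_rw [e]
  rw [intervalIntegral.integral_div, intervalIntegral.integral_add
    (intervalIntegrable_sin_freq _ _ _ _ _) (intervalIntegrable_sin_freq _ _ _ _ _),
    integral_sin_freq htT, integral_sin_freq htT]
  simp

lemma integral_trigBasis_odd (htT : t < T) (r : ℕ) :
    ∫ s in t..T, trigBasis t T (2 * r + 1) s = 0 := by
  simp_rw [trigBasis_odd]
  rw [intervalIntegral.integral_const_mul, integral_sin_freq htT, mul_zero]

lemma integral_trigBasis_even (htT : t < T) (r : ℕ) :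
    ∫ s in t..T, trigBasis t T (2 * r + 2) s = 0 := by
  simp_rw [trigBasis_even]
  rw [intervalIntegral.integral_const_mul, integral_cos_freq htT, if_neg (by positivity), mul_zero]

lemma sqrt_two_div_mul_self (htT : t < T) : √2 / √(T - t) * (√2 / √(T - t)) = 2 / (T - t) := by
  rw [div_mul_div_comm, mul_self_sqrt (by norm_num), mul_self_sqrt (sub_pos.2 htT).le]

lemma exists_index (j : ℕ) : j = 0 ∨ (∃ r, j = 2 * r + 1) ∨ ∃ r, j = 2 * r + 2 := by
  rcases Nat.even_or_odd' j with ⟨r, h | h⟩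
  · rcases Nat.eq_zero_or_pos r with rfl | hr
    · exact Or.inl h
    · exact Or.inr (Or.inr ⟨r - 1, by omega⟩)
  · exact Or.inr (Or.inl ⟨r, h⟩)

lemma integral_trigBasis_mul (htT : t < T) (i j : ℕ) :
    ∫ s in t..T, trigBasis t T i s * trigBasis t T j s = if i = j then 1 else 0 := by
  have hL : 0 < T - t := sub_pos.2 htT
  have e : ∀ x y : ℝ, √2 / √(T - t) * x * (√2 / √(T - t) * y) =
      √2 / √(T - t) * (√2 / √(T - t)) * (x * y) := fun x y => by ring
  rcases exists_index i with rfl | ⟨r, rfl⟩ | ⟨r, rfl⟩ <;>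
  rcases exists_index j with rfl | ⟨q, rfl⟩ | ⟨q, rfl⟩
  · simp_rw [trigBasis_zero]
    rw [if_pos trivial, intervalIntegral.integral_const, div_mul_div_comm, mul_self_sqrt hL.le, smul_eq_mul]
    field_simp
  · simp_rw [trigBasis_zero]
    rw [intervalIntegral.integral_const_mul, integral_trigBasis_odd htT, if_neg (by omega),
      mul_zero]
  · simp_rw [trigBasis_zero]
    rw [intervalIntegral.integral_const_mul, integral_trigBasis_even htT, if_neg (by omega),
      mul_zero]
  · simp_rw [trigBasis_zero]
    rw [intervalIntegral.integral_mul_const, integral_trigBasis_odd htT, if_neg (by omega),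
      zero_mul]
  · simp_rw [trigBasis_odd, e]
    rw [intervalIntegral.integral_const_mul, integral_sin_mul_sin_freq htT,
      sqrt_two_div_mul_self htT]
    rcases eq_or_ne r q with rfl | h
    · rw [if_pos (sub_self _), if_neg (by positivity), if_pos rfl]
      field_simp
      simp
    · rw [if_neg (by omega), if_neg (by positivity), if_neg (by omega)]
      simp
  · simp_rw [trigBasis_odd, trigBasis_even, e]
    rw [intervalIntegral.integral_const_mul, integral_sin_mul_cos_freq htT, if_neg (by omega),
      mul_zero]
  · simp_rw [trigBasis_zero]
    rw [intervalIntegral.integral_mul_const, integral_trigBasis_even htT, if_neg (by omega),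
      zero_mul]
  · simp_rw [mul_comm (trigBasis t T (2 * r + 2) _), trigBasis_odd, trigBasis_even, e]
    rw [intervalIntegral.integral_const_mul, integral_sin_mul_cos_freq htT, if_neg (by omega),
      mul_zero]
  · simp_rw [trigBasis_even, e]
    rw [intervalIntegral.integral_const_mul, integral_cos_mul_cos_freq htT,
      sqrt_two_div_mul_self htT]
    rcases eq_or_ne r q with rfl | h
    · rw [if_pos (sub_self _), if_neg (by positivity), if_pos rfl]
      field_simp
      simp
    · rw [if_neg (by omega), if_neg (by positivity), if_neg (by omega)]
      simp

/-- The primitive of the cosine is a multiple of the sine of the same frequency, so the integral is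
that of a squared sine. -/
lemma iteratedIntegral_cos_sin (htT : t < T) (r : ℕ) :
    iteratedIntegral t T (trigBasis t T (2 * r + 2)) (trigBasis t T (2 * r + 1)) =
      (T - t) / (2 * π) * (1 / ((r + 1 : ℕ) : ℝ)) := by
  have hL : 0 < T - t := sub_pos.2 htT
  have hr : ((r + 1 : ℕ) : ℤ) ≠ 0 := by positivity
  have e : ∀ s, trigBasis t T (2 * r + 1) s * ∫ τ in t..s, trigBasis t T (2 * r + 2) τ =
      (√2 / √(T - t) * (√2 / √(T - t))) * ((T - t) / (2 * π * ((r + 1 : ℕ) : ℤ))) *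
        (sin (2 * π * ((r + 1 : ℕ) : ℤ) * (s - t) / (T - t)) *
          sin (2 * π * ((r + 1 : ℕ) : ℤ) * (s - t) / (T - t))) := fun s => by
    simp_rw [trigBasis_even, trigBasis_odd]
    rw [intervalIntegral.integral_const_mul, integral_cos_freq_of_ne htT hr]
    ring
  rw [iteratedIntegral]
  simp_rw [e]
  rw [intervalIntegral.integral_const_mul, integral_sin_mul_sin_freq htT,
    sqrt_two_div_mul_self htT, if_pos (sub_self _), if_neg (by positivity), Int.cast_natCast]
  have : ((r + 1 : ℕ) : ℝ) ≠ 0 := by positivity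
  field_simp
  ring

lemma iteratedIntegral_sin_cos (htT : t < T) (r : ℕ) :
    iteratedIntegral t T (trigBasis t T (2 * r + 1)) (trigBasis t T (2 * r + 2)) =
      - ((T - t) / (2 * π) * (1 / ((r + 1 : ℕ) : ℝ))) := by
  have h := iteratedIntegral_add_swap (t := t) (T := T) (continuous_trigBasis t T (2 * r + 1))
    (continuous_trigBasis t T (2 * r + 2))
  rw [integral_trigBasis_odd htT, zero_mul, iteratedIntegral_cos_sin htT] at h
  linarith

/-- The primitive of the sine starting at `t` is a multiple of `1 - cos`, and its constant part
pairs with `φ₀`. This is the source of the `√2` terms of the expansion. -/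
lemma iteratedIntegral_sin_zero (htT : t < T) (r : ℕ) :
    iteratedIntegral t T (trigBasis t T (2 * r + 1)) (trigBasis t T 0) =
      (T - t) / (2 * π) * (1 / ((r + 1 : ℕ) : ℝ) * √2) := by
  have hL : 0 < T - t := sub_pos.2 htT
  have hr : ((r + 1 : ℕ) : ℤ) ≠ 0 := by positivity
  have e : ∀ s, trigBasis t T 0 s * ∫ τ in t..s, trigBasis t T (2 * r + 1) τ =
      (1 / √(T - t) * (√2 / √(T - t))) * ((T - t) / (2 * π * ((r + 1 : ℕ) : ℤ))) *
        (1 - cos (2 * π * ((r + 1 : ℕ) : ℤ) * (s - t) / (T - t))) := fun s => by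
    simp_rw [trigBasis_zero, trigBasis_odd]
    rw [intervalIntegral.integral_const_mul, integral_sin_freq_of_ne htT hr]
    ring
  rw [iteratedIntegral]
  simp_rw [e]
  rw [intervalIntegral.integral_const_mul, intervalIntegral.integral_sub (by simp)
    (intervalIntegrable_cos_freq _ _ _ _ _), integral_cos_freq htT, if_neg hr,
    div_mul_div_comm, mul_self_sqrt hL.le, Int.cast_natCast, intervalIntegral.integral_const]
  have : ((r + 1 : ℕ) : ℝ) ≠ 0 := by positivity
  rw [smul_eq_mul]
  field_simp
  ring

lemma iteratedIntegral_zero_sin (htT : t < T) (r : ℕ) :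
    iteratedIntegral t T (trigBasis t T 0) (trigBasis t T (2 * r + 1)) =
      - ((T - t) / (2 * π) * (1 / ((r + 1 : ℕ) : ℝ) * √2)) := by
  have h := iteratedIntegral_add_swap (t := t) (T := T) (continuous_trigBasis t T (2 * r + 1))
    (continuous_trigBasis t T 0)
  rw [integral_trigBasis_odd htT, zero_mul, iteratedIntegral_sin_zero htT] at h
  linarith

end Trig

/-! ### Moments of the truncation errors -/

section Errors

variable {Ω : Type*} {mΩ : MeasurableSpace Ω} {μ : Measure Ω} {ℱ : Filtration ℝ mΩ} {Θ : ℝ}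
  [IsProbabilityMeasure μ] {m : ℕ} {w : Fin m → ℝ → Ω → ℝ} {t T : ℝ}

/-- `E` is the second moment of `X`, whose even moments have the bounds of a second chaos. -/
structure HasChaosMoments (μ : Measure Ω) (X : Ω → ℝ) (E : ℝ) : Prop where
  integrable : ∀ n, Integrable (fun ω => X ω ^ (2 * n)) μ
  moment_le : ∀ n, 1 ≤ n →
    ∫ ω, X ω ^ (2 * n) ∂μ ≤ ((2 * n - 1).doubleFactorial : ℝ) ^ 2 * E ^ n
  second_moment : ∫ ω, X ω ^ 2 ∂μ = E

namespace HasChaosMoments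

omit [IsProbabilityMeasure μ]

variable {X Y : Ω → ℝ} {E : ℝ}

lemma congr (h : HasChaosMoments μ X E) (hXY : Y =ᵐ[μ] X) : HasChaosMoments μ Y E where
  integrable n := (h.integrable n).congr (by
    filter_upwards [hXY] with ω hω
    rw [hω])
  moment_le n hn := by
    refine le_trans (le_of_eq (integral_congr_ae ?_)) (h.moment_le n hn)
    filter_upwards [hXY] with ω hω
    rw [hω]
  second_moment := by
    rw [← h.second_moment]
    refine integral_congr_ae ?_
    filter_upwards [hXY] with ω hω
    rw [hω]

lemma nonneg (h : HasChaosMoments μ X E) : 0 ≤ E := by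
  rw [← h.second_moment]
  exact integral_nonneg fun ω => sq_nonneg _

lemma moment_le_momentConst (h : HasChaosMoments μ X E) {n : ℕ} (hn : 1 ≤ n) :
    ∫ ω, X ω ^ (2 * n) ∂μ ≤ momentConst n 2 * E ^ n :=
  (h.moment_le n hn).trans (mul_le_mul_of_nonneg_right (doubleFactorial_sq_le_momentConst hn)
    (pow_nonneg h.nonneg n))

lemma tendsto_moment {X : ℕ → Ω → ℝ} {E : ℕ → ℝ} (h : ∀ q, HasChaosMoments μ (X q) (E q))
    (hE : Tendsto E atTop (𝓝 0)) {n : ℕ} (hn : 1 ≤ n) :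
    Tendsto (fun q => ∫ ω, X q ω ^ (2 * n) ∂μ) atTop (𝓝 0) := by
  refine squeeze_zero (fun q => integral_nonneg fun ω => (even_two_mul n).pow_nonneg _)
    (fun q => (h q).moment_le n hn) ?_
  have := (hE.pow n).const_mul (((2 * n - 1).doubleFactorial : ℝ) ^ 2)
  rwa [zero_pow (by omega), mul_zero] at this

/-- Here `9 = (3!!)²`. -/
lemma fourth_moment_le (h : HasChaosMoments μ X E) : ∫ ω, X ω ^ 4 ∂μ ≤ 9 * E ^ 2 := by
  have := h.moment_le 2 (by norm_num)
  norm_num [Nat.doubleFactorial] at this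
  exact this

end HasChaosMoments

lemma hasChaosMoments_orthonormal (hw : IsWienerProcess μ ℱ Θ w) {i₁ i₂ : Fin m} (hi : i₁ ≠ i₂)
    (ht : 0 ≤ t) (htT : t < T) (hT : T ≤ Θ) {φ : ℕ → ℝ → ℝ} (hφ : ∀ j, Continuous (φ j))
    (horth : ∀ i j, ∫ s in t..T, φ i s * φ j s = if i = j then 1 else 0)
    {ι : Type*} (S : Finset ι) {e₁ e₂ : ι → ℕ} {c : ι → ℝ}
    (hinj : ∀ i ∈ S, ∀ j ∈ S, e₁ i = e₁ j → e₂ i = e₂ j → i = j)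
    (hc : ∀ i ∈ S, iteratedIntegral t T (φ (e₁ i)) (φ (e₂ i)) = c i)
    (hc' : ∀ i ∈ S, iteratedIntegral t T (φ (e₂ i)) (φ (e₁ i)) = - c i) :
    HasChaosMoments μ (fun ω => levyArea μ ℱ (w i₁) (w i₂) t T ω -
      ∑ i ∈ S, c i * (zeta μ ℱ φ (w i₁) t T (e₁ i) ω * zeta μ ℱ φ (w i₂) t T (e₂ i) ω))
      ((T - t) ^ 2 / 4 - ∑ i ∈ S, c i ^ 2) := by
  obtain ⟨h1, h2, h3⟩ := chaosForm_moments hw hi ht htT.le hT (1 / 2) (-1 / 2) S c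
    (p := fun i => φ (e₁ i)) (r := fun i => φ (e₂ i)) (fun i => hφ _) (fun i => hφ _)
  rw [kernelNormSq_orthonormal S horth hinj hc hc'] at h2 h3
  have e : (fun ω => levyArea μ ℱ (w i₁) (w i₂) t T ω -
      ∑ i ∈ S, c i * (zeta μ ℱ φ (w i₁) t T (e₁ i) ω * zeta μ ℱ φ (w i₂) t T (e₂ i) ω)) =
      chaosForm μ ℱ (w i₁) (w i₂) t T (1 / 2) (-1 / 2) S c (fun i => φ (e₁ i))
        (fun i => φ (e₂ i)) := by
    ext ω
    simp only [levyArea, chaosForm, zeta]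
    ring
  rw [e]
  exact ⟨h1, h2, h3⟩

lemma hasChaosMoments_legendre (hw : IsWienerProcess μ ℱ Θ w) {i₁ i₂ : Fin m} (hi : i₁ ≠ i₂)
    (ht : 0 ≤ t) (htT : t < T) (hT : T ≤ Θ) (q : ℕ) :
    HasChaosMoments μ (fun ω => levyArea μ ℱ (w i₁) (w i₂) t T ω -
        legendreArea μ ℱ (w i₁) (w i₂) t T q ω)
      ((T - t) ^ 2 / 2 * (1 / 2 - ∑ i ∈ Finset.Icc 1 q, 1 / (4 * (i : ℝ) ^ 2 - 1))) := by
  let a : ℕ → ℝ := fun i => (T - t) / 2 * (1 / √(4 * (i : ℝ) ^ 2 - 1))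
  -- Each `i` contributes two products: `true` stands for the degrees `(i - 1, i)` with coefficient
  -- `a i`, and `false` for the exchanged degrees with `-a i`. The sum of squares therefore contains
  -- `2 (a i)²`.
  have h := hasChaosMoments_orthonormal hw hi ht htT hT (continuous_legendreBasis t T)
    (integral_legendreBasis_mul htT) (Finset.Icc 1 q ×ˢ (Finset.univ : Finset Bool))
    (e₁ := fun x => if x.2 then x.1 - 1 else x.1) (e₂ := fun x => if x.2 then x.1 else x.1 - 1)
    (c := fun x => if x.2 then a x.1 else - a x.1) ?_ ?_ ?_
  · convert h using 1
    · ext ω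
      rw [Finset.sum_product]
      simp only [Fintype.sum_bool, if_true, Bool.false_eq_true, if_false, legendreArea]
      rw [Finset.mul_sum]
      congr 1
      refine Finset.sum_congr rfl fun i _ => ?_
      simp only [a]
      ring
    · rw [Finset.sum_product]
      simp only [Fintype.sum_bool, if_true, Bool.false_eq_true, if_false, neg_sq]
      have : ∀ i ∈ Finset.Icc 1 q, a i ^ 2 + a i ^ 2 =
          (T - t) ^ 2 / 2 * (1 / (4 * (i : ℝ) ^ 2 - 1)) := by
        intro i hi
        have hi1 : (1 : ℝ) ≤ i := by exact_mod_cast (Finset.mem_Icc.1 hi).1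
        simp only [a]
        rw [mul_pow, div_pow 1, one_pow, Real.sq_sqrt (by nlinarith)]
        ring
      rw [Finset.sum_congr rfl this, ← Finset.mul_sum]
      ring
  · rintro ⟨i, _ | _⟩ hx ⟨j, _ | _⟩ hy <;>
      simp only [Finset.mem_product, Finset.mem_Icc, Bool.false_eq_true, if_false, if_true,
        Prod.mk.injEq, and_true, reduceCtorEq, and_false] at hx hy ⊢ <;> omega
  · rintro ⟨i, b⟩ hx
    simp only [Finset.mem_product, Finset.mem_Icc] at hx
    obtain ⟨n, rfl⟩ : ∃ n, i = n + 1 := ⟨i - 1, by omega⟩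
    cases b
    · simpa [a] using iteratedIntegral_legendreBasis_swap htT n
    · simpa [a] using iteratedIntegral_legendreBasis htT n
  · rintro ⟨i, b⟩ hx
    simp only [Finset.mem_product, Finset.mem_Icc] at hx
    obtain ⟨n, rfl⟩ : ∃ n, i = n + 1 := ⟨i - 1, by omega⟩
    cases b
    · simpa [a] using iteratedIntegral_legendreBasis htT n
    · simpa [a] using iteratedIntegral_legendreBasis_swap htT n

lemma hasChaosMoments_trig (hw : IsWienerProcess μ ℱ Θ w) {i₁ i₂ : Fin m} (hi : i₁ ≠ i₂)
    (ht : 0 ≤ t) (htT : t < T) (hT : T ≤ Θ) (q : ℕ) :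
    HasChaosMoments μ (fun ω => levyArea μ ℱ (w i₁) (w i₂) t T ω -
        trigArea μ ℱ (w i₁) (w i₂) t T q ω)
      (3 * (T - t) ^ 2 / (2 * Real.pi ^ 2) *
        (Real.pi ^ 2 / 6 - ∑ r ∈ Finset.Icc 1 q, 1 / (r : ℝ) ^ 2)) := by
  let a : ℕ → ℝ := fun r => (T - t) / (2 * Real.pi) * (1 / (r : ℝ))
  -- Each `r` contributes cosine–sine, sine–cosine, sine–constant and constant–sine. The squared
  -- coefficients add up to `(1 + 1 + 2 + 2) (a r)² = 6 (a r)²`, which is where `3 / (2π²)` comes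
  -- from; times `π²/6` it is the total `1/4`.
  let e₁ : ℕ × Fin 4 → ℕ := fun x => ![2 * x.1, 2 * x.1 - 1, 2 * x.1 - 1, 0] x.2
  let e₂ : ℕ × Fin 4 → ℕ := fun x => ![2 * x.1 - 1, 2 * x.1, 0, 2 * x.1 - 1] x.2
  let c : ℕ × Fin 4 → ℝ := fun x => ![a x.1, - a x.1, a x.1 * √2, - (a x.1 * √2)] x.2
  have hodd : ∀ n, 2 * (n + 1) - 1 = 2 * n + 1 := fun n => by omega
  have heven : ∀ n, 2 * (n + 1) = 2 * n + 2 := fun n => by omega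
  have h := hasChaosMoments_orthonormal hw hi ht htT hT (continuous_trigBasis t T)
    (integral_trigBasis_mul htT) (Finset.Icc 1 q ×ˢ (Finset.univ : Finset (Fin 4)))
    (e₁ := e₁) (e₂ := e₂) (c := c) ?_ ?_ ?_
  · convert h using 1
    · ext ω
      rw [Finset.sum_product]
      simp only [Fin.sum_univ_four, e₁, e₂, c, trigArea]
      rw [Finset.mul_sum]
      congr 1
      refine Finset.sum_congr rfl fun i _ => ?_
      simp [a]
      ring
    · rw [Finset.sum_product]
      have : ∀ r ∈ Finset.Icc 1 q, ∑ y : Fin 4, c (r, y) ^ 2 =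
          3 * (T - t) ^ 2 / (2 * Real.pi ^ 2) * (1 / (r : ℝ) ^ 2) := by
        intro r _
        simp only [Fin.sum_univ_four, c]
        simp [mul_pow, a]
        field_simp
        ring
      rw [Finset.sum_congr rfl this, ← Finset.mul_sum]
      have := Real.pi_ne_zero
      field_simp
      ring
  · rintro ⟨i, x⟩ hx ⟨j, y⟩ hy
    simp only [Finset.mem_product, Finset.mem_Icc] at hx hy
    fin_cases x <;> fin_cases y <;> simp [e₁, e₂] <;> omega
  · rintro ⟨i, x⟩ hx
    simp only [Finset.mem_product, Finset.mem_Icc] at hx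
    obtain ⟨n, rfl⟩ : ∃ n, i = n + 1 := ⟨i - 1, by omega⟩
    fin_cases x
    · simpa [e₁, e₂, c, a, hodd, heven] using iteratedIntegral_cos_sin htT n
    · simpa [e₁, e₂, c, a, hodd, heven] using iteratedIntegral_sin_cos htT n
    · simpa [e₁, e₂, c, a, hodd, heven, mul_assoc] using iteratedIntegral_sin_zero htT n
    · simpa [e₁, e₂, c, a, hodd, heven, mul_assoc] using iteratedIntegral_zero_sin htT n
  · rintro ⟨i, x⟩ hx
    simp only [Finset.mem_product, Finset.mem_Icc] at hx
    obtain ⟨n, rfl⟩ : ∃ n, i = n + 1 := ⟨i - 1, by omega⟩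
    fin_cases x
    · simpa [e₁, e₂, c, a, hodd, heven] using iteratedIntegral_sin_cos htT n
    · simpa [e₁, e₂, c, a, hodd, heven] using iteratedIntegral_cos_sin htT n
    · simpa [e₁, e₂, c, a, hodd, heven, mul_assoc] using iteratedIntegral_zero_sin htT n
    · simpa [e₁, e₂, c, a, hodd, heven, mul_assoc] using iteratedIntegral_sin_zero htT n

/-- The iterated integral is the area plus half of `I⁽¹²⁾ + I⁽²¹⁾`, and that half is almost surely
the `ζ₀` term of the approximation. -/
lemma iteratedIto_sub_legendreIto (hw : IsWienerProcess μ ℱ Θ w) {i₁ i₂ : Fin m} (hi : i₁ ≠ i₂)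
    (ht : 0 ≤ t) (htT : t < T) (hT : T ≤ Θ) (q : ℕ) :
    (fun ω => iteratedIto μ ℱ (w i₁) (w i₂) t T ω - legendreIto μ ℱ (w i₁) (w i₂) t T q ω) =ᵐ[μ]
      fun ω => levyArea μ ℱ (w i₁) (w i₂) t T ω - legendreArea μ ℱ (w i₁) (w i₂) t T q ω := by
  filter_upwards [iteratedIto_add_swap hw hi ht htT hT (legendreBasis_zero t T)] with ω hω
  simp only [legendreIto, levyArea]
  linarith

lemma iteratedIto_sub_trigIto (hw : IsWienerProcess μ ℱ Θ w) {i₁ i₂ : Fin m} (hi : i₁ ≠ i₂)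
    (ht : 0 ≤ t) (htT : t < T) (hT : T ≤ Θ) (q : ℕ) :
    (fun ω => iteratedIto μ ℱ (w i₁) (w i₂) t T ω - trigIto μ ℱ (w i₁) (w i₂) t T q ω) =ᵐ[μ]
      fun ω => levyArea μ ℱ (w i₁) (w i₂) t T ω - trigArea μ ℱ (w i₁) (w i₂) t T q ω := by
  filter_upwards [iteratedIto_add_swap hw hi ht htT hT (trigBasis_zero t T)] with ω hω
  simp only [trigIto, levyArea]
  linarith

end Errors

/-! ### Decay of the Legendre error and the theorem -/

lemma legendreError_le {L : ℝ} {q : ℕ} (hq : 1 ≤ q) :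
    L ^ 2 / 2 * (1 / 2 - ∑ i ∈ Finset.Icc 1 q, 1 / (4 * (i : ℝ) ^ 2 - 1)) ≤ 1 * L ^ 2 / q := by
  have hq' : (1 : ℝ) ≤ q := by exact_mod_cast hq
  rw [sum_one_div_four_sq_sub_one, div_mul_div_comm, div_le_div_iff₀ (by positivity)
    (by positivity)]
  nlinarith [sq_nonneg L, mul_nonneg (sq_nonneg L) (by linarith : (0 : ℝ) ≤ q)]

lemma tendsto_legendreError (L : ℝ) : Tendsto (fun q : ℕ =>
    L ^ 2 / 2 * (1 / 2 - ∑ i ∈ Finset.Icc 1 q, 1 / (4 * (i : ℝ) ^ 2 - 1))) atTop (𝓝 0) := by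
  refine squeeze_zero' (Eventually.of_forall fun q => ?_)
    (eventually_atTop.2 ⟨1, fun q hq => legendreError_le hq⟩)
    (tendsto_const_div_atTop_nhds_zero_nat _)
  rw [sum_one_div_four_sq_sub_one]
  positivity

end LevyArea

theorem mainTheorem3 :
    ∃ C₁ C₂ : ℝ, ∀ (Ω : Type*) (mΩ : MeasurableSpace Ω) (μ : Measure Ω)
      (_hμ : IsProbabilityMeasure μ) (ℱ : Filtration ℝ mΩ) (Θ : ℝ) (m : ℕ)
      (w : Fin m → ℝ → Ω → ℝ) (_hw : IsWienerProcess μ ℱ Θ w)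
      (t T : ℝ) (_ht : 0 ≤ t) (_htT : t < T) (_hT : T ≤ Θ) (i₁ i₂ : Fin m) (_hi : i₁ ≠ i₂),
      -- all the stochastic integrals involved exist
      ((∀ i, ∀ s ∈ Set.Icc t T,
          ItoIntegrable μ ℱ (w i) t s (fun _ _ => 1)) ∧
        (∀ i j, i ≠ j → ItoIntegrable μ ℱ (w j) t T
          (fun s => itoIntegral μ ℱ (w i) t s (fun _ _ => 1))) ∧
        (∀ i j, ItoIntegrable μ ℱ (w i) t T
          (fun s _ => legendreBasis t T j s)) ∧
        (∀ i j, ItoIntegrable μ ℱ (w i) t T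
          (fun s _ => trigBasis t T j s))) ∧
      -- all moments of the errors are finite
      (∀ n q : ℕ, Integrable (fun ω => (levyArea μ ℱ (w i₁) (w i₂) t T ω -
            legendreArea μ ℱ (w i₁) (w i₂) t T q ω) ^ (2 * n)) μ ∧
        Integrable (fun ω => (iteratedIto μ ℱ (w i₁) (w i₂) t T ω -
            legendreIto μ ℱ (w i₁) (w i₂) t T q ω) ^ (2 * n)) μ ∧
        Integrable (fun ω => (levyArea μ ℱ (w i₁) (w i₂) t T ω -
            trigArea μ ℱ (w i₁) (w i₂) t T q ω) ^ (2 * n)) μ ∧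
        Integrable (fun ω => (iteratedIto μ ℱ (w i₁) (w i₂) t T ω -
            trigIto μ ℱ (w i₁) (w i₂) t T q ω) ^ (2 * n)) μ) ∧
      -- mean-square errors
      (∀ q : ℕ, ∫ ω, (levyArea μ ℱ (w i₁) (w i₂) t T ω -
            legendreArea μ ℱ (w i₁) (w i₂) t T q ω) ^ 2 ∂μ =
        (T - t) ^ 2 / 2 * (1 / 2 - ∑ i ∈ Finset.Icc 1 q, 1 / (4 * (i : ℝ) ^ 2 - 1))) ∧
      (∀ q : ℕ, 1 ≤ q → ∫ ω, (levyArea μ ℱ (w i₁) (w i₂) t T ω -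
            legendreArea μ ℱ (w i₁) (w i₂) t T q ω) ^ 2 ∂μ ≤ C₁ * (T - t) ^ 2 / q) ∧
      (∀ q : ℕ, ∫ ω, (levyArea μ ℱ (w i₁) (w i₂) t T ω -
            trigArea μ ℱ (w i₁) (w i₂) t T q ω) ^ 2 ∂μ =
        3 * (T - t) ^ 2 / (2 * Real.pi ^ 2) *
          (Real.pi ^ 2 / 6 - ∑ r ∈ Finset.Icc 1 q, 1 / (r : ℝ) ^ 2)) ∧
      (∀ q : ℕ, 1 ≤ q → ∫ ω, (levyArea μ ℱ (w i₁) (w i₂) t T ω -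
            trigArea μ ℱ (w i₁) (w i₂) t T q ω) ^ 2 ∂μ ≤ C₂ * (T - t) ^ 2 / q) ∧
      -- moment bounds of degree `2 n`
      (∀ n q : ℕ, 1 ≤ n →
        ∫ ω, (iteratedIto μ ℱ (w i₁) (w i₂) t T ω -
            legendreIto μ ℱ (w i₁) (w i₂) t T q ω) ^ (2 * n) ∂μ ≤
          momentConst n 2 * ((T - t) ^ 2 / 2 *
            (1 / 2 - ∑ i ∈ Finset.Icc 1 q, 1 / (4 * (i : ℝ) ^ 2 - 1))) ^ n) ∧
      (∀ n q : ℕ, 1 ≤ n →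
        ∫ ω, (iteratedIto μ ℱ (w i₁) (w i₂) t T ω -
            trigIto μ ℱ (w i₁) (w i₂) t T q ω) ^ (2 * n) ∂μ ≤
          momentConst n 2 * (3 * (T - t) ^ 2 / (2 * Real.pi ^ 2) *
            (Real.pi ^ 2 / 6 - ∑ r ∈ Finset.Icc 1 q, 1 / (r : ℝ) ^ 2)) ^ n) ∧
      (∀ n : ℕ, 1 ≤ n →
        Tendsto (fun q => ∫ ω, (iteratedIto μ ℱ (w i₁) (w i₂) t T ω -
            legendreIto μ ℱ (w i₁) (w i₂) t T q ω) ^ (2 * n) ∂μ) atTop (𝓝 0)) ∧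
      (∀ n : ℕ, 1 ≤ n →
        Tendsto (fun q => ∫ ω, (iteratedIto μ ℱ (w i₁) (w i₂) t T ω -
            trigIto μ ℱ (w i₁) (w i₂) t T q ω) ^ (2 * n) ∂μ) atTop (𝓝 0)) ∧
      -- convergence in the mean of degree `2 n`
      (∀ n : ℕ, 1 ≤ n →
        Tendsto (fun q => ∫ ω, (levyArea μ ℱ (w i₁) (w i₂) t T ω -
            legendreArea μ ℱ (w i₁) (w i₂) t T q ω) ^ (2 * n) ∂μ) atTop (𝓝 0)) ∧
      (∀ n : ℕ, 1 ≤ n →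
        Tendsto (fun q => ∫ ω, (levyArea μ ℱ (w i₁) (w i₂) t T ω -
            trigArea μ ℱ (w i₁) (w i₂) t T q ω) ^ (2 * n) ∂μ) atTop (𝓝 0)) ∧
      -- fourth-moment bound
      (∃ K : ℝ, ∀ q : ℕ, 1 ≤ q →
        ∫ ω, (iteratedIto μ ℱ (w i₁) (w i₂) t T ω -
            legendreIto μ ℱ (w i₁) (w i₂) t T q ω) ^ 4 ∂μ =
          ∫ ω, (levyArea μ ℱ (w i₁) (w i₂) t T ω -
            legendreArea μ ℱ (w i₁) (w i₂) t T q ω) ^ 4 ∂μ ∧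
        ∫ ω, (levyArea μ ℱ (w i₁) (w i₂) t T ω -
            legendreArea μ ℱ (w i₁) (w i₂) t T q ω) ^ 4 ∂μ ≤ K / (q : ℝ) ^ 2) ∧
      -- convergence with probability 1
      (∀ᵐ ω ∂μ, Tendsto (fun q => legendreArea μ ℱ (w i₁) (w i₂) t T q ω) atTop
        (𝓝 (levyArea μ ℱ (w i₁) (w i₂) t T ω))) := by 
  -- The second constant is the prefactor of the trigonometric error, whose tail is at most `1/q`;
  -- the first is generous, as the Legendre error equals `(T - t)² / (4 (2q + 1))`.
  refine ⟨1, 3 / (2 * Real.pi ^ 2), ?_⟩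
  intro Ω mΩ μ _ ℱ Θ m w hw t T ht htT hT i₁ i₂ hi
  have hL := hasChaosMoments_legendre hw hi ht htT hT
  have hTr := hasChaosMoments_trig hw hi ht htT hT
  have eL := iteratedIto_sub_legendreIto hw hi ht htT hT
  have eTr := iteratedIto_sub_trigIto hw hi ht htT hT
  have hL' := fun q => (hL q).congr (eL q)
  have hTr' := fun q => (hTr q).congr (eTr q)
  have limL := tendsto_legendreError (T - t)
  have limTr := tendsto_basel.const_mul (3 * (T - t) ^ 2 / (2 * Real.pi ^ 2))
  rw [mul_zero] at limTr
  -- The fourth moment is at most `9 E²` with `E ≤ (T - t)² / q`; this fixes the `K` used below.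
  have h4 : ∀ q : ℕ, 1 ≤ q → ∫ ω, (levyArea μ ℱ (w i₁) (w i₂) t T ω -
      legendreArea μ ℱ (w i₁) (w i₂) t T q ω) ^ 4 ∂μ ≤ 9 * ((T - t) ^ 2) ^ 2 / (q : ℝ) ^ 2 := by
    intro q hq
    refine (hL q).fourth_moment_le.trans ?_
    rw [mul_div_assoc, ← div_pow]
    have := legendreError_le (L := T - t) hq
    rw [one_mul] at this
    gcongr
    exact (hL q).nonneg
  refine ⟨⟨fun i s hs => ?_, fun i j _ => ?_, fun i j => ?_, fun i j => ?_⟩,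
    fun n q => ⟨(hL q).integrable n, (hL' q).integrable n, (hTr q).integrable n,
      (hTr' q).integrable n⟩,
    fun q => (hL q).second_moment, fun q hq => (hL q).second_moment.trans_le (legendreError_le hq),
    fun q => (hTr q).second_moment, fun q hq => (hTr q).second_moment.trans_le ?_,
    fun n q hn => (hL' q).moment_le_momentConst hn,
    fun n q hn => (hTr' q).moment_le_momentConst hn,
    fun n hn => HasChaosMoments.tendsto_moment hL' limL hn,
    fun n hn => HasChaosMoments.tendsto_moment hTr' limTr hn,
    fun n hn => HasChaosMoments.tendsto_moment hL limL hn,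
    fun n hn => HasChaosMoments.tendsto_moment hTr limTr hn,
    ⟨9 * ((T - t) ^ 2) ^ 2, fun q hq => ⟨?_, h4 q hq⟩⟩, ?_⟩
  · exact (itoIntegral_one (hw.isBrownian i) ht hs.1 (hs.2.trans hT)).1
  · exact (iteratedIto_grid (hw.isBrownian i) (hw.isBrownian j) ht htT.le hT).1
  · exact (itoIntegral_continuous (hw.isBrownian i) ht htT.le hT (continuous_legendreBasis t T j)).1
  · exact (itoIntegral_continuous (hw.isBrownian i) ht htT.le hT (continuous_trigBasis t T j)).1
  · refine (mul_le_mul_of_nonneg_left (basel_tail_le hq) (by positivity)).trans (le_of_eq ?_)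
    ring
  · refine integral_congr_ae ?_
    filter_upwards [eL q] with ω hω
    rw [hω]
  · filter_upwards [ae_tendsto_zero_of_fourth_moment (fun q => (hL q).integrable 2) h4] with ω hω
    simpa using hω.const_sub (levyArea μ ℱ (w i₁) (w i₂) t T ω)
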